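/- Let $d\ge 1$ and write $\kappa(q,p)=(X(q,p),\Xi(q,p))$ for maps of $\mathbb R^d\times\mathbb R^d$. A *canonical transformation of class $\mathcal B$* is a smooth diffeomorphism $\kappa$ of $\mathbb R^d\times\mathbb R^d$ onto itself whose Jacobian matrix $F^\kappa$ is everywhere symplectic and is bounded together with all its derivatives. An *action* of $\kappa$ is a differentiable function $S:\mathbb R^{2d}\to\mathbb R$ with $dS=-p\cdot dq+\Xi\cdot dX$. Let $\Theta^x,\Theta^y$ be complex symmetric $d\times d$ matrices with positive definite real parts, let $0<\varepsilon\le 1$, and put $$\Phi(x,y,q,p)=S(q,p)+\Xi(q,p)\cdot(x-X(q,p))-p\cdot(y-q)+\tfrac i2(x-X(q,p))\cdot\Theta^x(x-X(q,p))+\tfrac i2(y-q)\cdot\Theta^y(y-q).$$ Let $S[0;n]$ be the set of smooth functions $\mathbb R^n\to\mathbb C$ that are bounded together with all their derivatives. For $u\in S[0;4d]$, $\varphi\in\mathcal S(\mathbb R^d;\mathbb C)$ and an integer $k>d$ put $$[\mathcal I^\varepsilon(\kappa;u;\Theta^x,\Theta^y)\varphi](x)=\frac1{(2\pi\varepsilon)^{3d/2}}\int_{\mathbb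 R^{3d}}e^{\frac i\varepsilon\Phi(x,y,q,p)}(L_y^\dagger)^k[u(x,y,q,p)\varphi(y)]\,dq\,dp\,dy,$$ where $L_y^\dagger$ is the transpose, with respect to $\int v(y)w(y)\,dy$, of $L_y=(1+|\nabla_y\Phi|^2)^{-1}\bigl(1-i\varepsilon\,\overline{\nabla_y\Phi}\cdot\nabla_y\bigr)$. For $\Theta\in\{\Theta^x,\overline{\Theta^y}\}$ let $$\Lambda(\Theta)=\begin{pmatrix}(\operatorname{Re}\Theta)^{1/2}&0\\(\operatorname{Re}\Theta)^{-1/2}\operatorname{Im}\Theta&(\operatorname{Re}\Theta)^{-1/2}\end{pmatrix}.$$ For $f:\mathbb R^{2d}\to\mathbb R^{2d}$ let $c_f$ be the largest $c$ with $c|z-w|\le|f(z)-f(w)|$ for all $z,w$ (Euclidean norms), and let $$\eta_{[\kappa,\Theta^x,\Theta^y]}=\sup_{\kappa_0}\min\bigl(c_{\Lambda(\Theta^x)\circ\kappa\circ\kappa_0^{-1}},\,c_{\Lambda(\overline{\Theta^y})\circ\kappa_0^{-1}}\bigr),$$ the supremum being over all canonical transformations $\kappa_0$ of class $\mathcal B$.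 **Theorem.** (1) There is a constant $C>0$ depending only on $d$ such that the following holds for all canonical transformations $\kappa$ of class $\mathcal B$, all actions $S$ of $\kappa$, all $\Theta^x,\Theta^y$ as above, all $\lambda^x,\lambda^y>0$ with $\operatorname{Re}\Theta^x\ge\lambda^xI$ and $\operatorname{Re}\Theta^y\ge\lambda^yI$, all $u\in S[0;4d]$ and all $\varepsilon\in(0,1]$. The integrals above converge absolutely for every $k>d$; there is exactly one bounded operator on $L^2(\mathbb R^d;\mathbb C)$ that agrees with $\mathcal I^\varepsilon(\kappa;u;\Theta^x,\Theta^y)$, computed with any $k>d$, on $\mathcal S(\mathbb R^d;\mathbb C)$; and its norm satisfies $$\|\mathcal I^\varepsilon(\kappa;u;\Theta^x,\Theta^y)\|_{L^2\to L^2}\le C\left(1+\frac1{[\min(1,\lambda^x,\lambda^y)\,\eta_{[\kappa,\Theta^x,\Theta^y]}^2]^{(4d+1)/4}}\right)\frac{\sum_{|\alpha|\le4d+1}\|\partial^\alpha_{(x,y)}u\|_{L^\infty}}{(\det\operatorname{Re}\Theta^x\,\det\operatorname{Re}\Theta^y)^{1/4}}.$$ (2) If $u\in S[0;2d]$ depends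 on $(q,p)$ only, then for all such $\kappa,S,\Theta^x,\Theta^y,\varepsilon$ the unique bounded extension satisfies $$\|\mathcal I^\varepsilon(\kappa;u;\Theta^x,\Theta^y)\|_{L^2\to L^2}\le2^{-d/2}\frac{\|u\|_{L^\infty}}{(\det\operatorname{Re}\Theta^x\,\det\operatorname{Re}\Theta^y)^{1/4}}.$$ -/

import Mathlib

open MeasureTheory
open scoped ContDiff SchwartzMap RealInnerProductSpace

noncomputable section

namespace FourierOp

/-- `ℝ^d` with its Euclidean norm. -/
abbrev E (d : ℕ) : Type := EuclideanSpace ℝ (Fin d)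

/-- The phase space `T^*ℝ^d = ℝ^d × ℝ^d`, with points `(q, p)`. -/
abbrev Phase (d : ℕ) : Type := E d × E d

/-- `ℝ^{4d}`, with points `(x, y, q, p)`. -/
abbrev Var (d : ℕ) : Type := E d × E d × E d × E d

/-- The symbol class `S[0; ·]`: smooth functions all of whose derivatives are bounded. -/
structure IsBoundedSymbol {V W : Type*} [NormedAddCommGroup V] [NormedSpace ℝ V]
    [NormedAddCommGroup W] [NormedSpace ℝ W] (u : V → W) : Prop where
  smooth : ContDiff ℝ ∞ u
  bounded : ∀ k : ℕ, ∃ M : ℝ, ∀ z : V, ‖iteratedFDeriv ℝ k u z‖ ≤ M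

/-! ### Canonical transformations of class `B` and their actions -/

/-- The symplectic form `v† J w` with `J = (0, I; -I, 0)`. -/
def symplecticForm {d : ℕ} (v w : Phase d) : ℝ := ⟪v.1, w.2⟫ - ⟪v.2, w.1⟫

/-- `κ` is a smooth diffeomorphism of phase space whose Jacobian matrix is everywhere
symplectic, `F† J F = J`. -/
structure IsCanonical {d : ℕ} (κ : Phase d ≃ Phase d) : Prop where
  smooth : ContDiff ℝ ∞ κ
  smooth_symm : ContDiff ℝ ∞ κ.symm
  symplectic : ∀ z v w : Phase d,
    symplecticForm (fderiv ℝ κ z v) (fderiv ℝ κ z w) = symplecticForm v w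

/-- Class `B`: the Jacobian `F^κ` belongs to `S[0; 2d]`. -/
structure IsClassB {d : ℕ} (κ : Phase d ≃ Phase d) : Prop where
  canonical : IsCanonical κ
  jacobian : IsBoundedSymbol (fderiv ℝ κ)

/-- `S` is an action associated to `κ = (X, Ξ)`:
`∂S/∂q_j = -p_j + ∑_k (∂X_k/∂q_j) Ξ_k` and `∂S/∂p_j = ∑_k (∂X_k/∂p_j) Ξ_k`, here written as
an identity between differentials, `dS = -p · dq + Ξ · dX`. -/
structure IsAction {d : ℕ} (κ : Phase d ≃ Phase d) (S : Phase d → ℝ) : Prop where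
  differentiable : Differentiable ℝ S
  fderiv_eq : ∀ z v : Phase d,
    fderiv ℝ S z v = -⟪z.2, v.1⟫ + ⟪(κ z).2, (fderiv ℝ κ z v).1⟫

/-! ### The matrices `Θ` -/

/-- Entrywise real part. -/
def reMat {d : ℕ} (Θ : Matrix (Fin d) (Fin d) ℂ) : Matrix (Fin d) (Fin d) ℝ := Θ.map Complex.re

/-- Entrywise imaginary part. -/
def imMat {d : ℕ} (Θ : Matrix (Fin d) (Fin d) ℂ) : Matrix (Fin d) (Fin d) ℝ := Θ.map Complex.im

/-- Entrywise complex conjugate. -/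
def conjMat {d : ℕ} (Θ : Matrix (Fin d) (Fin d) ℂ) : Matrix (Fin d) (Fin d) ℂ :=
  Θ.map (starRingEnd ℂ)

/-- Complex symmetric matrices with positive definite real part. -/
structure IsAdmissible {d : ℕ} (Θ : Matrix (Fin d) (Fin d) ℂ) : Prop where
  symm : Θ.IsSymm
  posDef : (reMat Θ).PosDef

/-- The (complex bilinear) quadratic form `v · Θ v` at a real vector `v`. -/
def quad {d : ℕ} (Θ : Matrix (Fin d) (Fin d) ℂ) (v : E d) : ℂ :=
  ∑ i, ∑ j, (v i : ℂ) * Θ i j * (v j : ℂ)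

open scoped MatrixOrder in
/-- The positive square root `(Re Θ)^{1/2}`. -/
def sqrtRe {d : ℕ} (Θ : Matrix (Fin d) (Fin d) ℂ) : Matrix (Fin d) (Fin d) ℝ :=
  CFC.sqrt (reMat Θ)

/-- The linear symplectic map
`Λ(Θ) = ((Re Θ)^{1/2}, 0; (Re Θ)^{-1/2} Im Θ, (Re Θ)^{-1/2})`. -/
def Lam {d : ℕ} (Θ : Matrix (Fin d) (Fin d) ℂ) (z : Phase d) : Phase d :=
  ((sqrtRe Θ).toEuclideanLin z.1,
    ((sqrtRe Θ)⁻¹ * imMat Θ).toEuclideanLin z.1 + ((sqrtRe Θ)⁻¹).toEuclideanLin z.2)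

/-! ### The constants `c` and `η` -/

/-- The Euclidean norm of `(q, p) ∈ ℝ^{2d}` (the product type carries the sup norm). -/
def phaseNorm {d : ℕ} (z : Phase d) : ℝ := Real.sqrt (‖z.1‖ ^ 2 + ‖z.2‖ ^ 2)

/-- `c_f`: the best constant `c` in `c ‖z - w‖ ≤ ‖f z - f w‖`. -/
def lowerLip {d : ℕ} (f : Phase d → Phase d) : ℝ :=
  sSup {c : ℝ | ∀ z w : Phase d, c * phaseNorm (z - w) ≤ phaseNorm (f z - f w)}

/-- `η_{[κ, Θ^x, Θ^y]}`: the best value, over all canonical transformations `κ₀` of class `B`,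
of the smaller of the two constants of `Λ(Θ^x) ∘ κ ∘ κ₀⁻¹` and `Λ(conj Θ^y) ∘ κ₀⁻¹`. -/
def eta {d : ℕ} (κ : Phase d ≃ Phase d) (Θx Θy : Matrix (Fin d) (Fin d) ℂ) : ℝ :=
  ⨆ κ₀ : {κ₀ : Phase d ≃ Phase d // IsClassB κ₀},
    min (lowerLip (fun z => Lam Θx (κ (κ₀.1.symm z))))
      (lowerLip (fun z => Lam (conjMat Θy) (κ₀.1.symm z)))

/-! ### Norms of symbols -/

/-- The derivative of `f` in the fixed direction `v`. -/
def dirDeriv {V : Type*} [NormedAddCommGroup V] [NormedSpace ℝ V] (v : V) (f : V → ℂ) : V → ℂ :=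
  fun z => fderiv ℝ f z v

/-- The coordinate directions of `x` (left) and of `y` (right) in `ℝ^{4d}`. -/
def xyDir {d : ℕ} : Fin d ⊕ Fin d → Var d
  | Sum.inl i => (EuclideanSpace.single i 1, 0, 0, 0)
  | Sum.inr i => (0, EuclideanSpace.single i 1, 0, 0)

/-- `∂^α_{(x,y)} u` for a multi-index `α ∈ ℕ^{2d}`. -/
def xyDeriv {d : ℕ} (α : Fin d ⊕ Fin d → ℕ) (u : Var d → ℂ) : Var d → ℂ :=
  ((List.finRange d).map Sum.inl ++ (List.finRange d).map Sum.inr).foldr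
    (fun j g => (dirDeriv (xyDir j))^[α j] g) u

/-- `∑_{|α| ≤ N} ‖∂^α_{(x,y)} u‖_∞`. -/
def xyNorm {d : ℕ} (N : ℕ) (u : Var d → ℂ) : ℝ :=
  ∑ n ∈ Finset.range (N + 1),
    ∑ α ∈ Finset.piAntidiag (Finset.univ : Finset (Fin d ⊕ Fin d)) n, ⨆ z : Var d, ‖xyDeriv α u z‖

/-! ### The operator -/

/-- The complex phase
`S(q,p) + Ξ·(x - X) - p·(y - q) + (i/2)(x - X)·Θ^x(x - X) + (i/2)(y - q)·Θ^y(y - q)`,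
where `(X, Ξ) = κ(q,p)`. -/
def phase {d : ℕ} (κ : Phase d ≃ Phase d) (S : Phase d → ℝ) (Θx Θy : Matrix (Fin d) (Fin d) ℂ)
    (x y q p : E d) : ℂ :=
  ((S (q, p) + ⟪(κ (q, p)).2, x - (κ (q, p)).1⟫ - ⟪p, y - q⟫ : ℝ) : ℂ)
    + Complex.I / 2 * quad Θx (x - (κ (q, p)).1) + Complex.I / 2 * quad Θy (y - q)

/-- `1 + |∇F|²`. -/
def gradWeight {d : ℕ} (F : E d → ℂ) (y : E d) : ℝ :=
  1 + ∑ j, ‖dirDeriv (EuclideanSpace.single j 1) F y‖ ^ 2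

/-- The transpose `L†`, with respect to `∫ v w dy`, of the first order operator
`L = (1 + |∇F|²)⁻¹ (1 - i ε conj(∇F) · ∇)`, that is
`L† w = w / (1 + |∇F|²) + i ε div (conj(∇F) w / (1 + |∇F|²))`. -/
def transposeL {d : ℕ} (ε : ℝ) (F : E d → ℂ) (w : E d → ℂ) : E d → ℂ := fun y =>
  w y / (gradWeight F y : ℂ) + Complex.I * (ε : ℂ) *
    ∑ j, dirDeriv (EuclideanSpace.single j 1)
      (fun y' => (starRingEnd ℂ) (dirDeriv (EuclideanSpace.single j 1) F y') * w y'
        / (gradWeight F y' : ℂ)) y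

/-- The integrand `e^{iΦ/ε} (L_y†)^k [u φ]`, as a function of `(q, p, y) ∈ ℝ^{3d}`. -/
def integrand {d : ℕ} (ε : ℝ) (κ : Phase d ≃ Phase d) (S : Phase d → ℝ) (u : Var d → ℂ)
    (Θx Θy : Matrix (Fin d) (Fin d) ℂ) (k : ℕ) (φ : 𝓢(E d, ℂ)) (x : E d) :
    E d × E d × E d → ℂ := fun (q, p, y) =>
  Complex.exp (Complex.I / (ε : ℂ) * phase κ S Θx Θy x y q p) *
    (transposeL ε (fun y' => phase κ S Θx Θy x y' q p))^[k] (fun y' => u (x, y', q, p) * φ y') y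

/-- The semiclassical Fourier integral operator `I^ε(κ; u; Θ^x, Θ^y)` on Schwartz functions,
defined by the integral regularised with `k` integrations by parts. For bounded symbols every
`k > d` is allowed. -/
def fio {d : ℕ} (ε : ℝ) (κ : Phase d ≃ Phase d) (S : Phase d → ℝ) (u : Var d → ℂ)
    (Θx Θy : Matrix (Fin d) (Fin d) ℂ) (k : ℕ) (φ : 𝓢(E d, ℂ)) (x : E d) : ℂ :=
  (((2 * Real.pi * ε) ^ (3 * (d : ℝ) / 2))⁻¹ : ℝ) * ∫ z, integrand ε κ S u Θx Θy k φ x z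

/-- `L²(ℝ^d; ℂ)`. -/
abbrev L2 (d : ℕ) : Type := Lp ℂ 2 (volume : Measure (E d))

/-- The bounded operator `T` on `L²` extends `I^ε(κ; u; Θ^x, Θ^y)` from Schwartz functions
(computed with any admissible number `k > d` of integrations by parts). -/
def IsL2Extension {d : ℕ} (ε : ℝ) (κ : Phase d ≃ Phase d) (S : Phase d → ℝ) (u : Var d → ℂ)
    (Θx Θy : Matrix (Fin d) (Fin d) ℂ) (T : L2 d →L[ℂ] L2 d) : Prop :=
  ∀ k : ℕ, d < k → ∀ φ : 𝓢(E d, ℂ),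
    (T (φ.toLp 2 volume) : E d → ℂ) =ᵐ[volume] fio ε κ S u Θx Θy k φ

end FourierOp

end

/-! Paired with a test function `ψ`, and with the phase space integral done last, the operator
becomes a product of wave packet transforms. At each `w = (q, p)` the kernel `e^{iΦ/ε}` splits
(`kern_eq`) into the unimodular factor `e^{iS(w)/ε}`, a packet in `x` attached to `κ w` and a packet
in `y` attached to `w`. For fixed `q` a packet transform is a Fourier transform in `p` of a function
times a Gaussian, so Plancherel followed by Gaussian integration in `q` bounds it on `L²`
(`lintegral_packetTransform_sq_le'`). A canonical transformation preserves Lebesgue measure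
(`IsCanonical.lintegral_comp`), and Cauchy-Schwarz in `w` gives the estimate for symbols depending
on `(q, p)` only, with the exact constant `2^{-d/2}`.

A symbol depending on `(x, y)` is first separated. The product `B` of the operators `1 - ∂_j²` over
the `2d` coordinates of `(x, y)` has as Green function a product of exponentials, so `u` is a
superposition over `(r, r')` of `green (r - x) * green (r' - y)` with amplitude `B u`
(`IsBoundedSymbol.integral_xyBessel`). Here `|B u|` is at most `4^d` times the symbol norm. For each
`(r, r')` the variables `x` and `y` are decoupled again, and it remains to bound in `L²(dw)` the
integral over `r` of the localised packet transforms (`lintegral_totalTransform_sq_le`).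
Cauchy-Schwarz in `r` with the weight `exp(√μ |r - q|₁)`, `μ = min(1, λ^x, λ^y)`, does this: the
triangle inequality distributes the weight over the Green function and the Gaussian, which absorb
it. The price is `μ^{-d/2}`, uniformly in `ε ≤ 1`.

The constant `η` lies in `(0, 1]`, since a symplectic map cannot expand all distances by a factor
above one. Hence `μ^{-d/2}` is at most the power of `μ η²` in the theorem (`rpow_neg_le_one_add`).

The regularised integral is tied to this picture by integration by parts in `y`. Since `L`
reproduces `e^{iΦ/ε}`, the `y`-integral is the same for every `k`, while `k > d` factors `(1 +
|∇_yΦ|²)^{-1/2}` make the full integral absolutely convergent (`integral_kern_iterate`,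
`integrable_integrand`, `fio_eq`). Duality and density of Schwartz functions then give the operator
(`existsUnique_extension`). -/

noncomputable section

namespace FourierOp

open FourierTransform ENNReal

/-! ### Plancherel bounds for oscillatory integrals -/

/-- Plancherel's theorem for functions in `L¹ ∩ L²`. -/
theorem eLpNorm_fourier_eq {V : Type*} [NormedAddCommGroup V] [InnerProductSpace ℝ V]
    [FiniteDimensional ℝ V] [MeasurableSpace V] [BorelSpace V] {f : V → ℂ}
    (hf : Integrable f) (hf2 : MemLp f 2) :
    eLpNorm (𝓕 f) 2 volume = eLpNorm f 2 volume := by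
  set F : Lp ℂ 2 (volume : Measure V) := hf2.toLp f
  have hcont : Continuous (𝓕 f) :=
    VectorFourier.fourierIntegral_continuous Real.continuous_fourierChar
      (by exact continuous_inner) hf
  have hae : (𝓕 f) =ᵐ[volume] ((𝓕 F : Lp ℂ 2 (volume : Measure V)) : V → ℂ) := by
    -- The `L²` transform is accessible through its action on Schwartz functions, so the two
    -- transforms are compared by pairing with smooth compactly supported `g` and moving the Fourier
    -- transform onto `g`.
    apply ae_eq_of_integral_contDiff_smul_eq hcont.locallyIntegrable
    · exact ((Lp.memLp (𝓕 F)).locallyIntegrable (by norm_num))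
    intro g hg hgs
    have hgc : ContDiff ℝ ∞ (fun x => (g x : ℂ)) := Complex.ofRealCLM.contDiff.comp hg
    have hgcs : HasCompactSupport (fun x => (g x : ℂ)) := hgs.comp_left (g := fun r : ℝ => (r : ℂ)) rfl
    let G : 𝓢(V, ℂ) := hgcs.toSchwartzMap hgc
    have hG : ∀ x, G x = g x := fun x => rfl
    have h1 := Lp.fourier_toTemperedDistribution_eq F
    have h2 := DFunLike.congr_fun h1 G
    rw [TemperedDistribution.fourier_apply] at h2
    have e1 : (F : 𝓢'(V, ℂ)) (𝓕 G) = ∫ x, (𝓕 G) x • F x := by simp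
    have e2 : ((𝓕 F : Lp ℂ 2 (volume : Measure V)) : 𝓢'(V, ℂ)) G = ∫ x, G x • (𝓕 F : Lp ℂ 2 (volume : Measure V)) x := by
      simp only [Lp.toTemperedDistribution_apply]
    rw [e1, e2] at h2
    have e3 : ∫ x, g x • (𝓕 f) x = ∫ x, G x • (𝓕 f) x := by
      simp [hG]
    have e4 : ∫ x, g x • (𝓕 F : Lp ℂ 2 (volume : Measure V)) x = ∫ x, G x • (𝓕 F : Lp ℂ 2 (volume : Measure V)) x := by
      simp [hG]
    rw [e3, e4, ← h2]
    have e5 := VectorFourier.integral_fourierIntegral_smul_eq_flip (L := innerₗ V) (μ := volume)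
      (ν := volume) (f := (G : V → ℂ)) (g := f) Real.continuous_fourierChar
      (by exact continuous_inner) G.integrable hf
    have e6 : ∫ x, (𝓕 G) x • F x = ∫ x, (𝓕 G) x • f x := by
      apply integral_congr_ae
      filter_upwards [hf2.coeFn_toLp] with x hx
      rw [hx]
    rw [e6]
    rw [flip_innerₗ] at e5
    exact e5.symm
  rw [eLpNorm_congr_ae hae]
  have := Lp.norm_fourier_eq F
  rw [Lp.norm_def, Lp.norm_def, ENNReal.toReal_eq_toReal_iff' (Lp.eLpNorm_ne_top _) (Lp.eLpNorm_ne_top _)] at this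
  rw [this, eLpNorm_congr_ae hf2.coeFn_toLp]

theorem lintegral_fourier_sq_le {V : Type*} [NormedAddCommGroup V] [InnerProductSpace ℝ V]
    [FiniteDimensional ℝ V] [MeasurableSpace V] [BorelSpace V] {f : V → ℂ}
    (hf : Integrable f) : ∫⁻ ξ, ‖𝓕 f ξ‖ₑ ^ 2 ≤ ∫⁻ x, ‖f x‖ₑ ^ 2 := by
  by_cases h : ∫⁻ x, ‖f x‖ₑ ^ 2 = ⊤
  · rw [h]; exact le_top
  have hp : ∀ g : V → ℂ, eLpNorm g 2 volume ^ 2 = ∫⁻ x, ‖g x‖ₑ ^ 2 := by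
    intro g
    have := eLpNorm_nnreal_pow_eq_lintegral (f := g) (μ := volume) (p := 2) (by norm_num)
    simpa using this
  have hm : MemLp f 2 := by
    refine ⟨hf.1, lt_top_iff_ne_top.2 fun h' => h ?_⟩
    rw [← hp, h']; simp
  rw [← hp, ← hp, eLpNorm_fourier_eq hf hm]

/-- Semiclassical Plancherel inequality. -/
theorem lintegral_oscillatory_sq_le {d : ℕ} {h : E d → ℂ} (hh : Integrable h) (q : E d)
    {τ : ℝ} (hτ : τ ≠ 0) :
    ∫⁻ p : E d, ‖∫ y, h y * Complex.exp (Complex.I * (τ * ⟪p, y - q⟫ : ℝ))‖ₑ ^ 2 ≤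
      ENNReal.ofReal ((2 * Real.pi / |τ|) ^ d) * ∫⁻ y, ‖h y‖ₑ ^ 2 := by
  -- The Fourier transform uses the character `e^{-2πi⟨y, ξ⟩}`, so the frequency is `ξ = c p`. The
  -- leftover factor `e^{-iτ⟨p, q⟩}` is unimodular, and the dilation by `c` produces `(2π/|τ|)^d`.
  set c : ℝ := -(τ / (2 * Real.pi)) with hc
  have hc0 : c ≠ 0 := by rw [hc]; simp [hτ, Real.pi_ne_zero]
  have key : ∀ p : E d, ‖∫ y, h y * Complex.exp (Complex.I * (τ * ⟪p, y - q⟫ : ℝ))‖ₑ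
      = ‖𝓕 h (c • p)‖ₑ := by
    intro p
    have : ∫ y, h y * Complex.exp (Complex.I * (τ * ⟪p, y - q⟫ : ℝ)) =
        Complex.exp (((-τ * ⟪p, q⟫ : ℝ) : ℂ) * Complex.I) * 𝓕 h (c • p) := by
      rw [Real.fourier_eq', ← integral_const_mul]
      congr 1; ext y
      rw [smul_eq_mul, ← mul_assoc, ← Complex.exp_add, mul_comm]
      congr 2
      rw [inner_smul_right, inner_sub_right, real_inner_comm y p, hc]
      push_cast
      have : (Real.pi : ℂ) ≠ 0 := by exact_mod_cast Real.pi_ne_zero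
      field_simp
      ring
    rw [this, enorm_mul]
    have : ‖Complex.exp (((-τ * ⟪p, q⟫ : ℝ) : ℂ) * Complex.I)‖ₑ = 1 := by
      rw [← ofReal_norm, Complex.norm_exp_ofReal_mul_I]; simp
    rw [this, one_mul]
  simp_rw [key]
  have hcont : Continuous (𝓕 h) :=
    VectorFourier.fourierIntegral_continuous Real.continuous_fourierChar
      (by exact continuous_inner) hh
  have hmeas : Measurable (fun x => ‖𝓕 h x‖ₑ ^ 2) := by fun_prop
  have hmap := Measure.map_addHaar_smul (volume : Measure (E d)) hc0
  have : ∫⁻ p : E d, ‖𝓕 h (c • p)‖ₑ ^ 2 =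
      ENNReal.ofReal ((2 * Real.pi / |τ|) ^ d) * ∫⁻ p : E d, ‖𝓕 h p‖ₑ ^ 2 := by
    rw [← lintegral_map (f := fun x => ‖𝓕 h x‖ₑ ^ 2) (g := fun p : E d => c • p) hmeas (by fun_prop)]
    have : Measure.map (fun p : E d => c • p) volume = ENNReal.ofReal |(c ^ Module.finrank ℝ (E d))⁻¹| • volume := hmap
    rw [this, lintegral_smul_measure, smul_eq_mul]
    congr 2
    rw [finrank_euclideanSpace_fin, abs_inv, abs_pow, ← inv_pow, hc, abs_neg, abs_div, inv_div,
      abs_of_pos (by positivity : 0 < 2 * Real.pi)]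
  rw [this]
  exact mul_le_mul' le_rfl (lintegral_fourier_sq_le hh)

/-! ### Gaussians -/

section Gaussian

variable {d : ℕ} {Θ : Matrix (Fin d) (Fin d) ℂ}

theorem quad_re (Θ : Matrix (Fin d) (Fin d) ℂ) (v : E d) :
    (quad Θ v).re = ⟪v, (reMat Θ).toEuclideanLin v⟫ := by
  simp only [quad, Complex.re_sum, PiLp.inner_apply, Matrix.ofLp_toLpLin, Matrix.toLin'_apply,
    Matrix.mulVec, dotProduct, reMat, Matrix.map_apply]
  refine Finset.sum_congr rfl fun i _ => ?_
  simp only [RCLike.inner_apply, conj_trivial, Finset.sum_mul]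
  refine Finset.sum_congr rfl fun j _ => ?_
  simp
  ring

open scoped MatrixOrder in
theorem sqrtRe_mul_self (h : (reMat Θ).PosDef) : sqrtRe Θ * sqrtRe Θ = reMat Θ :=
  CFC.sqrt_mul_sqrt_self _ h.posSemidef.nonneg

open scoped MatrixOrder in
theorem sqrtRe_posSemidef (Θ : Matrix (Fin d) (Fin d) ℂ) : (sqrtRe Θ).PosSemidef :=
  Matrix.nonneg_iff_posSemidef.1 (CFC.sqrt_nonneg _)

theorem sqrtRe_isSymmetric (Θ : Matrix (Fin d) (Fin d) ℂ) (v w : E d) :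
    ⟪(sqrtRe Θ).toEuclideanLin v, w⟫ = ⟪v, (sqrtRe Θ).toEuclideanLin w⟫ :=
  (Matrix.isSymmetric_toEuclideanLin_iff.2 (sqrtRe_posSemidef Θ).1) v w

theorem toEuclideanLin_mul_apply (A B : Matrix (Fin d) (Fin d) ℝ) (v : E d) :
    (A * B).toEuclideanLin v = A.toEuclideanLin (B.toEuclideanLin v) := by
  simp [Matrix.toLpLin_apply]

theorem quad_re_eq_norm_sq (h : (reMat Θ).PosDef) (v : E d) :
    (quad Θ v).re = ‖(sqrtRe Θ).toEuclideanLin v‖ ^ 2 := by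
  rw [quad_re, ← sqrtRe_mul_self h, toEuclideanLin_mul_apply, ← sqrtRe_isSymmetric,
    real_inner_self_eq_norm_sq]

theorem quad_re_nonneg (h : (reMat Θ).PosDef) (v : E d) : 0 ≤ (quad Θ v).re := by
  rw [quad_re_eq_norm_sq h]; positivity

theorem mul_norm_sq_le_quad_re {l : ℝ}
    (h : (reMat Θ - l • (1 : Matrix (Fin d) (Fin d) ℝ)).PosSemidef) (v : E d) :
    l * ‖v‖ ^ 2 ≤ (quad Θ v).re := by
  have := (Matrix.isPositive_toEuclideanLin_iff.2 h).re_inner_nonneg_right v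
  rw [quad_re]
  simp only [map_sub, map_smul, LinearMap.sub_apply, LinearMap.smul_apply, inner_sub_right,
    inner_smul_right] at this
  have h1 : (1 : Matrix (Fin d) (Fin d) ℝ).toEuclideanLin v = v := by
    simp
  rw [h1, real_inner_self_eq_norm_sq] at this
  simp at this
  linarith

theorem continuous_quad (Θ : Matrix (Fin d) (Fin d) ℂ) : Continuous (quad Θ) := by
  unfold quad; fun_prop

open scoped MatrixOrder in
theorem det_sqrtRe (h : (reMat Θ).PosDef) : (sqrtRe Θ).det = (reMat Θ).det ^ (1 / 2 : ℝ) := by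
  have h1 : (sqrtRe Θ).det * (sqrtRe Θ).det = (reMat Θ).det := by
    rw [← Matrix.det_mul, sqrtRe_mul_self h]
  have h2 : 0 ≤ (sqrtRe Θ).det := (sqrtRe_posSemidef Θ).det_nonneg
  rw [← h1, ← Real.sqrt_eq_rpow, Real.sqrt_mul_self h2]

/-- The substitution `w = (Re Θ)^{1/2} z` reduces this to the isotropic Gaussian; its Jacobian is
the source of the determinants in the final bounds. -/
theorem lintegral_exp_neg_quad (h : (reMat Θ).PosDef) {b : ℝ} (hb : 0 < b) :
    ∫⁻ z : E d, ENNReal.ofReal (Real.exp (-b * (quad Θ z).re)) =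
      ENNReal.ofReal ((Real.pi / b) ^ ((d : ℝ) / 2) * ((reMat Θ).det ^ (1 / 2 : ℝ))⁻¹) := by
  set A := (sqrtRe Θ).toEuclideanLin with hA
  have hdet : LinearMap.det A = (reMat Θ).det ^ (1 / 2 : ℝ) := by
    rw [hA, Matrix.toEuclideanLin, Matrix.toLpLin_eq_toLin, LinearMap.det_toLin, det_sqrtRe h]
  have hpos : 0 < (reMat Θ).det ^ (1 / 2 : ℝ) := Real.rpow_pos_of_pos h.det_pos _
  have hdet0 : LinearMap.det A ≠ 0 := by rw [hdet]; exact hpos.ne'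
  have hmap := Measure.map_linearMap_addHaar_eq_smul_addHaar (volume : Measure (E d)) hdet0
  have hmA : Measurable A := A.continuous_of_finiteDimensional.measurable
  simp_rw [quad_re_eq_norm_sq h]
  rw [← lintegral_map (f := fun w : E d => ENNReal.ofReal (Real.exp (-b * ‖w‖ ^ 2)))
    (g := A) (by fun_prop) hmA, hmap, lintegral_smul_measure, smul_eq_mul,
    ← ofReal_integral_eq_lintegral_ofReal, GaussianFourier.integral_rexp_neg_mul_sq_norm hb,
    ← ENNReal.ofReal_mul (by positivity), hdet, abs_of_pos (by positivity), mul_comm]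
  · simp
  · have := GaussianFourier.integrable_cexp_neg_mul_sq_norm_add (V := E d) (b := b) (by simpa using hb) 0 0
    have h2 := this.norm
    refine h2.congr (Filter.Eventually.of_forall fun v => ?_)
    simp only [Complex.norm_exp]
    congr 1
    simp [← Complex.ofReal_pow]
  · exact Filter.Eventually.of_forall fun v => (Real.exp_pos _).le

end Gaussian

end FourierOp
end

noncomputable section

namespace FourierOp

open ENNReal

/-! ### Symplectic maps -/

section Symplectic

variable {d : ℕ}

theorem phaseNorm_sq (z : Phase d) : phaseNorm z ^ 2 = ‖z.1‖ ^ 2 + ‖z.2‖ ^ 2 :=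
  Real.sq_sqrt (by positivity)

theorem phaseNorm_nonneg (z : Phase d) : 0 ≤ phaseNorm z := Real.sqrt_nonneg _

theorem norm_le_phaseNorm (z : Phase d) : ‖z‖ ≤ phaseNorm z := by
  rw [Prod.norm_def]
  refine max_le ?_ ?_ <;> refine Real.le_sqrt_of_sq_le ?_ <;> nlinarith [sq_nonneg ‖z.1‖, sq_nonneg ‖z.2‖]

theorem phaseNorm_le_two_mul_norm (z : Phase d) : phaseNorm z ≤ 2 * ‖z‖ := by
  refine Real.sqrt_le_iff.2 ⟨by positivity, ?_⟩
  have h1 := norm_fst_le z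
  have h2 := norm_snd_le z
  nlinarith [norm_nonneg z.1, norm_nonneg z.2, norm_nonneg z]

theorem phaseNorm_smul (c : ℝ) (z : Phase d) : phaseNorm (c • z) = |c| * phaseNorm z := by
  rw [← Real.sqrt_sq (phaseNorm_nonneg (c • z)), phaseNorm_sq, ← abs_of_nonneg (phaseNorm_nonneg z),
    ← abs_mul, ← Real.sqrt_sq_eq_abs, mul_pow, phaseNorm_sq]
  simp [norm_smul, mul_pow, mul_add]

theorem continuous_phaseNorm : Continuous (phaseNorm (d := d)) := by
  unfold phaseNorm; fun_prop

theorem phaseNorm_pos {z : Phase d} (hz : z ≠ 0) : 0 < phaseNorm z :=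
  (norm_pos_iff.2 hz).trans_le (norm_le_phaseNorm z)

/-- Cauchy-Schwarz in each component, then in the plane: the defect in the last step is the square
of `‖v.1‖‖w.1‖ - ‖v.2‖‖w.2‖`. -/
theorem abs_symplecticForm_le (v w : Phase d) :
    |symplecticForm v w| ≤ phaseNorm v * phaseNorm w := by
  have h1 := abs_real_inner_le_norm v.1 w.2
  have h2 := abs_real_inner_le_norm v.2 w.1
  have h3 : |symplecticForm v w| ≤ ‖v.1‖ * ‖w.2‖ + ‖v.2‖ * ‖w.1‖ :=
    (abs_sub _ _).trans (add_le_add h1 h2)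
  refine h3.trans (abs_le_of_sq_le_sq' ?_ (mul_nonneg (phaseNorm_nonneg _) (phaseNorm_nonneg _))).2
  rw [mul_pow, phaseNorm_sq, phaseNorm_sq]
  nlinarith [sq_nonneg (‖v.1‖ * ‖w.1‖ - ‖v.2‖ * ‖w.2‖)]

/-- Rotation by the standard complex structure. -/
def rot (v : Phase d) : Phase d := (-v.2, v.1)

theorem phaseNorm_rot (v : Phase d) : phaseNorm (rot v) = phaseNorm v := by
  simp [phaseNorm, rot, add_comm]

theorem symplecticForm_rot (v : Phase d) : symplecticForm v (rot v) = phaseNorm v ^ 2 := by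
  simp [symplecticForm, rot, phaseNorm_sq]

/-- The symplectic form as a bilinear form. -/
def symplecticBilin (d : ℕ) : LinearMap.BilinForm ℝ (Phase d) :=
  LinearMap.mk₂ ℝ symplecticForm
    (fun a b c => by simp [symplecticForm, inner_add_left]; ring)
    (fun a b c => by simp [symplecticForm, inner_smul_left]; ring)
    (fun a b c => by simp [symplecticForm, inner_add_right]; ring)
    (fun a b c => by simp [symplecticForm, inner_smul_right]; ring)

theorem symplecticBilin_apply (v w : Phase d) : symplecticBilin d v w = symplecticForm v w := rfl

theorem injective_of_symplectic (A : Phase d →ₗ[ℝ] Phase d)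
    (h : ∀ v w, symplecticForm (A v) (A w) = symplecticForm v w) : Function.Injective A := by
  rw [injective_iff_map_eq_zero]
  intro v hv
  have h1 := h v (rot v)
  rw [hv, symplecticForm_rot] at h1
  by_contra hne
  have := phaseNorm_pos hne
  simp [symplecticForm] at h1
  exact this.ne' (by simpa using h1.symm)

/-- In matrices, `Aᵀ J A = J` with `det J ≠ 0` forces `(det A)² = 1`. Nondegeneracy is seen by
pairing `v` with `rot v`. -/
theorem abs_det_of_symplectic (A : Phase d →ₗ[ℝ] Phase d)
    (h : ∀ v w, symplecticForm (A v) (A w) = symplecticForm v w) : |LinearMap.det A| = 1 := by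
  set b := Module.finBasis ℝ (Phase d)
  have h1 : (symplecticBilin d).comp A A = symplecticBilin d := by
    ext v w <;> simp [symplecticBilin_apply, h]
  have h2 := congrArg (fun B => (LinearMap.BilinForm.toMatrix b B).det) h1
  simp only [LinearMap.BilinForm.toMatrix_comp b b, Matrix.det_mul, Matrix.det_transpose, LinearMap.det_toMatrix] at h2
  have hnd : (symplecticBilin d).Nondegenerate := by
    refine ⟨fun v hv => ?_, fun v hv => ?_⟩
    · by_contra hne
      have := hv (rot v)
      rw [symplecticBilin_apply, symplecticForm_rot] at this
      exact (phaseNorm_pos hne).ne' (by simpa using this)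
    · by_contra hne
      have := hv (rot v)
      have h3 : symplecticBilin d (rot v) v = - phaseNorm v ^ 2 := by
        rw [symplecticBilin_apply, ← symplecticForm_rot]
        simp only [symplecticForm, real_inner_comm]
        ring
      rw [h3] at this
      exact (phaseNorm_pos hne).ne' (by simpa using this)
  have hdet := (LinearMap.BilinForm.nondegenerate_iff_det_ne_zero b).1 hnd
  have h4 : LinearMap.det A * LinearMap.det A = 1 := by
    apply mul_right_cancel₀ hdet
    linarith
  rcases mul_self_eq_one_iff.1 h4 with h5 | h5 <;> simp [h5]

theorem surjective_of_symplectic (A : Phase d →ₗ[ℝ] Phase d)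
    (h : ∀ v w, symplecticForm (A v) (A w) = symplecticForm v w) : Function.Surjective A :=
  LinearMap.surjective_of_injective (injective_of_symplectic A h)

/-- A symplectic linear map cannot expand all lengths by a factor larger than one. -/
theorem le_one_of_symplectic (hd : 1 ≤ d) (A : Phase d →ₗ[ℝ] Phase d)
    (h : ∀ v w, symplecticForm (A v) (A w) = symplecticForm v w) {c : ℝ}
    (hc : ∀ v, c * phaseNorm v ≤ phaseNorm (A v)) : c ≤ 1 := by
  by_contra! hc1
  let v : Phase d := (EuclideanSpace.single ⟨0, hd⟩ 1, 0)
  have hv : phaseNorm v = 1 := by simp [phaseNorm, v]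
  -- With `A w = rot (A v)` and `|v| = 1`, invariance of the form gives `|A v|² ≤ |w|`, while
  -- expansion gives `c |w| ≤ |A v|`. Hence `c |A v| ≤ 1`, which contradicts `|A v| ≥ c > 1`.
  obtain ⟨w, hw⟩ := surjective_of_symplectic A h (rot (A v))
  have h1 : phaseNorm (A v) ^ 2 = symplecticForm v w := by
    rw [← symplecticForm_rot, ← hw, h]
  have h2 := (le_abs_self _).trans (abs_symplecticForm_le v w)
  have h3 := hc w
  have h4 := hc v
  rw [hw, phaseNorm_rot] at h3
  rw [← h1, hv, one_mul] at h2
  rw [hv, mul_one] at h4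
  nlinarith [phaseNorm_nonneg w]

/-- The inverse of a symplectic linear map is bounded by the same constant. -/
theorem phaseNorm_le_of_symplectic (A : Phase d →ₗ[ℝ] Phase d)
    (h : ∀ v w, symplecticForm (A v) (A w) = symplecticForm v w) {K : ℝ}
    (hK : ∀ v, phaseNorm (A v) ≤ K * phaseNorm v) (v : Phase d) :
    phaseNorm v ≤ K * phaseNorm (A v) := by
  by_cases hv : v = 0
  · subst hv; simp [phaseNorm]
  have hpos := phaseNorm_pos hv
  -- Duality through the form: `|v|² = ω(A v, A (rot v)) ≤ |A v| K |v|`.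
  have h1 : phaseNorm v ^ 2 = symplecticForm (A v) (A (rot v)) := by rw [h, symplecticForm_rot]
  have h2 := (le_abs_self _).trans (abs_symplecticForm_le (A v) (A (rot v)))
  have h3 := hK (rot v)
  rw [phaseNorm_rot] at h3
  rw [← h1] at h2
  have h4 : phaseNorm v * phaseNorm v ≤ (K * phaseNorm (A v)) * phaseNorm v := by
    nlinarith [phaseNorm_nonneg (A v)]
  exact le_of_mul_le_mul_right h4 hpos

/-! ### Canonical transformations -/

theorem IsCanonical.differentiable {κ : Phase d ≃ Phase d} (h : IsCanonical κ) :
    Differentiable ℝ κ := h.smooth.differentiable (by simp)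

/-- Liouville's theorem. Beyond continuity, this is all that the `L²` estimates need from `κ`. -/
theorem IsCanonical.lintegral_comp {κ : Phase d ≃ Phase d} (h : IsCanonical κ)
    (g : Phase d → ℝ≥0∞) : ∫⁻ z, g (κ z) = ∫⁻ z, g z := by
  have : (volume : Measure (Phase d)).IsAddHaarMeasure :=
    Measure.prod.instIsAddHaarMeasure volume volume
  have h1 := lintegral_image_eq_lintegral_abs_det_fderiv_mul (volume : Measure (Phase d))
    MeasurableSet.univ (f := κ) (f' := fderiv ℝ κ)
    (fun x _ => (h.differentiable x).hasFDerivAt.hasFDerivWithinAt) κ.injective.injOn g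
  rw [Set.image_univ, κ.surjective.range_eq, Measure.restrict_univ] at h1
  rw [h1]
  congr 1; ext z
  have : |(fderiv ℝ κ z).det| = 1 := abs_det_of_symplectic (fderiv ℝ κ z : Phase d →ₗ[ℝ] Phase d) (h.symplectic z)
  rw [this]; simp

theorem IsCanonical.symplectic_symm {κ : Phase d ≃ Phase d} (h : IsCanonical κ) :
    IsCanonical κ.symm := by
  refine ⟨h.smooth_symm, h.smooth, fun z v w => ?_⟩
  have hd : Differentiable ℝ κ.symm := h.smooth_symm.differentiable (by simp)
  have hc : ∀ v, fderiv ℝ κ (κ.symm z) (fderiv ℝ κ.symm z v) = v := by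
    intro v
    have h1 := fderiv_comp z (h.differentiable (κ.symm z)) (hd z)
    have h2 : (κ ∘ κ.symm : Phase d → Phase d) = id := by ext x <;> simp
    rw [h2, fderiv_id] at h1
    have := DFunLike.congr_fun h1 v
    simpa using this.symm
  rw [← h.symplectic (κ.symm z), hc, hc]

/-- The linear map `Λ(Θ)`. -/
def LamL (Θ : Matrix (Fin d) (Fin d) ℂ) : Phase d →ₗ[ℝ] Phase d where
  toFun := Lam Θ
  map_add' a b := by
    simp only [Lam, Prod.fst_add, Prod.snd_add, map_add, Prod.mk_add_mk, Prod.mk.injEq, true_and]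
    abel
  map_smul' c a := by
    simp only [Lam, Prod.smul_fst, Prod.smul_snd, map_smul, Prod.smul_mk, smul_add, RingHom.id_apply]

/-- `(Re Θ)^{1/2}` is symmetric and invertible, so it pairs with its inverse to the identity, and
the two terms containing `Im Θ` cancel because `Im Θ` is symmetric. -/
theorem Lam_symplectic {Θ : Matrix (Fin d) (Fin d) ℂ} (hΘ : IsAdmissible Θ) (v w : Phase d) :
    symplecticForm (Lam Θ v) (Lam Θ w) = symplecticForm v w := by
  have hR : IsUnit (sqrtRe Θ).det := by
    rw [det_sqrtRe hΘ.posDef]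
    exact (Real.rpow_pos_of_pos hΘ.posDef.det_pos _).ne'.isUnit
  have h1 : ∀ a b : E d, ⟪(sqrtRe Θ).toEuclideanLin a, ((sqrtRe Θ)⁻¹).toEuclideanLin b⟫ = ⟪a, b⟫ := by
    intro a b
    rw [sqrtRe_isSymmetric, ← toEuclideanLin_mul_apply, Matrix.mul_nonsing_inv _ hR]
    simp
  have h2 : ∀ a b : E d, ⟪(imMat Θ).toEuclideanLin a, b⟫ = ⟪a, (imMat Θ).toEuclideanLin b⟫ := by
    have : (imMat Θ).IsHermitian := by
      ext i j
      have := congrFun (congrFun hΘ.symm i) j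
      simp [imMat] at this ⊢
      rw [this]
    exact Matrix.isSymmetric_toEuclideanLin_iff.2 this
  simp only [symplecticForm, Lam, toEuclideanLin_mul_apply, inner_add_left, inner_add_right, h1]
  rw [real_inner_comm _ (((sqrtRe Θ)⁻¹).toEuclideanLin ((imMat Θ).toEuclideanLin v.1)), h1,
    real_inner_comm _ (((sqrtRe Θ)⁻¹).toEuclideanLin v.2), h1, real_inner_comm _ w.1, h2,
    real_inner_comm _ w.1]
  ring

theorem IsAdmissible.conjMat {Θ : Matrix (Fin d) (Fin d) ℂ} (hΘ : IsAdmissible Θ) :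
    IsAdmissible (conjMat Θ) := by
  refine ⟨?_, ?_⟩
  · ext i j
    have := congrFun (congrFun hΘ.symm i) j
    simp [FourierOp.conjMat] at this ⊢
    rw [this]
  · have : reMat (FourierOp.conjMat Θ) = reMat Θ := by ext i j; simp [reMat, FourierOp.conjMat]
    rw [this]; exact hΘ.posDef

end Symplectic

/-! ### The constants `c` and `η` -/

section Eta

variable {d : ℕ}

/-- The lower bound on difference quotients along rays from the origin passes to the derivative
there, and the linear case applies. -/
theorem le_one_of_expanding (hd : 1 ≤ d) {f : Phase d → Phase d} (hf : Differentiable ℝ f)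
    (h : ∀ z v w, symplecticForm (fderiv ℝ f z v) (fderiv ℝ f z w) = symplecticForm v w) {c : ℝ}
    (hc : ∀ z w : Phase d, c * phaseNorm (z - w) ≤ phaseNorm (f z - f w)) : c ≤ 1 := by
  refine le_one_of_symplectic hd (fderiv ℝ f 0 : Phase d →ₗ[ℝ] Phase d) (h 0) fun v => ?_
  have h1 : HasDerivAt (fun t : ℝ => f (t • v)) (fderiv ℝ f 0 v) 0 := by
    have hl : HasDerivAt (fun t : ℝ => t • v) v 0 := by
      simpa using (hasDerivAt_id (0 : ℝ)).smul_const v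
    have hF : HasFDerivAt f (fderiv ℝ f 0) ((0 : ℝ) • v) := by
      rw [zero_smul]; exact (hf 0).hasFDerivAt
    exact hF.comp_hasDerivAt 0 hl
  have h2 := (continuous_phaseNorm.tendsto _).comp h1.tendsto_slope_zero_right
  refine ge_of_tendsto h2 ?_
  filter_upwards [self_mem_nhdsWithin] with t ht
  have ht : 0 < t := ht
  simp only [Function.comp, zero_add, zero_smul]
  rw [phaseNorm_smul, abs_of_pos (inv_pos.2 ht)]
  have := hc (t • v) 0
  rw [sub_zero, phaseNorm_smul, abs_of_pos ht] at this
  rw [inv_mul_eq_div, le_div_iff₀ ht]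
  linarith

theorem lowerLip_le_one (hd : 1 ≤ d) {f : Phase d → Phase d} (hf : Differentiable ℝ f)
    (h : ∀ z v w, symplecticForm (fderiv ℝ f z v) (fderiv ℝ f z w) = symplecticForm v w) :
    lowerLip f ≤ 1 :=
  csSup_le ⟨0, fun z w => by simpa using phaseNorm_nonneg _⟩
    fun _ hc => le_one_of_expanding hd hf h hc

/-- The supremum dominates its members only if the set of admissible constants is bounded above;
symplecticity supplies the bound 1. -/
theorem le_lowerLip (hd : 1 ≤ d) {f : Phase d → Phase d} (hf : Differentiable ℝ f)
    (h : ∀ z v w, symplecticForm (fderiv ℝ f z v) (fderiv ℝ f z w) = symplecticForm v w) {c : ℝ}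
    (hc : ∀ z w : Phase d, c * phaseNorm (z - w) ≤ phaseNorm (f z - f w)) : c ≤ lowerLip f :=
  le_csSup ⟨1, fun _ hc => le_one_of_expanding hd hf h hc⟩ hc

theorem IsCanonical.trans {κ₁ κ₂ : Phase d ≃ Phase d} (h₁ : IsCanonical κ₁) (h₂ : IsCanonical κ₂) :
    IsCanonical (κ₁.trans κ₂) := by
  refine ⟨h₂.smooth.comp h₁.smooth, h₁.smooth_symm.comp h₂.smooth_symm, fun z v w => ?_⟩
  have : fderiv ℝ (κ₁.trans κ₂) z = (fderiv ℝ κ₂ (κ₁ z)).comp (fderiv ℝ κ₁ z) :=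
    fderiv_comp z (h₂.differentiable _) (h₁.differentiable _)
  rw [this]
  simp [h₂.symplectic, h₁.symplectic]

/-- `Λ(Θ)` as a canonical transformation. -/
def LamEquiv {Θ : Matrix (Fin d) (Fin d) ℂ} (hΘ : IsAdmissible Θ) : Phase d ≃L[ℝ] Phase d :=
  (LinearEquiv.ofBijective (LamL Θ) ⟨injective_of_symplectic _ (Lam_symplectic hΘ),
    surjective_of_symplectic _ (Lam_symplectic hΘ)⟩).toContinuousLinearEquiv

theorem isClassB_LamEquiv {Θ : Matrix (Fin d) (Fin d) ℂ} (hΘ : IsAdmissible Θ) :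
    IsClassB (LamEquiv hΘ).toEquiv := by
  have hf : fderiv ℝ (LamEquiv hΘ).toEquiv = fun _ => (LamEquiv hΘ : Phase d →L[ℝ] Phase d) := by
    ext1 z; exact (LamEquiv hΘ).fderiv
  refine ⟨⟨(LamEquiv hΘ).contDiff, (LamEquiv hΘ).symm.contDiff, fun z v w => ?_⟩, ?_, fun k => ?_⟩
  · rw [hf]; exact Lam_symplectic hΘ v w
  · rw [hf]; exact contDiff_const
  · rw [hf]
    rcases k with _ | k
    · exact ⟨_, fun z => (norm_iteratedFDeriv_zero).le⟩
    · exact ⟨0, fun z => by rw [iteratedFDeriv_const_of_ne (by simp)]; simp⟩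

theorem isClassB_refl : IsClassB (Equiv.refl (Phase d)) := by
  have hf : fderiv ℝ (Equiv.refl (Phase d)) = fun _ => ContinuousLinearMap.id ℝ (Phase d) := by
    ext1 z; exact fderiv_id
  refine ⟨⟨contDiff_id, contDiff_id, fun z v w => ?_⟩, ?_, fun k => ?_⟩
  · rw [hf]; rfl
  · rw [hf]; exact contDiff_const
  · rw [hf]
    rcases k with _ | k
    · exact ⟨_, fun z => (norm_iteratedFDeriv_zero).le⟩
    · exact ⟨0, fun z => by rw [iteratedFDeriv_const_of_ne (by simp)]; simp⟩

/-- A canonical transformation of class `B` has a Lipschitz inverse. -/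
theorem IsClassB.exists_expanding {κ : Phase d ≃ Phase d} (h : IsClassB κ) :
    ∃ c : ℝ, 0 < c ∧ ∀ z w, c * phaseNorm (z - w) ≤ phaseNorm (κ z - κ w) := by
  obtain ⟨M, hM⟩ := h.jacobian.bounded 0
  have hM' : ∀ z, ‖fderiv ℝ κ z‖ ≤ M := fun z => by simpa using hM z
  have hM0 : 0 ≤ M := (norm_nonneg _).trans (hM' 0)
  -- In Euclidean norm the Jacobian is at most `2 * M`, hence so is its inverse, by symplecticity.
  -- Returning to the sup norm costs another factor 2.
  have hb : ∀ z, ‖fderiv ℝ κ.symm z‖ ≤ 4 * M := by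
    intro z
    refine ContinuousLinearMap.opNorm_le_bound _ (by positivity) fun v => ?_
    set w := fderiv ℝ κ.symm z v
    have hd : Differentiable ℝ κ.symm := h.canonical.smooth_symm.differentiable (by simp)
    have hc : fderiv ℝ κ (κ.symm z) w = v := by
      have h1 := fderiv_comp z (h.canonical.differentiable (κ.symm z)) (hd z)
      have h2 : (κ ∘ κ.symm : Phase d → Phase d) = id := by ext x <;> simp
      rw [h2, fderiv_id] at h1
      simpa using (DFunLike.congr_fun h1 v).symm
    have h3 := phaseNorm_le_of_symplectic (fderiv ℝ κ (κ.symm z) : Phase d →ₗ[ℝ] Phase d)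
      (h.canonical.symplectic _) (K := 2 * M) (fun v => ?_) w
    · have h4 : phaseNorm w ≤ 2 * M * phaseNorm v := by rw [← hc]; exact h3
      have h5 := norm_le_phaseNorm w
      have h6 := phaseNorm_le_two_mul_norm v
      nlinarith
    · have h4 := (fderiv ℝ κ (κ.symm z)).le_of_opNorm_le (hM' _) v
      have h5 := norm_le_phaseNorm v
      have h6 := phaseNorm_le_two_mul_norm (fderiv ℝ κ (κ.symm z) v)
      change phaseNorm (fderiv ℝ κ (κ.symm z) v) ≤ _
      nlinarith
  have hlip : ∀ a b, ‖κ.symm a - κ.symm b‖ ≤ 4 * M * ‖a - b‖ := fun a b =>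
    Convex.norm_image_sub_le_of_norm_fderiv_le (𝕜 := ℝ) (s := Set.univ)
      (fun x _ => (h.canonical.smooth_symm.differentiable (by simp)) x) (fun x _ => hb x)
      convex_univ (Set.mem_univ _) (Set.mem_univ _)
  -- One more change of norm turns `4 * M` into `8 * M`; the `+ 1` keeps the denominator positive
  -- when `M = 0`.
  refine ⟨(8 * M + 1)⁻¹, by positivity, fun z w => ?_⟩
  rw [inv_mul_le_iff₀ (by positivity)]
  have h1 := hlip (κ z) (κ w)
  simp only [Equiv.symm_apply_apply] at h1
  have h2 := norm_le_phaseNorm (κ z - κ w)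
  have h3 := phaseNorm_le_two_mul_norm (z - w)
  nlinarith [phaseNorm_nonneg (κ z - κ w)]

/-- All maps in the definition are symplectic, so their constants are at most 1, which also makes
the supremum genuine. Positivity follows from the competitor `κ₀ = id`, since `κ` and both `Λ` are
expanding. -/
theorem eta_pos_le_one (hd : 1 ≤ d) {κ : Phase d ≃ Phase d} (hκ : IsClassB κ)
    {Θx Θy : Matrix (Fin d) (Fin d) ℂ} (hx : IsAdmissible Θx) (hy : IsAdmissible Θy) :
    0 < eta κ Θx Θy ∧ eta κ Θx Θy ≤ 1 := by
  have hbd : ∀ κ₀ : {κ₀ : Phase d ≃ Phase d // IsClassB κ₀},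
      min (lowerLip (fun z => Lam Θx (κ (κ₀.1.symm z))))
        (lowerLip (fun z => Lam (conjMat Θy) (κ₀.1.symm z))) ≤ 1 := by
    intro κ₀
    refine (min_le_right _ _).trans ?_
    have hc := κ₀.2.canonical.symplectic_symm.trans (isClassB_LamEquiv hy.conjMat).canonical
    exact lowerLip_le_one hd (f := κ₀.1.symm.trans (LamEquiv hy.conjMat).toEquiv) hc.differentiable hc.symplectic
  have : Nonempty {κ₀ : Phase d ≃ Phase d // IsClassB κ₀} := ⟨⟨_, isClassB_refl⟩⟩
  refine ⟨?_, ciSup_le hbd⟩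
  refine lt_of_lt_of_le ?_ (le_ciSup ⟨1, by rintro _ ⟨κ₀, rfl⟩; exact hbd κ₀⟩ ⟨_, isClassB_refl⟩)
  obtain ⟨c, hc, hκc⟩ := hκ.exists_expanding
  obtain ⟨c₁, hc₁, h₁⟩ := (isClassB_LamEquiv hx).exists_expanding
  obtain ⟨c₂, hc₂, h₂⟩ := (isClassB_LamEquiv hy.conjMat).exists_expanding
  refine lt_min ?_ ?_
  · have hcan := hκ.canonical.trans (isClassB_LamEquiv hx).canonical
    refine lt_of_lt_of_le (mul_pos hc₁ hc) (le_lowerLip hd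
      (f := κ.trans (LamEquiv hx).toEquiv) hcan.differentiable hcan.symplectic fun z w => ?_)
    have := h₁ (κ z) (κ w)
    refine le_trans ?_ this
    rw [mul_assoc]
    exact mul_le_mul_of_nonneg_left (hκc z w) hc₁.le
  · have hcan := (isClassB_LamEquiv hy.conjMat).canonical
    exact lt_of_lt_of_le hc₂ (le_lowerLip hd
      (f := (LamEquiv hy.conjMat).toEquiv) hcan.differentiable hcan.symplectic h₂)

end Eta

end FourierOp
end

noncomputable section

namespace FourierOp

/-! ### Directional derivatives -/

section DirDeriv

variable {V : Type*} [NormedAddCommGroup V] [NormedSpace ℝ V]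

theorem contDiff_dirDeriv {f : V → ℂ} (hf : ContDiff ℝ ∞ f) (v : V) :
    ContDiff ℝ ∞ (dirDeriv v f) :=
  (hf.fderiv_right (m := ∞) (by simp)).clm_apply contDiff_const

theorem dirDeriv_add {f g : V → ℂ} (hf : Differentiable ℝ f) (hg : Differentiable ℝ g) (v : V) :
    dirDeriv v (fun z => f z + g z) = fun z => dirDeriv v f z + dirDeriv v g z := by
  ext z; simp [dirDeriv, fderiv_fun_add (hf z) (hg z)]

theorem dirDeriv_mul {f g : V → ℂ} (hf : Differentiable ℝ f) (hg : Differentiable ℝ g) (v : V) :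
    dirDeriv v (fun z => f z * g z) = fun z => dirDeriv v f z * g z + f z * dirDeriv v g z := by
  ext z; simp [dirDeriv, fderiv_fun_mul (hf z) (hg z)]; ring

theorem dirDeriv_const (c : ℂ) (v : V) : dirDeriv v (fun _ => c) = fun _ => 0 := by
  ext z; simp [dirDeriv]

theorem dirDeriv_conj (f : V → ℂ) (v : V) :
    dirDeriv v (fun z => (starRingEnd ℂ) (f z)) = fun z => (starRingEnd ℂ) (dirDeriv v f z) := by
  ext z
  have := (Complex.conjCLE : ℂ ≃L[ℝ] ℂ).comp_fderiv (f := f) (x := z)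
  have h2 := DFunLike.congr_fun this v
  simpa [dirDeriv, Function.comp_def] using h2

/-- Obtained by differentiating `f * f⁻¹ = 1`; the right side is a product so that the calculus of
`IsSym` applies to it directly. -/
theorem dirDeriv_inv {f : V → ℂ} (hf : Differentiable ℝ f) (h0 : ∀ z, f z ≠ 0) (v : V) :
    dirDeriv v (fun z => (f z)⁻¹) = fun z => -1 * ((f z)⁻¹ * (f z)⁻¹ * dirDeriv v f z) := by
  have h1 := dirDeriv_mul hf (hf.fun_inv h0) v
  have h2 : (fun z => f z * (f z)⁻¹) = fun _ => 1 := by ext z; exact mul_inv_cancel₀ (h0 z)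
  rw [h2, dirDeriv_const] at h1
  ext z
  have h3 := congrFun h1 z
  have h4 := h0 z
  field_simp at h3 ⊢
  linear_combination -h3

theorem IsBoundedSymbol.dirDeriv {f : V → ℂ} (hf : IsBoundedSymbol f) (v : V) :
    IsBoundedSymbol (dirDeriv v f) := by
  refine ⟨contDiff_dirDeriv hf.smooth v, fun k => ?_⟩
  obtain ⟨M, hM⟩ := hf.bounded (k + 1)
  refine ⟨‖v‖ * M, fun z => ?_⟩
  have h1 := norm_iteratedFDeriv_clm_apply_const (𝕜 := ℝ) (f := fderiv ℝ f) (c := v) (x := z) (N := ∞)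
    (n := k) ((hf.smooth.fderiv_right (m := ∞) (by simp)).contDiffAt) (by exact_mod_cast le_top)
  refine h1.trans (mul_le_mul_of_nonneg_left ?_ (norm_nonneg v))
  rw [norm_iteratedFDeriv_fderiv]
  exact hM z

theorem IsBoundedSymbol.exists_norm_le {f : V → ℂ} (hf : IsBoundedSymbol f) :
    ∃ M, 0 ≤ M ∧ ∀ z, ‖f z‖ ≤ M := by
  obtain ⟨M, hM⟩ := hf.bounded 0
  exact ⟨M, (norm_nonneg _).trans (hM 0), fun z => by simpa using hM z⟩

end DirDeriv

/-! ### Symbols in the variable `y` -/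

section Symbols

variable {d : ℕ}

/-- The coordinate directions of `y` in `ℝ^{4d}`. -/
def yDir (j : Fin d) : Var d := (0, EuclideanSpace.single j 1, 0, 0)

/-- `W` is smooth and its derivatives with respect to `y` up to order `n` are `O(ρ)`. -/
def IsSym (ρ : Var d → ℝ) : ℕ → (Var d → ℂ) → Prop
  | 0, W => ContDiff ℝ ∞ W ∧ ∃ M : ℝ, 0 ≤ M ∧ ∀ z, ‖W z‖ ≤ M * ρ z
  | n + 1, W => (ContDiff ℝ ∞ W ∧ ∃ M : ℝ, 0 ≤ M ∧ ∀ z, ‖W z‖ ≤ M * ρ z) ∧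
      ∀ j, IsSym ρ n (dirDeriv (yDir j) W)

variable {ρ ρ₁ ρ₂ : Var d → ℝ} {n : ℕ} {f g : Var d → ℂ}

theorem IsSym.zero_le (h : IsSym ρ n f) :
    ContDiff ℝ ∞ f ∧ ∃ M : ℝ, 0 ≤ M ∧ ∀ z, ‖f z‖ ≤ M * ρ z := by
  cases n with
  | zero => exact h
  | succ n => exact h.1

theorem IsSym.smooth (h : IsSym ρ n f) : ContDiff ℝ ∞ f := h.zero_le.1

theorem IsSym.differentiable (h : IsSym ρ n f) : Differentiable ℝ f :=
  h.smooth.differentiable (by simp)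

theorem IsSym.of_succ (h : IsSym ρ (n + 1) f) : IsSym ρ n f := by
  induction n generalizing f with
  | zero => exact h.1
  | succ n ih => exact ⟨h.1, fun j => ih (h.2 j)⟩

theorem IsSym.mono (h : IsSym ρ₁ n f) (hρ : ∀ z, ρ₁ z ≤ ρ₂ z) : IsSym ρ₂ n f := by
  induction n generalizing f with
  | zero =>
    obtain ⟨hs, M, hM, hb⟩ := h
    exact ⟨hs, M, hM, fun z => (hb z).trans (mul_le_mul_of_nonneg_left (hρ z) hM)⟩
  | succ n ih =>
    obtain ⟨⟨hs, M, hM, hb⟩, h2⟩ := h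
    exact ⟨⟨hs, M, hM, fun z => (hb z).trans (mul_le_mul_of_nonneg_left (hρ z) hM)⟩,
      fun j => ih (h2 j)⟩

theorem IsSym.add (hf : IsSym ρ n f) (hg : IsSym ρ n g) : IsSym ρ n (fun z => f z + g z) := by
  have h0 : ∀ {n : ℕ} {f g : Var d → ℂ}, IsSym ρ n f → IsSym ρ n g →
      ContDiff ℝ ∞ (fun z => f z + g z) ∧ ∃ M : ℝ, 0 ≤ M ∧ ∀ z, ‖f z + g z‖ ≤ M * ρ z := by
    intro n f g hf hg
    obtain ⟨hs, M, hM, hb⟩ := hf.zero_le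
    obtain ⟨hs', M', hM', hb'⟩ := hg.zero_le
    refine ⟨hs.add hs', M + M', by positivity, fun z => (norm_add_le _ _).trans ?_⟩
    rw [add_mul]; exact add_le_add (hb z) (hb' z)
  induction n generalizing f g with
  | zero => exact h0 hf hg
  | succ n ih =>
    refine ⟨h0 hf hg, fun j => ?_⟩
    rw [dirDeriv_add hf.differentiable hg.differentiable]
    exact ih (hf.2 j) (hg.2 j)

theorem isSym_zero : IsSym ρ n (fun _ => 0) := by
  induction n with
  | zero => exact ⟨contDiff_const, 0, le_rfl, fun z => by simp⟩
  | succ n ih =>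
    refine ⟨⟨contDiff_const, 0, le_rfl, fun z => by simp⟩, fun j => ?_⟩
    rw [dirDeriv_const]; exact ih

theorem IsSym.sum {ι : Type*} (s : Finset ι) {f : ι → Var d → ℂ}
    (hf : ∀ i ∈ s, IsSym ρ n (f i)) : IsSym ρ n (fun z => ∑ i ∈ s, f i z) := by
  classical
  induction s using Finset.induction_on with
  | empty => simpa using isSym_zero
  | insert a s ha ih =>
    simp only [Finset.sum_insert ha]
    exact (hf a (by simp)).add (ih fun i hi => hf i (by simp [hi]))

theorem isSym_const (hρ : ∀ z, 1 ≤ ρ z) (c : ℂ) : IsSym ρ n (fun _ => c) := by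
  have h0 : ContDiff ℝ ∞ (fun _ : Var d => c) ∧ ∃ M : ℝ, 0 ≤ M ∧ ∀ z, ‖c‖ ≤ M * ρ z :=
    ⟨contDiff_const, ‖c‖, norm_nonneg _, fun z => le_mul_of_one_le_right (norm_nonneg _) (hρ z)⟩
  cases n with
  | zero => exact h0
  | succ n =>
    refine ⟨h0, fun j => ?_⟩
    rw [dirDeriv_const]; exact isSym_zero

theorem IsSym.mul (hf : IsSym ρ₁ n f) (hg : IsSym ρ₂ n g) :
    IsSym (fun z => ρ₁ z * ρ₂ z) n (fun z => f z * g z) := by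
  have h0 : ∀ {n : ℕ} {f g : Var d → ℂ}, IsSym ρ₁ n f → IsSym ρ₂ n g →
      ContDiff ℝ ∞ (fun z => f z * g z) ∧
      ∃ M : ℝ, 0 ≤ M ∧ ∀ z, ‖f z * g z‖ ≤ M * (ρ₁ z * ρ₂ z) := by
    intro n f g hf hg
    obtain ⟨hs, M, hM, hb⟩ := hf.zero_le
    obtain ⟨hs', M', hM', hb'⟩ := hg.zero_le
    refine ⟨hs.mul hs', M * M', by positivity, fun z => ?_⟩
    rw [norm_mul, mul_mul_mul_comm]
    exact mul_le_mul (hb z) (hb' z) (norm_nonneg _) ((norm_nonneg _).trans (hb z))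
  induction n generalizing f g with
  | zero => exact h0 hf hg
  | succ n ih =>
    refine ⟨h0 hf hg, fun j => ?_⟩
    rw [dirDeriv_mul hf.differentiable hg.differentiable]
    exact (ih (hf.2 j) hg.of_succ).add (ih hf.of_succ (hg.2 j))

theorem IsSym.const_mul (hf : IsSym ρ n f) (c : ℂ) : IsSym ρ n (fun z => c * f z) :=
  ((isSym_const (ρ := fun _ => 1) (fun _ => le_rfl) c).mul hf).mono fun z => by simp

theorem IsSym.conj (hf : IsSym ρ n f) : IsSym ρ n (fun z => (starRingEnd ℂ) (f z)) := by
  have h0 : ∀ {n : ℕ} {f : Var d → ℂ}, IsSym ρ n f → ContDiff ℝ ∞ (fun z => (starRingEnd ℂ) (f z)) ∧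
      ∃ M : ℝ, 0 ≤ M ∧ ∀ z, ‖(starRingEnd ℂ) (f z)‖ ≤ M * ρ z := by
    intro n f hf
    obtain ⟨hs, M, hM, hb⟩ := hf.zero_le
    exact ⟨Complex.conjCLE.contDiff.comp hs, M, hM, fun z => by simpa using hb z⟩
  induction n generalizing f with
  | zero => exact h0 hf
  | succ n ih =>
    refine ⟨h0 hf, fun j => ?_⟩
    rw [dirDeriv_conj]; exact ih (hf.2 j)

theorem IsBoundedSymbol.isSym {u : Var d → ℂ} (hu : IsBoundedSymbol u) :
    IsSym (fun _ => 1) n u := by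
  have h0 : ∀ {u : Var d → ℂ}, IsBoundedSymbol u → ContDiff ℝ ∞ u ∧
      ∃ M : ℝ, 0 ≤ M ∧ ∀ z, ‖u z‖ ≤ M * 1 := by
    intro u hu
    obtain ⟨M, hM, hb⟩ := hu.exists_norm_le
    exact ⟨hu.smooth, M, hM, fun z => by simpa using hb z⟩
  induction n generalizing u with
  | zero => exact h0 hu
  | succ n ih => exact ⟨h0 hu, fun j => ih (hu.dirDeriv _)⟩

theorem hasFDerivAt_incl (x y q p : E d) :
    HasFDerivAt (fun y' : E d => ((x, y', q, p) : Var d))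
      ((ContinuousLinearMap.inr ℝ (E d) (E d × E d × E d)).comp
        (ContinuousLinearMap.inl ℝ (E d) (E d × E d))) y := by
  have h1 : HasFDerivAt (fun y' : E d => ((y', q, p) : E d × E d × E d)) _ y :=
    hasFDerivAt_prodMk_left (𝕜 := ℝ) y (q, p)
  exact (hasFDerivAt_prodMk_right (𝕜 := ℝ) x (y, q, p)).comp y h1

theorem dirDeriv_slice {G : Var d → ℂ} (hG : Differentiable ℝ G) (j : Fin d) (x y q p : E d) :
    dirDeriv (EuclideanSpace.single j 1) (fun y' => G (x, y', q, p)) y =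
      dirDeriv (yDir j) G (x, y, q, p) := by
  have := ((hG (x, y, q, p)).hasFDerivAt.comp y (hasFDerivAt_incl x y q p)).fderiv
  simp only [Function.comp_def] at this
  rw [dirDeriv, this]
  simp [dirDeriv, yDir, Prod.zero_eq_mk]

open LineDeriv in
theorem isSym_schwartz (φ : 𝓢(E d, ℂ)) (N : ℕ) :
    IsSym (fun z : Var d => ((1 + ‖z.2.1‖) ^ N)⁻¹) n (fun z => φ z.2.1) := by
  have h0 : ∀ φ : 𝓢(E d, ℂ), ContDiff ℝ ∞ (fun z : Var d => φ z.2.1) ∧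
      ∃ M : ℝ, 0 ≤ M ∧ ∀ z : Var d, ‖φ z.2.1‖ ≤ M * ((1 + ‖z.2.1‖) ^ N)⁻¹ := by
    intro φ
    refine ⟨(φ.smooth ⊤).comp (contDiff_fst.comp contDiff_snd), ?_⟩
    have := SchwartzMap.one_add_le_sup_seminorm_apply (𝕜 := ℝ) (m := (N, 0)) (k := N) (n := 0) le_rfl le_rfl φ
    refine ⟨_, le_trans (by positivity) (this 0), fun z => ?_⟩
    · have h := this z.2.1
      rw [norm_iteratedFDeriv_zero] at h
      rw [← div_eq_mul_inv, le_div_iff₀ (by positivity), mul_comm]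
      exact h
  induction n generalizing φ with
  | zero => exact h0 φ
  | succ n ih =>
    refine ⟨h0 φ, fun j => ?_⟩
    convert ih (∂_{EuclideanSpace.single j (1 : ℝ)} φ) using 1
    ext ⟨x, y, q, p⟩
    rw [← dirDeriv_slice ((h0 φ).1.differentiable (by simp)), SchwartzMap.lineDerivOp_apply_eq_fderiv]
    rfl

end Symbols

/-! ### The transposed operator on symbols -/

section Transpose

variable {d : ℕ} (Θ : Matrix (Fin d) (Fin d) ℂ)

/-- The `y`-gradient of the phase. -/
def grad (j : Fin d) (z : Var d) : ℂ :=
  -((z.2.2.2 j : ℝ) : ℂ) + Complex.I * ∑ l, Θ j l * ((z.2.1 l - z.2.2.1 l : ℝ) : ℂ)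

/-- The weight `1 + |∇_y Φ|²`. -/
def weight (z : Var d) : ℝ := 1 + ∑ j, ‖grad Θ j z‖ ^ 2

theorem one_le_weight (z : Var d) : 1 ≤ weight Θ z :=
  le_add_of_nonneg_right (Finset.sum_nonneg fun _ _ => by positivity)

theorem weight_pos (z : Var d) : 0 < weight Θ z := zero_lt_one.trans_le (one_le_weight Θ z)

theorem one_le_sqrt_weight (z : Var d) : 1 ≤ √(weight Θ z) :=
  Real.one_le_sqrt.2 (one_le_weight Θ z)

theorem contDiff_grad (j : Fin d) : ContDiff ℝ ∞ (grad Θ j) := by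
  have h1 : ∀ l : Fin d, ContDiff ℝ ∞ (fun z : Var d => ((z.2.1 l - z.2.2.1 l : ℝ) : ℂ)) := by
    intro l
    have : ContDiff ℝ ∞ (fun z : Var d => z.2.1 l - z.2.2.1 l) := by fun_prop
    exact Complex.ofRealCLM.contDiff.comp this
  have h2 : ContDiff ℝ ∞ (fun z : Var d => ((z.2.2.2 j : ℝ) : ℂ)) :=
    Complex.ofRealCLM.contDiff.comp (by fun_prop)
  unfold grad
  exact h2.neg.add (contDiff_const.mul (ContDiff.sum fun l _ => contDiff_const.mul (h1 l)))

/-- The gradient is affine in `y`, so the next derivatives are constants and all further ones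
vanish. This makes `1 + |∇_yΦ|²` a well-behaved weight. -/
theorem dirDeriv_grad (i j : Fin d) :
    dirDeriv (yDir i) (grad Θ j) = fun _ => Complex.I * Θ j i := by
  ext z
  have h1 : HasDerivAt (fun t : ℝ => grad Θ j (z + t • yDir i)) (Complex.I * Θ j i) 0 := by
    have : (fun t : ℝ => grad Θ j (z + t • yDir i)) =
        fun t : ℝ => grad Θ j z + (t : ℂ) * (Complex.I * Θ j i) := by
      ext t
      simp only [grad, yDir, Prod.snd_add, Prod.fst_add, Prod.smul_snd, Prod.smul_fst, smul_zero,
        add_zero]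
      have : ∀ l, Θ j l * (((z.2.1 + t • EuclideanSpace.single i (1 : ℝ) : E d) l - z.2.2.1 l : ℝ) : ℂ) =
          Θ j l * ((z.2.1 l - z.2.2.1 l : ℝ) : ℂ) + (if l = i then (t : ℂ) * Θ j i else 0) := by
        intro l
        by_cases h : l = i
        · subst h; simp; ring
        · simp [h]
      simp only [this, Finset.sum_add_distrib]
      simp
      ring
    rw [this]
    have h3 : HasDerivAt (fun t : ℝ => (t : ℂ)) 1 0 := Complex.ofRealCLM.hasDerivAt
    simpa using (h3.mul_const (Complex.I * Θ j i)).const_add (grad Θ j z)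
  have h2 : HasDerivAt (fun t : ℝ => grad Θ j (z + t • yDir i)) (dirDeriv (yDir i) (grad Θ j) z) 0 := by
    have hl : HasDerivAt (fun t : ℝ => z + t • yDir i) (yDir i) 0 := by
      simpa using ((hasDerivAt_id (0 : ℝ)).smul_const (yDir i)).const_add z
    have hF : HasFDerivAt (grad Θ j) (fderiv ℝ (grad Θ j) z) (z + (0 : ℝ) • yDir i) := by
      rw [zero_smul, add_zero]
      exact ((contDiff_grad Θ j).differentiable (by simp) z).hasFDerivAt
    exact hF.comp_hasDerivAt 0 hl
  exact h2.unique h1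

variable {n : ℕ}

theorem isSym_grad (j : Fin d) : IsSym (fun z => √(weight Θ z)) n (grad Θ j) := by
  have h0 : ContDiff ℝ ∞ (grad Θ j) ∧ ∃ M : ℝ, 0 ≤ M ∧ ∀ z, ‖grad Θ j z‖ ≤ M * √(weight Θ z) := by
    refine ⟨contDiff_grad Θ j, 1, zero_le_one, fun z => ?_⟩
    rw [one_mul]
    refine Real.le_sqrt_of_sq_le ?_
    have := Finset.single_le_sum (f := fun j => ‖grad Θ j z‖ ^ 2) (fun _ _ => by positivity) (Finset.mem_univ j)
    rw [weight]; linarith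
  cases n with
  | zero => exact h0
  | succ n =>
    refine ⟨h0, fun i => ?_⟩
    rw [dirDeriv_grad]
    exact isSym_const (one_le_sqrt_weight Θ) _

theorem weight_eq : (fun z => (weight Θ z : ℂ)) =
    fun z => 1 + ∑ j, grad Θ j z * (starRingEnd ℂ) (grad Θ j z) := by
  ext z
  simp [weight, Complex.mul_conj, Complex.normSq_eq_norm_sq]

theorem isSym_weight : IsSym (weight Θ) n (fun z => (weight Θ z : ℂ)) := by
  rw [weight_eq]
  refine (isSym_const (one_le_weight Θ) 1).add (IsSym.sum _ fun j _ => ?_)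
  refine ((isSym_grad Θ j).mul (isSym_grad Θ j).conj).mono fun z => ?_
  rw [Real.mul_self_sqrt (weight_pos Θ z).le]

theorem contDiff_weight_inv : ContDiff ℝ ∞ (fun z => ((weight Θ z : ℂ))⁻¹) :=
  (isSym_weight Θ (n := 0)).smooth.inv fun z => by exact_mod_cast (weight_pos Θ z).ne'

theorem isSym_weight_inv : IsSym (fun z => (weight Θ z)⁻¹) n (fun z => ((weight Θ z : ℂ))⁻¹) := by
  have h0 : ContDiff ℝ ∞ (fun z => ((weight Θ z : ℂ))⁻¹) ∧
      ∃ M : ℝ, 0 ≤ M ∧ ∀ z, ‖((weight Θ z : ℂ))⁻¹‖ ≤ M * (weight Θ z)⁻¹ := by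
    refine ⟨contDiff_weight_inv Θ, 1, zero_le_one, fun z => ?_⟩
    rw [norm_inv, Complex.norm_real, Real.norm_of_nonneg (weight_pos Θ z).le, one_mul]
  induction n with
  | zero => exact h0
  | succ n ih =>
    refine ⟨h0, fun j => ?_⟩
    rw [dirDeriv_inv (isSym_weight Θ (n := 0)).differentiable
      (fun z => by exact_mod_cast (weight_pos Θ z).ne')]
    refine (((ih.mul ih).mul ((isSym_weight Θ (n := n + 1)).2 j)).const_mul (-1)).mono fun z => ?_
    have := weight_pos Θ z
    apply le_of_eq; field_simp

/-- The transposed operator `L†` acting on functions on `ℝ^{4d}`. -/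
def transposeSym (ε : ℝ) (W : Var d → ℂ) : Var d → ℂ := fun z =>
  W z / (weight Θ z : ℂ) + Complex.I * (ε : ℂ) * ∑ j, dirDeriv (yDir j)
    (fun z' => (starRingEnd ℂ) (grad Θ j z') * W z' / (weight Θ z' : ℂ)) z

variable {Θ} {ρ : Var d → ℝ} {W : Var d → ℂ}

theorem IsSym.coeff_mul (hW : IsSym ρ n W) (j : Fin d) :
    IsSym (fun z => (√(weight Θ z))⁻¹ * ρ z) n
      (fun z' => (starRingEnd ℂ) (grad Θ j z') * W z' / (weight Θ z' : ℂ)) := by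
  simp only [div_eq_mul_inv]
  refine (((isSym_grad Θ j).conj.mul hW).mul (isSym_weight_inv Θ)).mono fun z => ?_
  have h1 := weight_pos Θ z
  have h2 := Real.sqrt_pos.2 h1
  apply le_of_eq
  nth_rewrite 2 [← Real.mul_self_sqrt h1.le]
  field_simp

/-- Each application costs one `y`-derivative and gains a factor `weight^{-1/2}`: the coefficient
`conj(∇Φ)/weight` has exactly this size, and `1/weight` is smaller still. -/
theorem IsSym.transposeSym (ε : ℝ) (hρ : ∀ z, 0 ≤ ρ z) (hW : IsSym ρ (n + 1) W) :
    IsSym (fun z => (√(weight Θ z))⁻¹ * ρ z) n (transposeSym Θ ε W) := by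
  refine IsSym.add ?_ ((IsSym.sum _ fun j _ => (hW.coeff_mul j).2 j).const_mul _)
  simp only [div_eq_mul_inv]
  refine (hW.of_succ.mul (isSym_weight_inv Θ)).mono fun z => ?_
  rw [mul_comm]
  refine mul_le_mul_of_nonneg_right ?_ (hρ z)
  refine inv_anti₀ (Real.sqrt_pos.2 (weight_pos Θ z)) ?_
  rw [Real.sqrt_le_iff]
  refine ⟨(weight_pos Θ z).le, ?_⟩
  nlinarith [one_le_weight Θ z]

theorem IsSym.iterate_transposeSym (ε : ℝ) (hρ : ∀ z, 0 ≤ ρ z) (k : ℕ) (hW : IsSym ρ (n + k) W) :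
    IsSym (fun z => ((√(weight Θ z))⁻¹) ^ k * ρ z) n ((FourierOp.transposeSym Θ ε)^[k] W) := by
  induction k generalizing n with
  | zero => simpa using hW
  | succ k ih =>
    rw [Function.iterate_succ_apply']
    have h1 := ih (n := n + 1) (by rwa [show n + 1 + k = n + (k + 1) by ring])
    refine (h1.transposeSym (Θ := Θ) ε fun z =>
      mul_nonneg (pow_nonneg (inv_nonneg.2 (Real.sqrt_nonneg _)) _) (hρ z)).mono fun z => ?_
    rw [pow_succ]; apply le_of_eq; ring

end Transpose

end FourierOp
end

noncomputable section

namespace FourierOp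

/-! ### The phase -/

section Phase

variable {d : ℕ}

/-- Differentiating either slot of the form gives a sum, and symmetry of `Θ` makes the two sums
equal. -/
theorem hasDerivAt_quad_line {Θ : Matrix (Fin d) (Fin d) ℂ} (hΘ : Θ.IsSymm) (v : E d) (j : Fin d) :
    HasDerivAt (fun t : ℝ => quad Θ (v + t • EuclideanSpace.single j (1 : ℝ)))
      (2 * ∑ l, Θ j l * ((v l : ℝ) : ℂ)) 0 := by
  have hc : ∀ i, HasDerivAt (fun t : ℝ => (((v + t • EuclideanSpace.single j (1 : ℝ) : E d) i : ℝ) : ℂ))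
      (if i = j then 1 else 0) 0 := by
    intro i
    have : (fun t : ℝ => (((v + t • EuclideanSpace.single j (1 : ℝ) : E d) i : ℝ) : ℂ)) =
        fun t : ℝ => ((v i : ℝ) : ℂ) + (t : ℂ) * (if i = j then 1 else 0) := by
      ext t; by_cases h : i = j <;> simp [h]
    rw [this]
    have h3 : HasDerivAt (fun t : ℝ => (t : ℂ)) 1 0 := Complex.ofRealCLM.hasDerivAt
    simpa using (h3.mul_const (if i = j then (1 : ℂ) else 0)).const_add ((v i : ℝ) : ℂ)
  have h := HasDerivAt.fun_sum (u := Finset.univ) fun i _ => HasDerivAt.fun_sum (u := Finset.univ) fun l _ =>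
    (((hc i).mul_const (Θ i l)).mul (hc l))
  refine h.congr_deriv ?_
  simp only [zero_smul, add_zero, Finset.sum_add_distrib]
  have e1 : ∑ i, ∑ l, (if i = j then (1 : ℂ) else 0) * Θ i l * ((v l : ℝ) : ℂ) =
      ∑ l, Θ j l * ((v l : ℝ) : ℂ) := by
    rw [Finset.sum_comm]
    simp
  have e2 : ∑ i, ∑ l, ((v i : ℝ) : ℂ) * Θ i l * (if l = j then (1 : ℂ) else 0) =
      ∑ l, Θ j l * ((v l : ℝ) : ℂ) := by
    simp only [mul_ite, mul_one, mul_zero, Finset.sum_ite_eq', Finset.mem_univ, if_true]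
    refine Finset.sum_congr rfl fun i _ => ?_
    rw [mul_comm, hΘ.apply]
  rw [e1, e2]; ring

theorem contDiff_quad (Θ : Matrix (Fin d) (Fin d) ℂ) : ContDiff ℝ ∞ (quad Θ) := by
  have h : ∀ i : Fin d, ContDiff ℝ ∞ (fun v : E d => ((v i : ℝ) : ℂ)) := fun i =>
    Complex.ofRealCLM.contDiff.comp (by fun_prop : ContDiff ℝ ∞ (fun v : E d => v i))
  unfold quad
  exact ContDiff.sum fun i _ => ContDiff.sum fun l _ => ((h i).mul contDiff_const).mul (h l)

variable (ε : ℝ) (κ : Phase d ≃ Phase d) (S : Phase d → ℝ) (Θx Θy : Matrix (Fin d) (Fin d) ℂ)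

theorem contDiff_phase_y (x q p : E d) : ContDiff ℝ ∞ (fun y => phase κ S Θx Θy x y q p) := by
  unfold phase
  refine (ContDiff.add ?_ contDiff_const).add
    (contDiff_const.mul ((contDiff_quad Θy).comp (contDiff_id.sub contDiff_const)))
  refine Complex.ofRealCLM.contDiff.comp (contDiff_const.sub ?_)
  exact contDiff_const.inner ℝ (contDiff_id.sub contDiff_const)

-- The `y`-gradient involves neither `κ`, `S`, `Θx` nor `x`. This is why the explicit `grad` can
-- stand in for it throughout.
variable {Θy} in
theorem dirDeriv_phase (hy : Θy.IsSymm) (x y q p : E d) (j : Fin d) :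
    dirDeriv (EuclideanSpace.single j 1) (fun y' => phase κ S Θx Θy x y' q p) y =
      grad Θy j (x, y, q, p) := by
  set e : E d := EuclideanSpace.single j (1 : ℝ)
  have h1 : HasDerivAt (fun t : ℝ => phase κ S Θx Θy x (y + t • e) q p)
      (grad Θy j (x, y, q, p)) 0 := by
    have hq := (hasDerivAt_quad_line hy (y - q) j).const_mul (Complex.I / 2)
    have hi : HasDerivAt (fun t : ℝ => S (q, p) + ⟪(κ (q, p)).2, x - (κ (q, p)).1⟫ - ⟪p, (y + t • e) - q⟫)
        (-(p j)) 0 := by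
      have : (fun t : ℝ => S (q, p) + ⟪(κ (q, p)).2, x - (κ (q, p)).1⟫ - ⟪p, (y + t • e) - q⟫) =
          fun t : ℝ => (S (q, p) + ⟪(κ (q, p)).2, x - (κ (q, p)).1⟫ - ⟪p, y - q⟫) + t * (-(p j)) := by
        ext t
        have : y + t • e - q = (y - q) + t • e := by abel
        rw [this, inner_add_right, inner_smul_right]
        simp [e, EuclideanSpace.inner_single_right]
        ring
      rw [this]
      simpa using ((hasDerivAt_id (0 : ℝ)).mul_const (-(p j))).const_add
        (S (q, p) + ⟪(κ (q, p)).2, x - (κ (q, p)).1⟫ - ⟪p, y - q⟫)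
    have h := (hi.ofReal_comp.add_const (Complex.I / 2 * quad Θx (x - (κ (q, p)).1))).add hq
    have e1 : (fun t : ℝ => phase κ S Θx Θy x (y + t • e) q p) = fun t : ℝ =>
      (((S (q, p) + ⟪(κ (q, p)).2, x - (κ (q, p)).1⟫ - ⟪p, (y + t • e) - q⟫ : ℝ) : ℂ) +
        Complex.I / 2 * quad Θx (x - (κ (q, p)).1)) + Complex.I / 2 * quad Θy (y - q + t • e) := by
      ext t
      rw [phase, show y + t • e - q = y - q + t • e by abel]
    rw [e1]
    refine h.congr_deriv ?_
    simp only [grad]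
    push_cast
    simp only [PiLp.sub_apply]
    push_cast
    ring
  have h2 : HasDerivAt (fun t : ℝ => phase κ S Θx Θy x (y + t • e) q p)
      (dirDeriv e (fun y' => phase κ S Θx Θy x y' q p) y) 0 := by
    have hl : HasDerivAt (fun t : ℝ => y + t • e) e 0 := by
      simpa using ((hasDerivAt_id (0 : ℝ)).smul_const e).const_add y
    have hF : HasFDerivAt (fun y' => phase κ S Θx Θy x y' q p)
        (fderiv ℝ (fun y' => phase κ S Θx Θy x y' q p) y) (y + (0 : ℝ) • e) := by
      rw [zero_smul, add_zero]
      exact ((contDiff_phase_y κ S Θx Θy x q p).differentiable (by simp) y).hasFDerivAt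
    exact hF.comp_hasDerivAt 0 hl
  exact h2.unique h1

/-- The oscillating factor `e^{iΦ/ε}`. -/
def kern (x y q p : E d) : ℂ := Complex.exp (Complex.I / (ε : ℂ) * phase κ S Θx Θy x y q p)

/-- Only the two quadratic forms contribute to `Im Φ`; the remaining terms, and the imaginary parts
of `Θx` and `Θy`, merely oscillate. -/
theorem norm_kern (x y q p : E d) : ‖kern ε κ S Θx Θy x y q p‖ =
    Real.exp (-((quad Θx (x - (κ (q, p)).1)).re + (quad Θy (y - q)).re) / (2 * ε)) := by
  rw [kern, Complex.norm_exp]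
  congr 1
  have : Complex.I / (ε : ℂ) * phase κ S Θx Θy x y q p =
      ((1 / ε : ℝ) : ℂ) * (Complex.I * phase κ S Θx Θy x y q p) := by
    push_cast; ring
  rw [this, Complex.re_ofReal_mul, Complex.I_mul_re, phase]
  simp only [Complex.add_im, Complex.ofReal_im, Complex.mul_im, Complex.div_ofNat_re, Complex.I_re,
    Complex.div_ofNat_im, Complex.I_im]
  ring

variable {ε κ S Θx Θy}

theorem norm_kern_le (hε : 0 < ε) (hx : IsAdmissible Θx) (x y q p : E d) :
    ‖kern ε κ S Θx Θy x y q p‖ ≤ Real.exp (-(1 / (2 * ε)) * (quad Θy (y - q)).re) := by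
  rw [norm_kern, Real.exp_le_exp]
  have := quad_re_nonneg hx.posDef (x - (κ (q, p)).1)
  rw [neg_mul, one_div, inv_mul_eq_div, neg_div]
  gcongr
  linarith

theorem norm_kern_le_one (hε : 0 < ε) (hx : IsAdmissible Θx) (hy : IsAdmissible Θy) (x y q p : E d) :
    ‖kern ε κ S Θx Θy x y q p‖ ≤ 1 := by
  refine (norm_kern_le hε hx x y q p).trans (Real.exp_le_one_iff.2 ?_)
  have := quad_re_nonneg hy.posDef (y - q)
  have : 0 ≤ (1 / (2 * ε)) * (quad Θy (y - q)).re := by positivity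
  linarith

theorem continuous_kern (hκ : Continuous κ) (hS : Continuous S) :
    Continuous (fun z : Var d => kern ε κ S Θx Θy z.1 z.2.1 z.2.2.1 z.2.2.2) := by
  have h1 := continuous_quad Θx
  have h2 := continuous_quad Θy
  unfold kern phase
  fun_prop

theorem contDiff_kern_y (x q p : E d) : ContDiff ℝ ∞ (fun y => kern ε κ S Θx Θy x y q p) :=
  (contDiff_const.mul (contDiff_phase_y κ S Θx Θy x q p)).cexp

theorem dirDeriv_kern (hy : Θy.IsSymm) (x y q p : E d) (j : Fin d) :
    dirDeriv (EuclideanSpace.single j 1) (fun y' => kern ε κ S Θx Θy x y' q p) y =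
      Complex.I / (ε : ℂ) * grad Θy j (x, y, q, p) * kern ε κ S Θx Θy x y q p := by
  have hd := (contDiff_phase_y κ S Θx Θy x q p).differentiable (by simp) y
  have h := ((hd.hasFDerivAt.const_mul (Complex.I / (ε : ℂ))).cexp).fderiv
  rw [← dirDeriv_phase κ S Θx hy x y q p j]
  unfold kern dirDeriv
  rw [h]
  simp
  ring

end Phase

/-! ### Integration by parts -/

section Transpose

variable {d : ℕ} {ε : ℝ} {κ : Phase d ≃ Phase d} {S : Phase d → ℝ}
  {Θx Θy : Matrix (Fin d) (Fin d) ℂ}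

theorem contDiff_coeff_mul {W : Var d → ℂ} (hW : ContDiff ℝ ∞ W) (j : Fin d) :
    ContDiff ℝ ∞ (fun z' => (starRingEnd ℂ) (grad Θy j z') * W z' / (weight Θy z' : ℂ)) := by
  simp only [div_eq_mul_inv]
  exact ((Complex.conjCLE.contDiff.comp (contDiff_grad Θy j)).mul hW).mul (contDiff_weight_inv Θy)

theorem contDiff_transposeSym {W : Var d → ℂ} (hW : ContDiff ℝ ∞ W) :
    ContDiff ℝ ∞ (transposeSym Θy ε W) := by
  unfold transposeSym
  refine ContDiff.add ?_ (contDiff_const.mul (ContDiff.sum fun j _ =>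
    contDiff_dirDeriv (contDiff_coeff_mul hW j) _))
  simp only [div_eq_mul_inv]
  exact hW.mul (contDiff_weight_inv Θy)

theorem gradWeight_phase (hy : Θy.IsSymm) (x y q p : E d) :
    gradWeight (fun y' => phase κ S Θx Θy x y' q p) y = weight Θy (x, y, q, p) := by
  simp only [gradWeight, weight, dirDeriv_phase κ S Θx hy]

/-- The operator defined on functions of `y` alone is replaced by one on functions of all variables,
so that joint smoothness, and hence measurability in `(q, p, y)`, comes with the symbol calculus. -/
theorem transposeL_slice (hy : Θy.IsSymm) {W : Var d → ℂ} (hW : ContDiff ℝ ∞ W) (x q p : E d) :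
    transposeL ε (fun y' => phase κ S Θx Θy x y' q p) (fun y' => W (x, y', q, p)) =
      fun y => transposeSym Θy ε W (x, y, q, p) := by
  ext y
  simp only [transposeL, transposeSym, gradWeight_phase hy, dirDeriv_phase κ S Θx hy]
  congr 2
  refine Finset.sum_congr rfl fun j _ => ?_
  exact dirDeriv_slice ((contDiff_coeff_mul hW j).differentiable (by simp)) j x y q p

theorem iterate_transposeL_slice (hy : Θy.IsSymm) (k : ℕ) {W : Var d → ℂ} (hW : ContDiff ℝ ∞ W)
    (x q p : E d) :
    (transposeL ε (fun y' => phase κ S Θx Θy x y' q p))^[k] (fun y' => W (x, y', q, p)) =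
      fun y => (transposeSym Θy ε)^[k] W (x, y, q, p) := by
  induction k generalizing W with
  | zero => rfl
  | succ k ih =>
    rw [Function.iterate_succ_apply, transposeL_slice hy hW, ih (contDiff_transposeSym hW)]
    rfl

theorem integrable_decay (d : ℕ) : Integrable (fun y : E d => ((1 + ‖y‖) ^ (d + 1))⁻¹) := by
  have := integrable_one_add_norm (E := E d) (μ := volume) (r := (d + 1 : ℕ)) (by simp)
  refine this.congr (Filter.Eventually.of_forall fun y => ?_)
  simp only
  rw [Real.rpow_neg (by positivity), Real.rpow_natCast]

theorem integrable_of_decay {f : E d → ℂ} (hf : Continuous f) {M : ℝ}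
    (h : ∀ y, ‖f y‖ ≤ M * ((1 + ‖y‖) ^ (d + 1))⁻¹) : Integrable f :=
  ((integrable_decay d).const_mul M).mono' hf.aestronglyMeasurable (Filter.Eventually.of_forall h)

/-- The decay weight in the variable `y`. -/
def yDecay (d : ℕ) (z : Var d) : ℝ := ((1 + ‖z.2.1‖) ^ (d + 1))⁻¹

theorem yDecay_nonneg (z : Var d) : 0 ≤ yDecay d z := by unfold yDecay; positivity

theorem continuous_slice {G : Var d → ℂ} (hG : Continuous G) (x q p : E d) :
    Continuous (fun y => G (x, y, q, p)) := by fun_prop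

/-- The operator `L` fixes `e^{iΦ/ε}`, and `L†` is its transpose. The decay of `W` and of its first
derivatives makes every product integrable, so no boundary terms appear. -/
theorem integral_kern_transposeSym (hε : 0 < ε) (hx : IsAdmissible Θx) (hy : IsAdmissible Θy)
    {W : Var d → ℂ} (hW : IsSym (yDecay d) 1 W) (x q p : E d) :
    ∫ y, kern ε κ S Θx Θy x y q p * transposeSym Θy ε W (x, y, q, p) =
      ∫ y, kern ε κ S Θx Θy x y q p * W (x, y, q, p) := by
  set K : E d → ℂ := fun y => kern ε κ S Θx Θy x y q p with hK
  have hKc : ContDiff ℝ ∞ K := contDiff_kern_y x q p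
  have hK1 : ∀ y, ‖K y‖ ≤ 1 := fun y => norm_kern_le_one hε hx hy x y q p
  set b : Fin d → Var d → ℂ := fun j z' => (starRingEnd ℂ) (grad Θy j z') * W z' / (weight Θy z' : ℂ)
    with hb
  have hbs : ∀ j, IsSym (fun z => (√(weight Θy z))⁻¹ * yDecay d z) 1 (b j) := fun j => hW.coeff_mul j
  have hle : ∀ z, (√(weight Θy z))⁻¹ * yDecay d z ≤ yDecay d z := fun z =>
    mul_le_of_le_one_left (yDecay_nonneg z) (inv_le_one_of_one_le₀ (one_le_sqrt_weight Θy z))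
  have hint : ∀ G : Var d → ℂ, IsSym (yDecay d) 0 G → Integrable (fun y => K y * G (x, y, q, p)) := by
    rintro G ⟨hG, M, hM, hb⟩
    refine integrable_of_decay (M := M) (hKc.continuous.mul (continuous_slice hG.continuous x q p))
      fun y => ?_
    rw [norm_mul]
    exact (mul_le_of_le_one_left (norm_nonneg _) (hK1 y)).trans (hb (x, y, q, p))
  have hW' : IsSym (yDecay d) 0 (fun z => W z / (weight Θy z : ℂ)) := by
    simp only [div_eq_mul_inv]
    refine (hW.of_succ.mul (isSym_weight_inv Θy)).mono fun z => ?_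
    exact mul_le_of_le_one_right (yDecay_nonneg z) (inv_le_one_of_one_le₀ (one_le_weight Θy z))
  have hgb : ∀ j, IsSym (yDecay d) 0 (fun z => grad Θy j z * b j z) := fun j =>
    ((isSym_grad Θy j).mul (hbs j).of_succ).mono fun z => by
      have : 0 < √(weight Θy z) := Real.sqrt_pos.2 (weight_pos Θy z)
      apply le_of_eq; field_simp
  have hdb : ∀ j, IsSym (yDecay d) 0 (dirDeriv (yDir j) (b j)) := fun j => ((hbs j).2 j).mono hle
  -- The derivative moves to the kernel and brings down `(i/ε) ∂_jΦ`; the prefactor `iε` of `L†`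
  -- later cancels `-(i/ε)`.
  have hib : ∀ j, ∫ y, K y * dirDeriv (yDir j) (b j) (x, y, q, p) =
      -(Complex.I / ε) * ∫ y, K y * (grad Θy j (x, y, q, p) * b j (x, y, q, p)) := by
    intro j
    have hs : ∀ y, fderiv ℝ (fun y' => b j (x, y', q, p)) y (EuclideanSpace.single j 1) =
        dirDeriv (yDir j) (b j) (x, y, q, p) := fun y =>
      dirDeriv_slice (hbs j).differentiable j x y q p
    have hk : ∀ y, fderiv ℝ K y (EuclideanSpace.single j 1) =
        Complex.I / (ε : ℂ) * grad Θy j (x, y, q, p) * K y := fun y =>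
      dirDeriv_kern hy.symm x y q p j
    have hibp := integral_mul_fderiv_eq_neg_fderiv_mul_of_integrable (μ := (volume : Measure (E d)))
      (f := K) (g := fun y' => b j (x, y', q, p)) (v := EuclideanSpace.single j 1) ?_ ?_ ?_ ?_ ?_
    · simp only [hs, hk] at hibp
      rw [hibp, ← integral_const_mul, ← integral_neg]
      congr 1; ext y; ring
    · simp only [hk]
      refine ((hint _ (hgb j)).const_mul (Complex.I / ε)).congr (Filter.Eventually.of_forall fun y => ?_)
      simp only; ring
    · simp only [hs]
      exact hint _ (hdb j)
    · exact hint _ ((hbs j).of_succ.mono hle)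
    · exact fun y _ => hKc.differentiable (by simp) y
    · intro y _
      exact ((hbs j).differentiable _).comp y (hasFDerivAt_incl x y q p).differentiableAt
  have e1 : ∀ y, K y * transposeSym Θy ε W (x, y, q, p) =
      K y * (W (x, y, q, p) / (weight Θy (x, y, q, p) : ℂ)) +
        ∑ j, Complex.I * ε * (K y * dirDeriv (yDir j) (b j) (x, y, q, p)) := by
    intro y
    simp only [transposeSym]
    rw [mul_add, Finset.mul_sum, Finset.mul_sum]
    congr 1
    refine Finset.sum_congr rfl fun j _ => ?_
    ring
  -- This splits `W` according to `weight = 1 + ∑ |∂_jΦ|²`, to be matched term by term with `L† W`.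
  have e2 : ∀ y, K y * W (x, y, q, p) =
      K y * (W (x, y, q, p) / (weight Θy (x, y, q, p) : ℂ)) +
        ∑ j, K y * (grad Θy j (x, y, q, p) * b j (x, y, q, p)) := by
    intro y
    have hw : (weight Θy (x, y, q, p) : ℂ) ≠ 0 := by exact_mod_cast (weight_pos Θy _).ne'
    have hww := congrFun (weight_eq Θy) (x, y, q, p)
    have : ∑ j, K y * (grad Θy j (x, y, q, p) * b j (x, y, q, p)) =
        K y * (W (x, y, q, p) / (weight Θy (x, y, q, p) : ℂ)) *
          ∑ j, grad Θy j (x, y, q, p) * (starRingEnd ℂ) (grad Θy j (x, y, q, p)) := by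
      rw [Finset.mul_sum]
      refine Finset.sum_congr rfl fun j _ => ?_
      simp only [hb]; ring
    rw [this, ← mul_one_add, ← hww]
    field_simp
  have hεc : (ε : ℂ) ≠ 0 := by exact_mod_cast hε.ne'
  change ∫ y, K y * transposeSym Θy ε W (x, y, q, p) = ∫ y, K y * W (x, y, q, p)
  rw [integral_congr_ae (Filter.Eventually.of_forall e1),
    integral_congr_ae (Filter.Eventually.of_forall e2)]
  rw [integral_add (hint _ hW') (integrable_finsetSum _ fun j _ => (hint _ (hdb j)).const_mul _),
    integral_add (hint _ hW') (integrable_finsetSum _ fun j _ => hint _ (hgb j)),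
    integral_finsetSum _ fun j _ => (hint _ (hdb j)).const_mul _,
    integral_finsetSum _ fun j _ => hint _ (hgb j)]
  congr 1
  refine Finset.sum_congr rfl fun j _ => ?_
  rw [integral_const_mul, hib j, ← mul_assoc]
  have : Complex.I * (ε : ℂ) * (-(Complex.I / ε)) = 1 := by
    field_simp
    rw [Complex.I_sq]; norm_num
  rw [this, one_mul]

/-- The symbol `u(x, y, q, p) φ(y)`. -/
def amp (u : Var d → ℂ) (φ : 𝓢(E d, ℂ)) (z : Var d) : ℂ := u z * φ z.2.1

theorem isSym_amp {u : Var d → ℂ} (hu : IsBoundedSymbol u) (φ : 𝓢(E d, ℂ)) (n : ℕ) :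
    IsSym (yDecay d) n (amp u φ) :=
  (hu.isSym.mul (isSym_schwartz φ (d + 1))).mono fun z => by simp [yDecay]

theorem isSym_iterate_amp {u : Var d → ℂ} (hu : IsBoundedSymbol u) (φ : 𝓢(E d, ℂ)) (n k : ℕ) :
    IsSym (fun z => ((√(weight Θy z))⁻¹) ^ k * yDecay d z) n ((transposeSym Θy ε)^[k] (amp u φ)) :=
  IsSym.iterate_transposeSym ε yDecay_nonneg k (isSym_amp hu φ (n + k))

/-- All regularisations share the same inner `y`-integral, that of the original integrand. Only the
`y`-integral is treated here: without regularisation, absolute convergence in `p` is not available.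
-/
theorem integral_kern_iterate (hε : 0 < ε) (hx : IsAdmissible Θx) (hy : IsAdmissible Θy)
    {u : Var d → ℂ} (hu : IsBoundedSymbol u) (φ : 𝓢(E d, ℂ)) (k : ℕ) (x q p : E d) :
    ∫ y, kern ε κ S Θx Θy x y q p * (transposeSym Θy ε)^[k] (amp u φ) (x, y, q, p) =
      ∫ y, kern ε κ S Θx Θy x y q p * amp u φ (x, y, q, p) := by
  induction k with
  | zero => rfl
  | succ k ih =>
    rw [← ih]
    simp only [Function.iterate_succ_apply']
    refine integral_kern_transposeSym hε hx hy ((isSym_iterate_amp hu φ 1 k).mono fun z => ?_) x q p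
    exact mul_le_of_le_one_left (yDecay_nonneg z) (pow_le_one₀ (by positivity)
      (inv_le_one_of_one_le₀ (one_le_sqrt_weight Θy z)))

theorem integrand_eq (hy : Θy.IsSymm) {u : Var d → ℂ} (hu : IsBoundedSymbol u) (k : ℕ)
    (φ : 𝓢(E d, ℂ)) (x q p y : E d) :
    integrand ε κ S u Θx Θy k φ x (q, p, y) =
      kern ε κ S Θx Θy x y q p * (transposeSym Θy ε)^[k] (amp u φ) (x, y, q, p) := by
  have := congrFun (iterate_transposeL_slice (ε := ε) (κ := κ) (S := S) (Θx := Θx) hy k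
    (isSym_amp hu φ 0).smooth x q p) y
  simp only [integrand, kern]
  rw [← this]
  rfl

end Transpose

end FourierOp
end

noncomputable section

namespace FourierOp

/-! ### Absolute convergence -/

section Convergence

variable {d : ℕ} {ε : ℝ} {κ : Phase d ≃ Phase d} {S : Phase d → ℝ}
  {Θx Θy : Matrix (Fin d) (Fin d) ℂ} {u : Var d → ℂ}

theorem grad_re (Θ : Matrix (Fin d) (Fin d) ℂ) (j : Fin d) (x y q p : E d) :
    (grad Θ j (x, y, q, p)).re = -((p + (imMat Θ).toEuclideanLin (y - q)) j) := by
  simp only [grad, Complex.add_re, Complex.neg_re, Complex.ofReal_re, Complex.I_mul_re,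
    Complex.im_sum, PiLp.add_apply, Matrix.ofLp_toLpLin, Matrix.toLin'_apply, Matrix.mulVec,
    dotProduct, imMat, Matrix.map_apply, neg_add]
  simp

/-- The real part of the gradient is `-(p + Im Θ (y - q))`, so the weight controls `p` up to a
shear; the factor 2 comes from `(1 + t)² / 4 ≤ 1 + t²`. -/
theorem sqrt_weight_inv_le (Θ : Matrix (Fin d) (Fin d) ℂ) (x y q p : E d) :
    (√(weight Θ (x, y, q, p)))⁻¹ ≤ 2 * (1 + ‖p + (imMat Θ).toEuclideanLin (y - q)‖)⁻¹ := by
  set t := ‖p + (imMat Θ).toEuclideanLin (y - q)‖ with ht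
  have ht0 : 0 ≤ t := norm_nonneg _
  have h1 : 1 + t ^ 2 ≤ weight Θ (x, y, q, p) := by
    rw [weight, ht, EuclideanSpace.norm_sq_eq]
    gcongr with j _
    rw [← norm_neg, ← PiLp.neg_apply, PiLp.neg_apply, ← grad_re Θ j x y q p]
    exact Complex.abs_re_le_norm _
  have h2 : (1 + t) / 2 ≤ √(weight Θ (x, y, q, p)) := by
    refine Real.le_sqrt_of_sq_le ?_
    nlinarith [sq_nonneg (1 - t)]
  calc (√(weight Θ (x, y, q, p)))⁻¹ ≤ ((1 + t) / 2)⁻¹ := inv_anti₀ (by positivity) h2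
    _ = _ := by rw [inv_div, div_eq_mul_inv]

/-- Tonelli with two translations: integrating `p`, then `q`, then `y` removes the shifts one at a
time. -/
theorem lintegral_shear (g₁ g₂ g₃ : E d → ENNReal) (h₁ : Measurable g₁) (h₂ : Measurable g₂)
    (h₃ : Measurable g₃) (A : E d →L[ℝ] E d) :
    ∫⁻ z : E d × E d × E d, g₁ (z.2.2 - z.1) * g₂ (z.2.1 + A (z.2.2 - z.1)) * g₃ z.2.2 =
      (∫⁻ z, g₁ z) * (∫⁻ z, g₂ z) * ∫⁻ z, g₃ z := by
  have hA : Measurable A := A.continuous.measurable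
  calc ∫⁻ z : E d × E d × E d, g₁ (z.2.2 - z.1) * g₂ (z.2.1 + A (z.2.2 - z.1)) * g₃ z.2.2
      = ∫⁻ q, ∫⁻ w : E d × E d, g₁ (w.2 - q) * g₂ (w.1 + A (w.2 - q)) * g₃ w.2 :=
        lintegral_prod _ (by fun_prop)
    _ = ∫⁻ q, ∫⁻ y, ∫⁻ p, g₁ (y - q) * g₂ (p + A (y - q)) * g₃ y := by
        congr 1; ext q
        exact lintegral_prod_symm _ (by fun_prop)
    _ = ∫⁻ q, ∫⁻ y, g₁ (y - q) * (∫⁻ p, g₂ p) * g₃ y := by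
        congr 1; ext q; congr 1; ext y
        rw [lintegral_mul_const _ (by fun_prop), lintegral_const_mul _ (by fun_prop),
          lintegral_add_right_eq_self g₂]
    _ = ∫⁻ y, ∫⁻ q, g₁ (y - q) * (∫⁻ p, g₂ p) * g₃ y :=
        lintegral_lintegral_swap (by fun_prop)
    _ = ∫⁻ y, (∫⁻ z, g₁ z) * (∫⁻ z, g₂ z) * g₃ y := by
        congr 1; ext y
        rw [lintegral_mul_const _ (by fun_prop), lintegral_mul_const _ (by fun_prop),
          lintegral_sub_left_eq_self g₁]
    _ = _ := by rw [lintegral_const_mul _ h₃]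

/-- An integrable function of `(q, p, y)` that dominates the integrand, uniformly in `x`. -/
def domin (ε : ℝ) (Θ : Matrix (Fin d) (Fin d) ℂ) (z : E d × E d × E d) : ℝ :=
  Real.exp (-(1 / (2 * ε)) * (quad Θ (z.2.2 - z.1)).re) *
    ((1 + ‖z.2.1 + (imMat Θ).toEuclideanLin (z.2.2 - z.1)‖) ^ (d + 1))⁻¹ *
      ((1 + ‖z.2.2‖) ^ (d + 1))⁻¹

theorem continuous_domin (ε : ℝ) (Θ : Matrix (Fin d) (Fin d) ℂ) : Continuous (domin ε Θ) := by
  have hq : Continuous (quad Θ) := continuous_quad Θ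
  have hA : Continuous ((imMat Θ).toEuclideanLin) := LinearMap.continuous_of_finiteDimensional _
  have hpos : ∀ w : E d, (1 + ‖w‖) ^ (d + 1) ≠ 0 := fun w => by positivity
  unfold domin
  exact (Continuous.mul (by fun_prop) (Continuous.inv₀ (by fun_prop) fun z => hpos _)).mul
    (Continuous.inv₀ (by fun_prop) fun z => hpos _)

theorem integrable_domin_y (hε : 0 < ε) (hy : IsAdmissible Θy) (q p : E d) :
    Integrable (fun y => domin ε Θy (q, p, y)) := by
  refine (integrable_decay d).mono' ((continuous_domin ε Θy).comp
    (by fun_prop : Continuous fun y : E d => (q, p, y))).aestronglyMeasurable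
    (Filter.Eventually.of_forall fun y => ?_)
  have h1 : Real.exp (-(1 / (2 * ε)) * (quad Θy (y - q)).re) ≤ 1 := by
    rw [Real.exp_le_one_iff, neg_mul, neg_nonpos]
    have := quad_re_nonneg hy.posDef (y - q)
    positivity
  have h2 : ((1 + ‖p + (imMat Θy).toEuclideanLin (y - q)‖) ^ (d + 1))⁻¹ ≤ 1 :=
    inv_le_one_of_one_le₀ (one_le_pow₀ (by simp))
  rw [Real.norm_of_nonneg (by unfold domin; positivity)]
  exact mul_le_of_le_one_left (by positivity) (mul_le_one₀ h1 (by positivity) h2)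

theorem integrable_domin (hε : 0 < ε) (hy : IsAdmissible Θy) : Integrable (domin ε Θy) := by
  have hq : Continuous (quad Θy) := continuous_quad Θy
  refine ⟨(continuous_domin ε Θy).aestronglyMeasurable, ?_⟩
  have hdec : Measurable (fun w : E d => ENNReal.ofReal ((1 + ‖w‖) ^ (d + 1))⁻¹) := by fun_prop
  have h := lintegral_shear (fun z => ENNReal.ofReal (Real.exp (-(1 / (2 * ε)) * (quad Θy z).re)))
    (fun w : E d => ENNReal.ofReal ((1 + ‖w‖) ^ (d + 1))⁻¹)
    (fun w : E d => ENNReal.ofReal ((1 + ‖w‖) ^ (d + 1))⁻¹) (by fun_prop) hdec hdec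
    (LinearMap.toContinuousLinearMap (imMat Θy).toEuclideanLin)
  have hfin : ∫⁻ w : E d, ENNReal.ofReal ((1 + ‖w‖) ^ (d + 1))⁻¹ ≠ ⊤ := by
    have := (integrable_decay d).lintegral_lt_top
    exact this.ne
  rw [hasFiniteIntegral_iff_enorm]
  have e : ∀ z, ‖domin ε Θy z‖ₑ = ENNReal.ofReal (Real.exp (-(1 / (2 * ε)) * (quad Θy (z.2.2 - z.1)).re)) *
      ENNReal.ofReal ((1 + ‖z.2.1 + (imMat Θy).toEuclideanLin (z.2.2 - z.1)‖) ^ (d + 1))⁻¹ *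
      ENNReal.ofReal ((1 + ‖z.2.2‖) ^ (d + 1))⁻¹ := by
    intro z
    rw [domin, Real.enorm_of_nonneg (by positivity), ENNReal.ofReal_mul (by positivity),
      ENNReal.ofReal_mul (by positivity)]
  simp only [e]
  refine lt_of_eq_of_lt h ?_
  rw [lintegral_exp_neg_quad hy.posDef (by positivity)]
  exact ENNReal.mul_lt_top (ENNReal.mul_lt_top ENNReal.ofReal_lt_top hfin.lt_top) hfin.lt_top

/-- There are three sources of decay: the Gaussian in `y - q`, the `k` powers of `weight^{-1/2}` for
`p`, and the Schwartz function for `y`. The Gaussian in `x` is dropped, so the majorant is uniform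
in `x`. -/
theorem exists_norm_integrand_le (hε : 0 < ε) (hx : IsAdmissible Θx)
    (hy : IsAdmissible Θy) (hu : IsBoundedSymbol u) {k : ℕ} (hk : d < k) (φ : 𝓢(E d, ℂ)) :
    ∃ M : ℝ, 0 ≤ M ∧ ∀ x z, ‖integrand ε κ S u Θx Θy k φ x z‖ ≤ M * domin ε Θy z := by
  obtain ⟨-, M, hM, hb⟩ := isSym_iterate_amp (ε := ε) (Θy := Θy) hu φ 0 k
  refine ⟨M * 2 ^ k, by positivity, ?_⟩
  rintro x ⟨q, p, y⟩
  rw [integrand_eq hy.symm hu, norm_mul]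
  have h1 := norm_kern_le (κ := κ) (S := S) (Θy := Θy) hε hx x y q p
  have h2 := hb (x, y, q, p)
  set t := ‖p + (imMat Θy).toEuclideanLin (y - q)‖ with ht
  have ht0 : 0 ≤ t := norm_nonneg _
  have h3 : ((√(weight Θy (x, y, q, p)))⁻¹) ^ k ≤ 2 ^ k * ((1 + t) ^ (d + 1))⁻¹ := by
    calc ((√(weight Θy (x, y, q, p)))⁻¹) ^ k ≤ (2 * (1 + t)⁻¹) ^ k := by
          gcongr; exact sqrt_weight_inv_le Θy x y q p
      _ = 2 ^ k * ((1 + t) ^ k)⁻¹ := by rw [mul_pow, inv_pow]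
      _ ≤ _ := by
          gcongr
          · linarith
          -- Here `d < k` is read as `d + 1 ≤ k`, matching the integrable exponent `d + 1` in
          -- `domin`.
          · exact hk
  calc _ ≤ Real.exp (-(1 / (2 * ε)) * (quad Θy (y - q)).re) *
        (M * ((2 ^ k * ((1 + t) ^ (d + 1))⁻¹) * ((1 + ‖y‖) ^ (d + 1))⁻¹)) := by
        refine mul_le_mul h1 (h2.trans ?_) (norm_nonneg _) (Real.exp_pos _).le
        exact mul_le_mul_of_nonneg_left (mul_le_mul_of_nonneg_right h3 (yDecay_nonneg _)) hM
    _ = _ := by simp only [domin, ← ht]; ring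

theorem continuous_integrand (hκ : Continuous κ) (hS : Continuous S) (hy : IsAdmissible Θy)
    (hu : IsBoundedSymbol u) (k : ℕ) (φ : 𝓢(E d, ℂ)) :
    Continuous (fun w : E d × E d × E d × E d => integrand ε κ S u Θx Θy k φ w.1 w.2) := by
  have e : (fun w : E d × E d × E d × E d => integrand ε κ S u Θx Θy k φ w.1 w.2) = fun w =>
      (fun z : Var d => kern ε κ S Θx Θy z.1 z.2.1 z.2.2.1 z.2.2.2 *
        (transposeSym Θy ε)^[k] (amp u φ) z) (w.1, w.2.2.2, w.2.1, w.2.2.1) := by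
    ext ⟨x, q, p, y⟩
    exact integrand_eq hy.symm hu k φ x q p y
  rw [e]
  have h := (continuous_kern (ε := ε) (Θx := Θx) (Θy := Θy) hκ hS).mul
    (isSym_iterate_amp (ε := ε) (Θy := Θy) hu φ 0 k).smooth.continuous
  exact h.comp (by fun_prop : Continuous fun w : E d × E d × E d × E d =>
    ((w.1, w.2.2.2, w.2.1, w.2.2.1) : Var d))

theorem integrable_integrand (hκ : Continuous κ) (hS : Continuous S) (hε : 0 < ε)
    (hx : IsAdmissible Θx) (hy : IsAdmissible Θy) (hu : IsBoundedSymbol u) {k : ℕ} (hk : d < k)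
    (φ : 𝓢(E d, ℂ)) (x : E d) : Integrable (integrand ε κ S u Θx Θy k φ x) := by
  obtain ⟨M, hM, hb⟩ := exists_norm_integrand_le (κ := κ) (S := S) hε hx hy hu hk φ
  refine ((integrable_domin hε hy).const_mul M).mono' ?_ (Filter.Eventually.of_forall (hb x))
  have := continuous_integrand (ε := ε) (Θx := Θx) hκ hS hy hu k φ
  exact (this.comp (Continuous.prodMk_right x)).aestronglyMeasurable

/-- The `y`-integral of the unregularised integrand. -/
def wave (ε : ℝ) (κ : Phase d ≃ Phase d) (S : Phase d → ℝ) (u : Var d → ℂ)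
    (Θx Θy : Matrix (Fin d) (Fin d) ℂ) (φ : E d → ℂ) (x : E d) (w : Phase d) : ℂ :=
  ∫ y, kern ε κ S Θx Θy x y w.1 w.2 * (u (x, y, w.1, w.2) * φ y)

theorem integral_integrand_y (hε : 0 < ε) (hx : IsAdmissible Θx) (hy : IsAdmissible Θy)
    (hu : IsBoundedSymbol u) (k : ℕ) (φ : 𝓢(E d, ℂ)) (x q p : E d) :
    ∫ y, integrand ε κ S u Θx Θy k φ x (q, p, y) = wave ε κ S u Θx Θy φ x (q, p) := by
  simp only [integrand_eq hy.symm hu]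
  exact integral_kern_iterate hε hx hy hu φ k x q p

theorem integrable_prodAssoc {F : E d × E d × E d → ℂ} (hF : Integrable F) :
    Integrable (fun w : Phase d × E d => F (w.1.1, w.1.2, w.2)) :=
  (volume_preserving_prodAssoc.integrable_comp_emb MeasurableEquiv.prodAssoc.measurableEmbedding).2 hF

theorem integrable_wave (hκ : Continuous κ) (hS : Continuous S) (hε : 0 < ε)
    (hx : IsAdmissible Θx) (hy : IsAdmissible Θy) (hu : IsBoundedSymbol u)
    (φ : 𝓢(E d, ℂ)) (x : E d) : Integrable (wave ε κ S u Θx Θy φ x) := by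
  have h := (integrable_prodAssoc (integrable_integrand hκ hS hε hx hy hu (Nat.lt_succ_self d) φ x)).integral_prod_left
  refine h.congr (Filter.Eventually.of_forall fun w => ?_)
  exact integral_integrand_y hε hx hy hu _ φ x w.1 w.2

/-- The regularised integrand is absolutely integrable, so `y` may be integrated first, and there
the regularisation disappears. The right side no longer contains `k`. -/
theorem fio_eq (hκ : Continuous κ) (hS : Continuous S) (hε : 0 < ε)
    (hx : IsAdmissible Θx) (hy : IsAdmissible Θy) (hu : IsBoundedSymbol u) {k : ℕ} (hk : d < k)
    (φ : 𝓢(E d, ℂ)) (x : E d) : fio ε κ S u Θx Θy k φ x =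
      (((2 * Real.pi * ε) ^ (3 * (d : ℝ) / 2))⁻¹ : ℝ) * ∫ w, wave ε κ S u Θx Θy φ x w := by
  rw [fio]
  congr 1
  have h := integrable_prodAssoc (integrable_integrand hκ hS hε hx hy hu hk φ x)
  rw [← volume_preserving_prodAssoc.integral_comp MeasurableEquiv.prodAssoc.measurableEmbedding]
  refine (integral_prod _ h).trans ?_
  congr 1; ext w
  exact integral_integrand_y hε hx hy hu _ φ x w.1 w.2

/-- A majorant in `w` alone allows the integrals over `x` and `w` to be exchanged against any
integrable `ψ`. -/
theorem exists_norm_wave_le (hε : 0 < ε) (hx : IsAdmissible Θx)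
    (hy : IsAdmissible Θy) (hu : IsBoundedSymbol u) (φ : 𝓢(E d, ℂ)) :
    ∃ B : Phase d → ℝ, Integrable B ∧ ∀ x w, ‖wave ε κ S u Θx Θy φ x w‖ ≤ B w := by
  obtain ⟨M, hM, hb⟩ := exists_norm_integrand_le (κ := κ) (S := S) hε hx hy hu (Nat.lt_succ_self d) φ
  have hi : Integrable (fun w : Phase d × E d => M * domin ε Θy (w.1.1, w.1.2, w.2)) :=
    (volume_preserving_prodAssoc.integrable_comp_emb
      MeasurableEquiv.prodAssoc.measurableEmbedding).2 ((integrable_domin hε hy).const_mul M)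
  refine ⟨fun w => ‖∫ y, M * domin ε Θy (w.1, w.2, y)‖, hi.integral_prod_left.norm, fun x w => ?_⟩
  rw [← integral_integrand_y hε hx hy hu (d + 1) φ x w.1 w.2]
  exact (norm_integral_le_of_norm_le ((integrable_domin_y hε hy w.1 w.2).const_mul M)
    (Filter.Eventually.of_forall fun y => hb x _)).trans (le_abs_self _)

theorem stronglyMeasurable_wave (hκ : Continuous κ) (hS : Continuous S) (hu : Continuous u)
    (φ : 𝓢(E d, ℂ)) : StronglyMeasurable
      (fun z : E d × Phase d => wave ε κ S u Θx Θy φ z.1 z.2) := by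
  have h1 : Continuous (fun z : (E d × Phase d) × E d =>
      kern ε κ S Θx Θy z.1.1 z.2 z.1.2.1 z.1.2.2 * (u (z.1.1, z.2, z.1.2.1, z.1.2.2) * φ z.2)) := by
    have h2 := (continuous_kern (ε := ε) (Θx := Θx) (Θy := Θy) hκ hS).comp
      (by fun_prop : Continuous fun z : (E d × Phase d) × E d =>
        ((z.1.1, z.2, z.1.2.1, z.1.2.2) : Var d))
    have h3 := φ.continuous
    exact h2.mul (by fun_prop)
  exact h1.stronglyMeasurable.integral_prod_right'

end Convergence

end FourierOp
end

noncomputable section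

namespace FourierOp

/-! ### From weak estimates to bounded operators -/

section Extension

variable {d : ℕ} {ε : ℝ} {κ : Phase d ≃ Phase d} {S : Phase d → ℝ}
  {Θx Θy : Matrix (Fin d) (Fin d) ℂ} {u : Var d → ℂ}

theorem eLpNorm_two_sq {α : Type*} [MeasurableSpace α] (μ : Measure α) (g : α → ℂ) :
    eLpNorm g 2 μ ^ 2 = ∫⁻ x, ‖g x‖ₑ ^ 2 ∂μ := by
  simpa using eLpNorm_nnreal_pow_eq_lintegral (f := g) (μ := μ) (p := 2) (by norm_num)

/-- A bounded measurable function whose pairings with integrable functions are controlled by the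
`L²` norm belongs to `L²`. -/
theorem eLpNorm_le_of_pairing_le {F : E d → ℂ} (hF : StronglyMeasurable F) {R : ℝ}
    (hR : ∀ x, ‖F x‖ ≤ R) {N : ENNReal}
    (h : ∀ ψ : E d → ℂ, StronglyMeasurable ψ → Integrable ψ → ‖∫ x, ψ x * F x‖ₑ ≤ N * eLpNorm ψ 2 volume) :
    eLpNorm F 2 volume ≤ N := by
  have hball : ∀ n : ℕ, ∫⁻ x in Metric.ball (0 : E d) n, ‖F x‖ₑ ^ 2 ≤ N ^ 2 := by
    intro n
    set B := Metric.ball (0 : E d) n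
    have hB : MeasurableSet B := measurableSet_ball
    have hBfin : volume B ≠ ⊤ := measure_ball_lt_top.ne
    -- Testing with the conjugate of `F` on a ball gives `a² ≤ N a`, where `a` is the local `L²`
    -- norm. Boundedness of `F` and finite volume keep `a` finite, so one factor can be cancelled
    -- before the ball grows.
    set ψ : E d → ℂ := B.indicator fun x => (starRingEnd ℂ) (F x) with hψ
    have hFi : IntegrableOn (fun x => (starRingEnd ℂ) (F x)) B := by
      refine Measure.integrableOn_of_bounded (M := R) hBfin ?_ ?_
      · exact (Complex.continuous_conj.comp_stronglyMeasurable hF).aestronglyMeasurable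
      · exact Filter.Eventually.of_forall fun x => by simpa using hR x
    have hψi : Integrable ψ := hFi.integrable_indicator hB
    have h1 := h ψ ((Complex.continuous_conj.comp_stronglyMeasurable hF).indicator hB) hψi
    set a := eLpNorm ψ 2 volume with ha
    have ha2 : a ^ 2 = ∫⁻ x in B, ‖F x‖ₑ ^ 2 := by
      rw [ha, eLpNorm_two_sq, ← lintegral_indicator hB]
      congr 1; ext x
      by_cases hx : x ∈ B <;> simp [hψ, hx]
    have hfin : ∫⁻ x in B, ‖F x‖ₑ ^ 2 ≠ ⊤ := by
      refine ne_of_lt (lt_of_le_of_lt (setLIntegral_mono (g := fun _ => ENNReal.ofReal R ^ 2)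
        measurable_const fun x _ => ?_) ?_)
      · gcongr
        rw [← ofReal_norm]
        exact ENNReal.ofReal_le_ofReal (hR x)
      · rw [setLIntegral_const]
        exact ENNReal.mul_lt_top (by simp) hBfin.lt_top
    have h2 : ‖∫ x, ψ x * F x‖ₑ = ∫⁻ x in B, ‖F x‖ₑ ^ 2 := by
      have e1 : ∫ x, ψ x * F x = ((∫ x in B, ‖F x‖ ^ 2 : ℝ) : ℂ) := by
        rw [← integral_complex_ofReal, ← integral_indicator hB]
        congr 1; ext x
        by_cases hx : x ∈ B
        · simp only [hψ, hx, Set.indicator_of_mem]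
          rw [mul_comm, Complex.mul_conj, Complex.normSq_eq_norm_sq]
        · simp [hψ, hx]
      rw [e1]
      have hnn : 0 ≤ ∫ x in B, ‖F x‖ ^ 2 := integral_nonneg fun x => by positivity
      rw [← ofReal_norm, Complex.norm_real, Real.norm_of_nonneg hnn,
        integral_eq_lintegral_of_nonneg_ae (Filter.Eventually.of_forall fun x => by positivity)
          (by exact (hF.norm.pow 2).aestronglyMeasurable)]
      have e2 : ∀ x, ENNReal.ofReal (‖F x‖ ^ 2) = ‖F x‖ₑ ^ 2 := fun x => by
        rw [ENNReal.ofReal_pow (norm_nonneg _), ofReal_norm]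
      simp only [e2]
      exact ENNReal.ofReal_toReal hfin
    rw [h2, ← ha2] at h1
    rw [← ha2]
    by_cases ha0 : a = 0
    · simp [ha0]
    have hat : a ≠ ⊤ := fun hat => hfin (by rw [← ha2, hat]; simp)
    have : a ≤ N := by
      rw [sq] at h1
      exact (ENNReal.mul_le_mul_iff_left ha0 hat).1 h1
    gcongr
  have hlim := (aecover_ball (x := (0 : E d)) (μ := volume)
    tendsto_natCast_atTop_atTop).lintegral_tendsto_of_nat (f := fun x => ‖F x‖ₑ ^ 2)
    (hF.enorm.pow_const 2).aemeasurable
  have h3 : eLpNorm F 2 volume ^ 2 ≤ N ^ 2 := by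
    rw [eLpNorm_two_sq]
    exact le_of_tendsto' hlim hball
  exact (ENNReal.pow_le_pow_left_iff (two_ne_zero)).1 h3

/-- The weak form of an `L²` estimate with constant `A`. -/
def WeakBound (ε : ℝ) (κ : Phase d ≃ Phase d) (S : Phase d → ℝ) (u : Var d → ℂ)
    (Θx Θy : Matrix (Fin d) (Fin d) ℂ) (A : ℝ) : Prop := ∀ (φ : 𝓢(E d, ℂ)) (ψ : E d → ℂ), StronglyMeasurable ψ →
  Integrable ψ →
  ENNReal.ofReal ((2 * Real.pi * ε) ^ (3 * (d : ℝ) / 2))⁻¹ *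
    ∫⁻ w, ‖∫ x, ψ x * wave ε κ S u Θx Θy φ x w‖ₑ ≤
      ENNReal.ofReal A * eLpNorm φ 2 volume * eLpNorm ψ 2 volume

theorem stronglyMeasurable_fio (hκ : Continuous κ) (hS : Continuous S) (hε : 0 < ε)
    (hx : IsAdmissible Θx) (hy : IsAdmissible Θy) (hu : IsBoundedSymbol u) {k : ℕ} (hk : d < k)
    (φ : 𝓢(E d, ℂ)) : StronglyMeasurable (fio ε κ S u Θx Θy k φ) := by
  have h := (stronglyMeasurable_wave (ε := ε) (Θx := Θx) (Θy := Θy) hκ hS hu.smooth.continuous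
    φ).integral_prod_right' (ν := (volume : Measure (Phase d)))
  have e : fio ε κ S u Θx Θy k φ = fun x => (((2 * Real.pi * ε) ^ (3 * (d : ℝ) / 2))⁻¹ : ℝ) *
      ∫ w, wave ε κ S u Θx Θy φ x w := by
    ext x; exact fio_eq hκ hS hε hx hy hu hk φ x
  rw [e]
  exact h.const_mul _

/-- By duality it suffices to pair with `ψ`; Fubini puts the `x`-integral inside, where `WeakBound`
controls its modulus pointwise in `w` before integration. -/
theorem eLpNorm_fio_le (hκ : Continuous κ) (hS : Continuous S) (hε : 0 < ε)
    (hx : IsAdmissible Θx) (hy : IsAdmissible Θy) (hu : IsBoundedSymbol u) {A : ℝ}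
    (hA : WeakBound ε κ S u Θx Θy A) {k : ℕ} (hk : d < k) (φ : 𝓢(E d, ℂ)) :
    eLpNorm (fio ε κ S u Θx Θy k φ) 2 volume ≤ ENNReal.ofReal A * eLpNorm φ 2 volume := by
  obtain ⟨B, hB, hb⟩ := exists_norm_wave_le (κ := κ) (S := S) hε hx hy hu φ
  set c : ℝ := ((2 * Real.pi * ε) ^ (3 * (d : ℝ) / 2))⁻¹ with hc
  have hc0 : 0 ≤ c := by positivity
  refine eLpNorm_le_of_pairing_le (stronglyMeasurable_fio hκ hS hε hx hy hu hk φ)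
    (R := c * ∫ w, B w) (fun x => ?_) fun ψ hψm hψ => ?_
  · rw [fio_eq hκ hS hε hx hy hu hk, norm_mul, Complex.norm_real, Real.norm_of_nonneg hc0]
    exact mul_le_mul_of_nonneg_left (norm_integral_le_of_norm_le hB
      (Filter.Eventually.of_forall (hb x))) hc0
  · have hint : Integrable (fun z : E d × Phase d => ψ z.1 * wave ε κ S u Θx Θy φ z.1 z.2)
        ((volume : Measure (E d)).prod volume) := by
      refine (hψ.norm.mul_prod hB).mono' ?_ (Filter.Eventually.of_forall fun z => ?_)
      · exact hψ.1.comp_fst.mul (stronglyMeasurable_wave hκ hS hu.smooth.continuous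
          φ).aestronglyMeasurable
      · rw [norm_mul]
        exact mul_le_mul_of_nonneg_left (hb _ _) (norm_nonneg _)
    have e : ∫ x, ψ x * fio ε κ S u Θx Θy k φ x =
        (c : ℂ) * ∫ w, ∫ x, ψ x * wave ε κ S u Θx Θy φ x w := by
      rw [← integral_integral_swap hint, ← integral_const_mul]
      congr 1; ext x
      rw [fio_eq hκ hS hε hx hy hu hk, integral_const_mul]
      ring
    rw [e, enorm_mul]
    refine le_trans ?_ (hA φ ψ hψm hψ)
    have : ‖(c : ℂ)‖ₑ = ENNReal.ofReal c := by
      rw [← ofReal_norm, Complex.norm_real, Real.norm_of_nonneg hc0]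
    rw [this]
    exact mul_le_mul' le_rfl (enorm_integral_le_lintegral_enorm _)

theorem integrable_kern_amp (hε : 0 < ε)
    (hx : IsAdmissible Θx) (hy : IsAdmissible Θy) (hu : IsBoundedSymbol u) (φ : 𝓢(E d, ℂ))
    (x : E d) (w : Phase d) :
    Integrable (fun y => kern ε κ S Θx Θy x y w.1 w.2 * (u (x, y, w.1, w.2) * φ y)) := by
  obtain ⟨hs, M, hM, hb⟩ := isSym_amp hu φ 0
  refine integrable_of_decay (M := M) (((contDiff_kern_y x w.1 w.2).continuous).mul
    (continuous_slice hs.continuous x w.1 w.2)) fun y => ?_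
  rw [norm_mul]
  exact (mul_le_of_le_one_left (norm_nonneg _) (norm_kern_le_one hε hx hy x y w.1 w.2)).trans
    (hb (x, y, w.1, w.2))

/-- Linearity is read off the unregularised form, so the iterates of `L†` need not be expanded. -/
theorem fio_add (hκ : Continuous κ) (hS : Continuous S) (hε : 0 < ε)
    (hx : IsAdmissible Θx) (hy : IsAdmissible Θy) (hu : IsBoundedSymbol u) {k : ℕ} (hk : d < k)
    (φ₁ φ₂ : 𝓢(E d, ℂ)) : fio ε κ S u Θx Θy k (φ₁ + φ₂) =
      fio ε κ S u Θx Θy k φ₁ + fio ε κ S u Θx Θy k φ₂ := by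
  ext x
  rw [Pi.add_apply, fio_eq hκ hS hε hx hy hu hk, fio_eq hκ hS hε hx hy hu hk,
    fio_eq hκ hS hε hx hy hu hk, ← mul_add, ← integral_add (integrable_wave hκ hS hε hx hy hu φ₁ x)
    (integrable_wave hκ hS hε hx hy hu φ₂ x)]
  congr 2; ext w
  rw [wave, wave, wave, ← integral_add (integrable_kern_amp hε hx hy hu φ₁ x w)
    (integrable_kern_amp hε hx hy hu φ₂ x w)]
  congr 1; ext y
  simp; ring

theorem fio_smul (hκ : Continuous κ) (hS : Continuous S) (hε : 0 < ε)
    (hx : IsAdmissible Θx) (hy : IsAdmissible Θy) (hu : IsBoundedSymbol u) {k : ℕ} (hk : d < k)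
    (c : ℂ) (φ : 𝓢(E d, ℂ)) : fio ε κ S u Θx Θy k (c • φ) = c • fio ε κ S u Θx Θy k φ := by
  ext x
  rw [Pi.smul_apply, fio_eq hκ hS hε hx hy hu hk, fio_eq hκ hS hε hx hy hu hk, smul_eq_mul,
    mul_left_comm, ← integral_const_mul c]
  congr 2; ext w
  rw [wave, wave, ← integral_const_mul c]
  congr 1; ext y
  simp; ring

theorem existsUnique_extension (hκ : Continuous κ) (hS : Continuous S) (hε : 0 < ε)
    (hx : IsAdmissible Θx) (hy : IsAdmissible Θy) (hu : IsBoundedSymbol u) {A : ℝ} (hA0 : 0 ≤ A)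
    (hA : WeakBound ε κ S u Θx Θy A) :
    (∃! T : L2 d →L[ℂ] L2 d, IsL2Extension ε κ S u Θx Θy T) ∧
      ∀ T : L2 d →L[ℂ] L2 d, IsL2Extension ε κ S u Θx Θy T → ‖T‖ ≤ A := by
  -- The least admissible `k` defines the operator; `fio_eq` transfers the result to all others.
  have hd1 : d < d + 1 := Nat.lt_succ_self d
  have hmem : ∀ φ : 𝓢(E d, ℂ), MemLp (fio ε κ S u Θx Θy (d + 1) φ) 2 volume := fun φ =>
    ⟨(stronglyMeasurable_fio hκ hS hε hx hy hu hd1 φ).aestronglyMeasurable,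
      (eLpNorm_fio_le hκ hS hε hx hy hu hA hd1 φ).trans_lt
        (ENNReal.mul_lt_top ENNReal.ofReal_lt_top (φ.memLp 2 volume).2)⟩
  let L : 𝓢(E d, ℂ) →ₗ[ℂ] L2 d :=
    { toFun := fun φ => (hmem φ).toLp _
      map_add' := fun φ₁ φ₂ => by
        rw [← MemLp.toLp_add]
        exact MemLp.toLp_congr _ _ (by rw [fio_add hκ hS hε hx hy hu hd1])
      map_smul' := fun c φ => by
        rw [RingHom.id_apply, ← MemLp.toLp_const_smul]
        exact MemLp.toLp_congr _ _ (by rw [fio_smul hκ hS hε hx hy hu hd1]) }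
  let e : 𝓢(E d, ℂ) →ₗ[ℂ] L2 d := (SchwartzMap.toLpCLM ℂ ℂ 2 (volume : Measure (E d))).toLinearMap
  have he : ∀ φ, e φ = φ.toLp 2 volume := fun φ => rfl
  have hdense : DenseRange e := SchwartzMap.denseRange_toLpCLM ENNReal.ofNat_ne_top
  have hL : ∀ φ, ‖L φ‖ ≤ A * ‖e φ‖ := by
    intro φ
    change ‖(hmem φ).toLp _‖ ≤ A * ‖φ.toLp 2 volume‖
    rw [Lp.norm_toLp, SchwartzMap.norm_toLp, ← ENNReal.toReal_ofReal hA0, ← ENNReal.toReal_mul]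
    exact ENNReal.toReal_mono (ENNReal.mul_ne_top ENNReal.ofReal_ne_top (φ.memLp 2 volume).2.ne)
      (eLpNorm_fio_le hκ hS hε hx hy hu hA hd1 φ)
  have hext : ∀ T : L2 d →L[ℂ] L2 d, IsL2Extension ε κ S u Θx Θy T ↔ ∀ φ, T (e φ) = L φ := by
    intro T
    constructor
    · intro hT φ
      apply Lp.ext
      exact (hT (d + 1) hd1 φ).trans (hmem φ).coeFn_toLp.symm
    · intro hT k hk φ
      rw [← he, hT]
      refine (hmem φ).coeFn_toLp.trans (Filter.Eventually.of_forall fun x => ?_)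
      rw [fio_eq hκ hS hε hx hy hu hd1, fio_eq hκ hS hε hx hy hu hk]
  have huniq : ∀ T : L2 d →L[ℂ] L2 d, IsL2Extension ε κ S u Θx Θy T → L.extendOfNorm e = T :=
    fun T hT => LinearMap.extendOfNorm_unique hdense A hL T
      (LinearMap.ext fun φ => (hext T).1 hT φ)
  refine ⟨⟨L.extendOfNorm e, ?_, fun T hT => (huniq T hT).symm⟩, fun T hT => ?_⟩
  · exact (hext _).2 fun φ => LinearMap.extendOfNorm_eq hdense ⟨A, hL⟩ φ
  · rw [← huniq T hT]
    exact ContinuousLinearMap.opNorm_le_bound _ hA0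
      (LinearMap.norm_extendOfNorm_apply_le hdense A hL)

end Extension

end FourierOp
end

noncomputable section

namespace FourierOp

/-! ### Wave packet transforms -/

section Packets

variable {d : ℕ} {ε τ : ℝ} {Θ : Matrix (Fin d) (Fin d) ℂ}

/-- The wave packet centred at the phase space point `w`. -/
def packet (τ ε : ℝ) (Θ : Matrix (Fin d) (Fin d) ℂ) (w : Phase d) (y : E d) : ℂ :=
  Complex.exp (Complex.I * (τ * ⟪w.2, y - w.1⟫ : ℝ)) *
    Complex.exp (-(quad Θ (y - w.1)) / (2 * ε : ℝ))

/-- The wave packet transform. -/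
def packetTransform (τ ε : ℝ) (Θ : Matrix (Fin d) (Fin d) ℂ) (h : E d → ℂ) (w : Phase d) : ℂ :=
  ∫ y, h y * packet τ ε Θ w y

theorem norm_exp_quad (v : E d) : ‖Complex.exp (-(quad Θ v) / (2 * ε : ℝ))‖ =
    Real.exp (-(quad Θ v).re / (2 * ε)) := by
  rw [Complex.norm_exp, Complex.div_ofReal_re, Complex.neg_re]

theorem norm_packet (w : Phase d) (y : E d) :
    ‖packet τ ε Θ w y‖ = Real.exp (-(quad Θ (y - w.1)).re / (2 * ε)) := by
  rw [packet, norm_mul, mul_comm Complex.I, Complex.norm_exp_ofReal_mul_I, one_mul, norm_exp_quad]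

theorem norm_exp_quad_le_one (hε : 0 < ε) (hΘ : IsAdmissible Θ) (v : E d) :
    Real.exp (-(quad Θ v).re / (2 * ε)) ≤ 1 := by
  rw [Real.exp_le_one_iff, neg_div, neg_nonpos]
  have := quad_re_nonneg hΘ.posDef v
  positivity

theorem continuous_packet :
    Continuous (fun z : Phase d × E d => packet τ ε Θ z.1 z.2) := by
  have := continuous_quad Θ
  unfold packet; fun_prop

theorem integrable_mul_packet (hε : 0 < ε) (hΘ : IsAdmissible Θ) {h : E d → ℂ} (hh : Integrable h)
    (w : Phase d) : Integrable (fun y => h y * packet τ ε Θ w y) := by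
  refine hh.mul_bdd (c := 1)
    (continuous_packet.comp (Continuous.prodMk_right w)).aestronglyMeasurable
    (Filter.Eventually.of_forall fun y => ?_)
  rw [norm_packet]
  exact norm_exp_quad_le_one hε hΘ _

theorem stronglyMeasurable_packetTransform {h : E d → ℂ} (hh : StronglyMeasurable h) :
    StronglyMeasurable (packetTransform τ ε Θ h) := by
  have : StronglyMeasurable (fun z : Phase d × E d => h z.2 * packet τ ε Θ z.1 z.2) :=
    (hh.comp_measurable measurable_snd).mul continuous_packet.stronglyMeasurable
  exact this.integral_prod_right'

/-- For fixed `q` this is Plancherel in `p` at scale `ε`, applied to `h` times the Gaussian;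
squaring the Gaussian doubles its exponent. Only `|τ|` matters, which covers the opposite signs in
`x` and `y`. -/
theorem lintegral_packetTransform_sq_le (hε : 0 < ε) (hτ : |τ| = 1 / ε) (hΘ : IsAdmissible Θ)
    {h : E d → ℂ} (hh : Integrable h) (q : E d) :
    ∫⁻ p, ‖packetTransform τ ε Θ h (q, p)‖ₑ ^ 2 ≤ ENNReal.ofReal ((2 * Real.pi * ε) ^ d) *
      ∫⁻ y, ‖h y‖ₑ ^ 2 * ENNReal.ofReal (Real.exp (-(1 / ε) * (quad Θ (y - q)).re)) := by
  have hτ0 : τ ≠ 0 := by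
    intro h0; rw [h0, abs_zero] at hτ; exact (one_div_pos.2 hε).ne hτ
  have hq := continuous_quad Θ
  have hint : Integrable (fun y => h y * Complex.exp (-(quad Θ (y - q)) / (2 * ε : ℝ))) := by
    refine hh.mul_bdd (c := 1) (by fun_prop) (Filter.Eventually.of_forall fun y => ?_)
    rw [norm_exp_quad]
    exact norm_exp_quad_le_one hε hΘ _
  have h1 := lintegral_oscillatory_sq_le hint q hτ0
  have e1 : ∀ p, packetTransform τ ε Θ h (q, p) =
      ∫ y, h y * Complex.exp (-(quad Θ (y - q)) / (2 * ε : ℝ)) *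
        Complex.exp (Complex.I * (τ * ⟪p, y - q⟫ : ℝ)) := by
    intro p
    unfold packetTransform packet
    congr 1; ext y; ring
  simp only [e1]
  refine h1.trans (le_of_eq ?_)
  congr 1
  · rw [hτ]; congr 2; field_simp
  · congr 1; ext y
    rw [enorm_mul, mul_pow, ← ofReal_norm (Complex.exp _), norm_exp_quad,
      ← ENNReal.ofReal_pow (Real.exp_pos _).le, ← Real.exp_nat_mul]
    congr 3
    push_cast; field_simp

/-- The wave packet transform is bounded from `L²` to `L²`. -/
theorem lintegral_packetTransform_sq_le' (hε : 0 < ε) (hτ : |τ| = 1 / ε) (hΘ : IsAdmissible Θ)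
    {h : E d → ℂ} (hm : StronglyMeasurable h) (hh : Integrable h) :
    ∫⁻ w, ‖packetTransform τ ε Θ h w‖ₑ ^ 2 ≤
      ENNReal.ofReal ((2 * Real.pi * ε) ^ d * (Real.pi * ε) ^ ((d : ℝ) / 2) *
        ((reMat Θ).det ^ (1 / 2 : ℝ))⁻¹) * eLpNorm h 2 volume ^ 2 := by
  have hq := continuous_quad Θ
  have hme := hm.enorm
  set γ : E d → ENNReal := fun z => ENNReal.ofReal (Real.exp (-(1 / ε) * (quad Θ z).re)) with hγ
  have hγm : Measurable γ := by fun_prop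
  calc ∫⁻ w, ‖packetTransform τ ε Θ h w‖ₑ ^ 2
      ≤ ∫⁻ q, ∫⁻ p, ‖packetTransform τ ε Θ h (q, p)‖ₑ ^ 2 := lintegral_prod_le _
    _ ≤ ∫⁻ q, ENNReal.ofReal ((2 * Real.pi * ε) ^ d) * ∫⁻ y, ‖h y‖ₑ ^ 2 * γ (y - q) :=
        lintegral_mono fun q => lintegral_packetTransform_sq_le hε hτ hΘ hh q
    _ = ENNReal.ofReal ((2 * Real.pi * ε) ^ d) * ∫⁻ q, ∫⁻ y, ‖h y‖ₑ ^ 2 * γ (y - q) :=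
        lintegral_const_mul' _ _ ENNReal.ofReal_ne_top
    _ = ENNReal.ofReal ((2 * Real.pi * ε) ^ d) * ∫⁻ y, ∫⁻ q, ‖h y‖ₑ ^ 2 * γ (y - q) := by
        rw [lintegral_lintegral_swap]
        exact Measurable.aemeasurable (by fun_prop)
    _ = ENNReal.ofReal ((2 * Real.pi * ε) ^ d) * ((∫⁻ y, ‖h y‖ₑ ^ 2) * ∫⁻ z, γ z) := by
        congr 1
        rw [← lintegral_mul_const _ (by fun_prop)]
        congr 1; ext y
        rw [lintegral_const_mul _ (by fun_prop), lintegral_sub_left_eq_self γ]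
    _ = _ := by
        rw [hγ, lintegral_exp_neg_quad hΘ.posDef (by positivity), eLpNorm_two_sq,
          mul_comm (∫⁻ y, ‖h y‖ₑ ^ 2), ← mul_assoc, ← ENNReal.ofReal_mul (by positivity)]
        congr 2
        rw [div_div_eq_mul_div, div_one]; ring

end Packets

/-! ### Cauchy-Schwarz on phase space -/

theorem lintegral_mul_sq_le {α : Type*} [MeasurableSpace α] {μ : Measure α} {f g : α → ENNReal}
    (hf : AEMeasurable f μ) (hg : AEMeasurable g μ) :
    (∫⁻ a, f a * g a ∂μ) ^ 2 ≤ (∫⁻ a, f a ^ 2 ∂μ) * ∫⁻ a, g a ^ 2 ∂μ := by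
  have h := ENNReal.lintegral_mul_le_Lp_mul_Lq μ (Real.HolderConjugate.two_two) hf hg
  have h2 : (∫⁻ a, f a * g a ∂μ) ^ 2 ≤ ((∫⁻ a, f a ^ (2 : ℝ) ∂μ) ^ (1 / 2 : ℝ) *
      (∫⁻ a, g a ^ (2 : ℝ) ∂μ) ^ (1 / 2 : ℝ)) ^ 2 := by
    gcongr; exact h
  refine h2.trans (le_of_eq ?_)
  rw [mul_pow, ← ENNReal.rpow_natCast, ← ENNReal.rpow_natCast, ← ENNReal.rpow_mul,
    ← ENNReal.rpow_mul]
  norm_num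

variable {d : ℕ} {κ : Phase d ≃ Phase d}

/-- Cauchy-Schwarz, combined with the fact that composition with `κ` does not change the `L²` norm.
-/
theorem IsCanonical.lintegral_mul_le (h : IsCanonical κ) {F₁ F₂ : Phase d → ENNReal}
    (h₁ : Measurable F₁) (h₂ : Measurable F₂) {K₁ K₂ : ℝ} (hK₁ : 0 ≤ K₁) (e₁ e₂ : ENNReal)
    (hF₁ : ∫⁻ w, F₁ w ^ 2 ≤ ENNReal.ofReal K₁ * e₁ ^ 2)
    (hF₂ : ∫⁻ w, F₂ w ^ 2 ≤ ENNReal.ofReal K₂ * e₂ ^ 2) :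
    ∫⁻ w, F₁ (κ w) * F₂ w ≤ ENNReal.ofReal (√(K₁ * K₂)) * e₁ * e₂ := by
  have hm : Measurable κ := h.smooth.continuous.measurable
  have h3 := lintegral_mul_sq_le (μ := volume) (h₁.comp hm).aemeasurable h₂.aemeasurable
  rw [← ENNReal.pow_le_pow_left_iff (two_ne_zero)]
  refine h3.trans ?_
  have h4 := h.lintegral_comp (fun w => F₁ w ^ 2)
  simp only [Function.comp_def]
  rw [h4]
  refine (mul_le_mul' hF₁ hF₂).trans (le_of_eq ?_)
  rw [mul_pow, mul_pow, ← ENNReal.ofReal_pow (Real.sqrt_nonneg _)]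
  by_cases hK₂ : 0 ≤ K₂
  · rw [Real.sq_sqrt (mul_nonneg hK₁ hK₂), ENNReal.ofReal_mul hK₁]
    ring
  · push Not at hK₂
    rw [ENNReal.ofReal_of_nonpos hK₂.le, Real.sqrt_eq_zero_of_nonpos (mul_nonpos_of_nonneg_of_nonpos hK₁ hK₂.le)]
    simp

/-! ### Factorisation of the kernel -/

section Factor

variable {ε : ℝ} {S : Phase d → ℝ} {Θx Θy : Matrix (Fin d) (Fin d) ℂ} {u : Var d → ℂ}

/-- The phase is a sum of a function of `w`, one of `(x, κ w)` and one of `(y, w)`, so at each `w`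
the kernel has rank one. The sign in `-p · (y - q)` explains the frequency `-1/ε`. -/
theorem kern_eq (x y : E d) (w : Phase d) : kern ε κ S Θx Θy x y w.1 w.2 =
    Complex.exp ((S w / ε : ℝ) * Complex.I) *
      (packet (1 / ε) ε Θx (κ w) x * packet (-(1 / ε)) ε Θy w y) := by
  simp only [kern, packet, ← Complex.exp_add, phase, Prod.mk.eta]
  congr 1
  push_cast
  ring_nf
  rw [Complex.I_sq]
  ring

theorem enorm_exp_action (w : Phase d) : ‖Complex.exp ((S w / ε : ℝ) * Complex.I)‖ₑ = 1 := by
  rw [← ofReal_norm, Complex.norm_exp_ofReal_mul_I, ENNReal.ofReal_one]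

theorem abs_one_div (hε : 0 < ε) : |1 / ε| = 1 / ε := abs_of_pos (by positivity)

theorem abs_neg_one_div (hε : 0 < ε) : |-(1 / ε)| = 1 / ε := by
  rw [abs_neg, abs_one_div hε]

theorem sqrt_mul_det {B a b : ℝ} (hB : 0 ≤ B) (ha : 0 < a) (hb : 0 < b) :
    √((B * (a ^ (1 / 2 : ℝ))⁻¹) * (B * (b ^ (1 / 2 : ℝ))⁻¹)) = B / (a * b) ^ (1 / 4 : ℝ) := by
  rw [Real.sqrt_eq_iff_mul_self_eq (by positivity) (by positivity), div_mul_div_comm,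
    ← Real.rpow_add (mul_pos ha hb), Real.mul_rpow ha.le hb.le]
  norm_num
  field_simp

/-- The weak estimate for symbols that depend on `(q, p)` only. -/
theorem weakBound_of_phase_symbol (hκ : IsCanonical κ) (hε : 0 < ε) (hx : IsAdmissible Θx)
    (hy : IsAdmissible Θy) {a : Phase d → ℂ} (ha : IsBoundedSymbol a) :
    WeakBound ε κ S (fun z : Var d => a z.2.2) Θx Θy ((2 : ℝ) ^ (-(d : ℝ) / 2) *
      ((⨆ z : Phase d, ‖a z‖) / ((reMat Θx).det * (reMat Θy).det) ^ (1 / 4 : ℝ))) := by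
  intro φ ψ hψm hψ
  set m := ⨆ z : Phase d, ‖a z‖ with hm
  have ham : ∀ z, ‖a z‖ₑ ≤ ENNReal.ofReal m := by
    intro z
    obtain ⟨M, hM, hb⟩ := ha.exists_norm_le
    rw [← ofReal_norm]
    exact ENNReal.ofReal_le_ofReal (le_ciSup (f := fun z => ‖a z‖) ⟨M, by rintro _ ⟨z, rfl⟩; exact hb z⟩ z)
  have hm0 : 0 ≤ m := Real.iSup_nonneg fun z => norm_nonneg _
  have e1 : ∀ w, ‖∫ x, ψ x * wave ε κ S (fun z : Var d => a z.2.2) Θx Θy φ x w‖ₑ ≤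
      ENNReal.ofReal m * (‖packetTransform (1 / ε) ε Θx ψ (κ w)‖ₑ *
        ‖packetTransform (-(1 / ε)) ε Θy φ w‖ₑ) := by
    intro w
    have : ∫ x, ψ x * wave ε κ S (fun z : Var d => a z.2.2) Θx Θy φ x w =
        a w * (Complex.exp ((S w / ε : ℝ) * Complex.I) * (packetTransform (1 / ε) ε Θx ψ (κ w) *
          packetTransform (-(1 / ε)) ε Θy φ w)) := by
      have hw : ∀ x, wave ε κ S (fun z : Var d => a z.2.2) Θx Θy φ x w =
          (a w * Complex.exp ((S w / ε : ℝ) * Complex.I) *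
            packetTransform (-(1 / ε)) ε Θy φ w) * packet (1 / ε) ε Θx (κ w) x := by
        intro x
        rw [wave, packetTransform, ← integral_const_mul, ← integral_mul_const]
        congr 1; ext y
        rw [kern_eq]
        simp only [Prod.mk.eta]
        ring
      simp only [hw]
      change _ = a w * (Complex.exp ((S w / ε : ℝ) * Complex.I) *
        ((∫ x, ψ x * packet (1 / ε) ε Θx (κ w) x) * packetTransform (-(1 / ε)) ε Θy φ w))
      rw [← integral_mul_const, ← integral_const_mul, ← integral_const_mul]
      congr 1; ext x
      ring
    rw [this, enorm_mul, enorm_mul, enorm_exp_action, one_mul, enorm_mul]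
    exact mul_le_mul' (ham w) le_rfl
  have hφm : StronglyMeasurable φ := φ.continuous.stronglyMeasurable
  set B : ℝ := (2 * Real.pi * ε) ^ d * (Real.pi * ε) ^ ((d : ℝ) / 2) with hB
  have hB0 : 0 ≤ B := by positivity
  have hdx := hx.posDef.det_pos
  have hdy := hy.posDef.det_pos
  have h2 := hκ.lintegral_mul_le (stronglyMeasurable_packetTransform hψm).enorm
    (stronglyMeasurable_packetTransform hφm).enorm (by positivity) _ _
    (lintegral_packetTransform_sq_le' hε (abs_one_div hε) hx hψm hψ)
    (lintegral_packetTransform_sq_le' hε (abs_neg_one_div hε) hy hφm φ.integrable)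
  have h3 : ∫⁻ w, ‖∫ x, ψ x * wave ε κ S (fun z : Var d => a z.2.2) Θx Θy φ x w‖ₑ ≤
      ENNReal.ofReal m * (ENNReal.ofReal (√((B * ((reMat Θx).det ^ (1 / 2 : ℝ))⁻¹) *
        (B * ((reMat Θy).det ^ (1 / 2 : ℝ))⁻¹))) * eLpNorm ψ 2 volume * eLpNorm φ 2 volume) := by
    refine (lintegral_mono e1).trans ?_
    rw [lintegral_const_mul' _ _ ENNReal.ofReal_ne_top]
    exact mul_le_mul' le_rfl h2
  refine (mul_le_mul' le_rfl h3).trans (le_of_eq ?_)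
  rw [sqrt_mul_det hB0 hdx hdy]
  have hdd : 0 ≤ B / ((reMat Θx).det * (reMat Θy).det) ^ (1 / 4 : ℝ) := by positivity
  have e2 : (2 : ℝ) ^ (-(d : ℝ) / 2) * (m / ((reMat Θx).det * (reMat Θy).det) ^ (1 / 4 : ℝ)) =
      ((2 * Real.pi * ε) ^ (3 * (d : ℝ) / 2))⁻¹ *
        (m * (B / ((reMat Θx).det * (reMat Θy).det) ^ (1 / 4 : ℝ))) := by
    -- The powers of `π ε` cancel between the normalisation and the packet bounds; what survives is
    -- `2^{-3d/2} * 2^d`.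
    have h5 : (2 : ℝ) ^ (-(d : ℝ) / 2) = ((2 * Real.pi * ε) ^ (3 * (d : ℝ) / 2))⁻¹ * B := by
      have hpe : 0 < Real.pi * ε := by positivity
      rw [hB, mul_assoc 2 Real.pi ε, Real.mul_rpow (by norm_num) hpe.le,
        ← Real.rpow_natCast (2 * (Real.pi * ε)), Real.mul_rpow (by norm_num) hpe.le, mul_inv,
        ← Real.rpow_neg (by norm_num), ← Real.rpow_neg hpe.le]
      calc (2 : ℝ) ^ (-(d : ℝ) / 2)
          = (2 : ℝ) ^ (-(3 * (d : ℝ) / 2) + d) *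
              (Real.pi * ε) ^ (-(3 * (d : ℝ) / 2) + d + d / 2) := by
            rw [show -(3 * (d : ℝ) / 2) + d + d / 2 = 0 by ring, Real.rpow_zero, mul_one]
            congr 1; ring
        _ = _ := by
            rw [Real.rpow_add (by norm_num), Real.rpow_add hpe, Real.rpow_add hpe]; ring
    rw [h5]; ring
  rw [e2, ENNReal.ofReal_mul (by positivity), ENNReal.ofReal_mul hm0]
  ring

end Factor

end FourierOp
end

noncomputable section

namespace FourierOp

/-! ### Exponential weights -/

section ExpWeight

theorem integrable_exp_neg_mul_abs {a : ℝ} (ha : 0 < a) :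
    Integrable (fun t : ℝ => Real.exp (-a * |t|)) := by
  rw [← integrableOn_univ, ← Set.Iic_union_Ioi (a := (0 : ℝ))]
  refine IntegrableOn.union ?_ ?_
  · refine (integrableOn_exp_mul_Iic ha 0).congr_fun (fun t ht => ?_) measurableSet_Iic
    simp only
    rw [abs_of_nonpos ht]; ring_nf
  · refine (integrableOn_exp_mul_Ioi (neg_lt_zero.2 ha) 0).congr_fun (fun t ht => ?_) measurableSet_Ioi
    simp only
    rw [abs_of_pos ht]

theorem integral_exp_neg_mul_abs {a : ℝ} (ha : 0 < a) :
    ∫ t : ℝ, Real.exp (-a * |t|) = 2 / a := by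
  rw [integral_comp_abs (f := fun t => Real.exp (-a * t)), integral_exp_mul_Ioi (neg_lt_zero.2 ha)]
  simp; ring

variable {d : ℕ}

/-- The `ℓ¹` norm on `ℝ^d`. -/
def normOne (z : E d) : ℝ := ∑ j, |z j|

theorem continuous_normOne : Continuous (normOne (d := d)) := by unfold normOne; fun_prop

theorem normOne_add_le (z w : E d) : normOne (z + w) ≤ normOne z + normOne w := by
  unfold normOne
  rw [← Finset.sum_add_distrib]
  exact Finset.sum_le_sum fun j _ => abs_add_le _ _

theorem exp_neg_mul_normOne (a : ℝ) (z : E d) :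
    Real.exp (-a * normOne z) = ∏ j, Real.exp (-a * |z j|) := by
  rw [normOne, Finset.mul_sum, Real.exp_sum]

theorem integrable_exp_neg_normOne {a : ℝ} (ha : 0 < a) :
    Integrable (fun z : E d => Real.exp (-a * normOne z)) := by
  simp only [exp_neg_mul_normOne]
  have h := Integrable.fintype_prod (ι := Fin d) (μ := fun _ => (volume : Measure ℝ))
    (f := fun _ t => Real.exp (-a * |t|)) fun _ => integrable_exp_neg_mul_abs ha
  exact ((EuclideanSpace.volume_preserving_symm_measurableEquiv_toLp (Fin d)).integrable_comp_emb
    (MeasurableEquiv.measurableEmbedding _)).2 h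

theorem lintegral_exp_neg_normOne {a : ℝ} (ha : 0 < a) :
    ∫⁻ z : E d, ENNReal.ofReal (Real.exp (-a * normOne z)) = ENNReal.ofReal ((2 / a) ^ d) := by
  rw [← ofReal_integral_eq_lintegral_ofReal (integrable_exp_neg_normOne ha)
    (Filter.Eventually.of_forall fun z => (Real.exp_pos _).le)]
  congr 1
  simp only [exp_neg_mul_normOne]
  have h := integral_fintype_prod_volume_eq_pow (ι := Fin d) (fun t : ℝ => Real.exp (-a * |t|))
  rw [integral_exp_neg_mul_abs ha, Fintype.card_fin] at h
  rw [← h]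
  exact (EuclideanSpace.volume_preserving_symm_measurableEquiv_toLp (Fin d)).integral_comp
    (MeasurableEquiv.measurableEmbedding _) (fun r : Fin d → ℝ => ∏ j, Real.exp (-a * |r j|))

end ExpWeight

/-! ### The Green function of `1 - ∂²` -/

section Green

/-- The Green function of `1 - ∂²` on the line. -/
def greenLine (t : ℝ) : ℝ := Real.exp (-|t|) / 2

theorem integrable_greenLine : Integrable greenLine := by
  have := (integrable_exp_neg_mul_abs one_pos).div_const 2
  exact this.congr (Filter.Eventually.of_forall fun t => by simp [greenLine])

theorem continuous_greenLine : Continuous greenLine := by unfold greenLine; fun_prop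

/-- On each half-line the integrand has an explicit primitive, `e^t (h - h') / 2` on the left and
`-e^{-t} (h + h') / 2` on the right. At the origin the `h'` terms cancel; at infinity boundedness
kills the rest. -/
theorem integral_greenLine_mul {h h' h'' : ℝ → ℂ} (hd : ∀ t, HasDerivAt h (h' t) t)
    (hd' : ∀ t, HasDerivAt h' (h'' t) t) (hc : Continuous h'') {M : ℝ} (hM : ∀ t, ‖h t‖ ≤ M)
    (hM' : ∀ t, ‖h' t‖ ≤ M) (hM'' : ∀ t, ‖h'' t‖ ≤ M) :
    ∫ t, (greenLine t : ℂ) * (h t - h'' t) = h 0 := by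
  have hch : Continuous h := continuous_iff_continuousAt.2 fun t => (hd t).continuousAt
  have hint : Integrable (fun t => (greenLine t : ℂ) * (h t - h'' t)) := by
    refine integrable_greenLine.ofReal.mul_bdd (c := M + M) (hch.sub hc).aestronglyMeasurable
      (Filter.Eventually.of_forall fun t => (norm_sub_le _ _).trans (add_le_add (hM t) (hM'' t)))
  rw [← intervalIntegral.integral_Iic_add_Ioi (b := 0) hint.integrableOn hint.integrableOn]
  have hexp : ∀ t : ℝ, HasDerivAt (fun t : ℝ => ((Real.exp t : ℝ) : ℂ)) ((Real.exp t : ℝ) : ℂ) t :=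
    fun t => (Real.hasDerivAt_exp t).ofReal_comp
  have hexpn : ∀ t : ℝ, HasDerivAt (fun t : ℝ => ((Real.exp (-t) : ℝ) : ℂ))
      ((-Real.exp (-t) : ℝ) : ℂ) t := fun t => by
    have := ((Real.hasDerivAt_exp (-t)).comp t (hasDerivAt_neg t)).ofReal_comp
    simpa [Function.comp_def] using this
  have h1 : ∫ t in Set.Iic (0 : ℝ), (greenLine t : ℂ) * (h t - h'' t) = (h 0 - h' 0) / 2 := by
    have hderiv : ∀ t ∈ Set.Iic (0 : ℝ), HasDerivAt
        (fun t : ℝ => ((Real.exp t : ℝ) : ℂ) * (h t - h' t) / 2)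
        ((greenLine t : ℂ) * (h t - h'' t)) t := by
      intro t ht
      have := ((hexp t).mul ((hd t).sub (hd' t))).div_const 2
      refine this.congr_deriv ?_
      rw [greenLine, abs_of_nonpos ht, neg_neg]
      push_cast
      simp only [Pi.sub_apply]
      ring
    have hlim : Filter.Tendsto (fun t : ℝ => ((Real.exp t : ℝ) : ℂ) * (h t - h' t) / 2)
        Filter.atBot (nhds 0) := by
      rw [tendsto_zero_iff_norm_tendsto_zero]
      refine squeeze_zero (fun t => norm_nonneg _) (g := fun t => Real.exp t * (M + M) / 2)
        (fun t => ?_) ?_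
      · rw [norm_div, norm_mul, Complex.norm_real, Real.norm_of_nonneg (Real.exp_pos t).le]
        simp only [Complex.norm_ofNat]
        gcongr
        exact (norm_sub_le _ _).trans (add_le_add (hM t) (hM' t))
      · have := (Real.tendsto_exp_atBot.mul_const (M + M)).div_const 2
        simpa using this
    rw [integral_Iic_of_hasDerivAt_of_tendsto' hderiv hint.integrableOn hlim]
    simp
  have h2 : ∫ t in Set.Ioi (0 : ℝ), (greenLine t : ℂ) * (h t - h'' t) = (h 0 + h' 0) / 2 := by
    have hderiv : ∀ t ∈ Set.Ici (0 : ℝ), HasDerivAt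
        (fun t : ℝ => -(((Real.exp (-t) : ℝ) : ℂ) * (h t + h' t) / 2))
        ((greenLine t : ℂ) * (h t - h'' t)) t := by
      intro t ht
      have := (((hexpn t).mul ((hd t).add (hd' t))).div_const 2).neg
      refine this.congr_deriv ?_
      rw [greenLine, abs_of_nonneg ht]
      push_cast
      simp only [Pi.add_apply]
      ring
    have hlim : Filter.Tendsto (fun t : ℝ => -(((Real.exp (-t) : ℝ) : ℂ) * (h t + h' t) / 2))
        Filter.atTop (nhds 0) := by
      rw [tendsto_zero_iff_norm_tendsto_zero]
      refine squeeze_zero (fun t => norm_nonneg _) (g := fun t => Real.exp (-t) * (M + M) / 2)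
        (fun t => ?_) ?_
      · rw [norm_neg, norm_div, norm_mul, Complex.norm_real, Real.norm_of_nonneg (Real.exp_pos _).le]
        simp only [Complex.norm_ofNat]
        gcongr
        exact (norm_add_le _ _).trans (add_le_add (hM t) (hM' t))
      · have := ((Real.tendsto_exp_neg_atTop_nhds_zero).mul_const (M + M)).div_const 2
        simpa using this
    rw [integral_Ioi_of_hasDerivAt_of_tendsto' hderiv hint.integrableOn hlim]
    simp
  rw [h1, h2]; ring

variable {V : Type*} [NormedAddCommGroup V] [NormedSpace ℝ V]

/-- The operator `1 - ∂_v²`. -/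
def bessel (v : V) (f : V → ℂ) : V → ℂ := fun z => f z - dirDeriv v (dirDeriv v f) z

theorem IsBoundedSymbol.sub {f g : V → ℂ} (hf : IsBoundedSymbol f) (hg : IsBoundedSymbol g) :
    IsBoundedSymbol (fun z => f z - g z) := by
  refine ⟨hf.smooth.sub hg.smooth, fun k => ?_⟩
  obtain ⟨M, hM⟩ := hf.bounded k
  obtain ⟨N, hN⟩ := hg.bounded k
  refine ⟨M + N, fun z => ?_⟩
  have : iteratedFDeriv ℝ k (fun z => f z - g z) z = iteratedFDeriv ℝ k f z - iteratedFDeriv ℝ k g z :=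
    iteratedFDeriv_sub_apply (hf.smooth.contDiffAt.of_le (by exact_mod_cast le_top))
      (hg.smooth.contDiffAt.of_le (by exact_mod_cast le_top))
  rw [this]
  exact (norm_sub_le _ _).trans (add_le_add (hM z) (hN z))

theorem IsBoundedSymbol.bessel {f : V → ℂ} (hf : IsBoundedSymbol f) (v : V) :
    IsBoundedSymbol (bessel v f) := hf.sub ((hf.dirDeriv v).dirDeriv v)

theorem hasDerivAt_line {f : V → ℂ} (hf : Differentiable ℝ f) (z v : V) (t : ℝ) :
    HasDerivAt (fun t : ℝ => f (z + t • v)) (dirDeriv v f (z + t • v)) t := by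
  have hl : HasDerivAt (fun t : ℝ => z + t • v) v t := by
    simpa using ((hasDerivAt_id t).smul_const v).const_add z
  exact (hf (z + t • v)).hasFDerivAt.comp_hasDerivAt t hl

theorem IsBoundedSymbol.integral_bessel {f : V → ℂ} (hf : IsBoundedSymbol f) (v z : V) :
    ∫ t : ℝ, (greenLine t : ℂ) * FourierOp.bessel v f (z + t • v) = f z := by
  obtain ⟨M₀, h₀, hM₀⟩ := hf.exists_norm_le
  obtain ⟨M₁, h₁, hM₁⟩ := (hf.dirDeriv v).exists_norm_le
  obtain ⟨M₂, h₂, hM₂⟩ := ((hf.dirDeriv v).dirDeriv v).exists_norm_le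
  have hc : Continuous fun t : ℝ => FourierOp.dirDeriv v (FourierOp.dirDeriv v f) (z + t • v) :=
    ((hf.dirDeriv v).dirDeriv v).smooth.continuous.comp (by fun_prop)
  have := integral_greenLine_mul (M := M₀ + M₁ + M₂)
    (fun t => hasDerivAt_line (hf.smooth.differentiable (by simp)) z v t)
    (fun t => hasDerivAt_line ((hf.dirDeriv v).smooth.differentiable (by simp)) z v t) hc
    (fun t => (hM₀ _).trans (by linarith)) (fun t => (hM₁ _).trans (by linarith))
    (fun t => (hM₂ _).trans (by linarith))
  simpa [FourierOp.bessel] using this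

/-- The product of the operators `1 - ∂_v²` over a family of directions. -/
def besselProd {n : ℕ} (e : Fin n → V) (f : V → ℂ) : V → ℂ :=
  (List.finRange n).foldr (fun j h => bessel (e j) h) f

theorem besselProd_succ {n : ℕ} (e : Fin (n + 1) → V) (f : V → ℂ) :
    besselProd e f = bessel (e 0) (besselProd (fun j => e j.succ) f) := by
  simp [besselProd, List.finRange_succ, List.foldr_map]

theorem IsBoundedSymbol.besselProd {n : ℕ} (e : Fin n → V) {f : V → ℂ} (hf : IsBoundedSymbol f) :
    IsBoundedSymbol (besselProd e f) := by
  induction n with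
  | zero => simpa [FourierOp.besselProd] using hf
  | succ n ih => rw [besselProd_succ]; exact (ih _).bessel _

/-- Induction on the number of directions: integrating the first parameter undoes the outermost
factor `1 - ∂²`. -/
theorem IsBoundedSymbol.integral_besselProd {n : ℕ} (e : Fin n → V) {f : V → ℂ}
    (hf : IsBoundedSymbol f) (z : V) :
    ∫ r : Fin n → ℝ, ((∏ j, greenLine (r j) : ℝ) : ℂ) *
      FourierOp.besselProd e f (z + ∑ j, r j • e j) = f z := by
  induction n with
  | zero =>
    rw [Measure.volume_pi_eq_dirac default, integral_dirac]
    simp [FourierOp.besselProd]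
  | succ n ih =>
    set P := FourierOp.besselProd (fun j : Fin n => e j.succ) f with hP
    have hPs : IsBoundedSymbol P := hf.besselProd _
    have hB : IsBoundedSymbol (FourierOp.bessel (e 0) P) := hPs.bessel _
    have hmp := (volume_preserving_piFinSuccAbove (fun _ : Fin (n + 1) => ℝ) 0).symm
    rw [← hmp.integral_comp (MeasurableEquiv.measurableEmbedding _)]
    have e1 : ∀ w : ℝ × (Fin n → ℝ), (MeasurableEquiv.piFinSuccAbove (fun _ : Fin (n + 1) => ℝ) 0).symm w
        = Fin.cons w.1 w.2 := fun w => Fin.insertNth_zero' w.1 w.2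
    simp only [e1, Fin.prod_univ_succ, Fin.sum_univ_succ, Fin.cons_zero, Fin.cons_succ,
      besselProd_succ, ← hP]
    obtain ⟨M, hM, hb⟩ := hB.exists_norm_le
    have hg : Integrable (fun r : Fin n → ℝ => ((∏ j, greenLine (r j) : ℝ) : ℂ)) :=
      (Integrable.fintype_prod (ι := Fin n) (μ := fun _ => (volume : Measure ℝ))
        (f := fun _ => greenLine) fun _ => integrable_greenLine).ofReal
    have hint : Integrable (fun w : ℝ × (Fin n → ℝ) =>
        ((greenLine w.1 * ∏ j, greenLine (w.2 j) : ℝ) : ℂ) *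
          FourierOp.bessel (e 0) P (z + (w.1 • e 0 + ∑ j, w.2 j • e j.succ))) := by
      have h1 := (integrable_greenLine.ofReal (𝕜 := ℂ)).mul_prod hg
      have hcont : Continuous (fun w : ℝ × (Fin n → ℝ) =>
          FourierOp.bessel (e 0) P (z + (w.1 • e 0 + ∑ j, w.2 j • e j.succ))) :=
        hB.smooth.continuous.comp (by fun_prop)
      refine (h1.mul_bdd (c := M) hcont.aestronglyMeasurable
        (Filter.Eventually.of_forall fun w => hb _)).congr (Filter.Eventually.of_forall fun w => ?_)
      simp
    refine (integral_prod_symm _ hint).trans ?_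
    rw [← ih (fun j => e j.succ)]
    congr 1; ext r
    have h2 := hPs.integral_bessel (e 0) (z + ∑ j, r j • e j.succ)
    rw [← hP, ← h2, ← integral_const_mul]
    congr 1; ext t
    rw [show z + (t • e 0 + ∑ j, r j • e j.succ) = z + ∑ j, r j • e j.succ + t • e 0 by abel]
    push_cast
    ring

end Green

/-! ### Green representation of symbols on `ℝ^{4d}` -/

section Representation

variable {d : ℕ}

/-- The Green function of `∏ (1 - ∂_j²)` on `ℝ^d`. -/
def green (r : E d) : ℝ := ∏ j, greenLine (r j)

theorem green_eq (r : E d) : green r = (1 / 2) ^ d * Real.exp (-1 * normOne r) := by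
  rw [exp_neg_mul_normOne]
  simp only [green, greenLine, div_eq_mul_inv, Finset.prod_mul_distrib]
  simp [mul_comm]

theorem green_nonneg (r : E d) : 0 ≤ green r := by rw [green_eq]; positivity

theorem continuous_green : Continuous (green (d := d)) := by
  have := continuous_greenLine
  unfold green; fun_prop

theorem integrable_green : Integrable (green (d := d)) := by
  have e : (green (d := d)) = fun r => (1 / 2) ^ d * Real.exp (-1 * normOne r) := funext green_eq
  rw [e]
  exact (integrable_exp_neg_normOne one_pos).const_mul _

theorem IsBoundedSymbol.integral_green {V : Type*} [NormedAddCommGroup V] [NormedSpace ℝ V]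
    (e : Fin d → V) {f : V → ℂ} (hf : IsBoundedSymbol f) (z : V) :
    ∫ r : E d, (green r : ℂ) * FourierOp.besselProd e f (z + ∑ j, r j • e j) = f z := by
  rw [← hf.integral_besselProd e z]
  exact (EuclideanSpace.volume_preserving_symm_measurableEquiv_toLp (Fin d)).integral_comp
    (MeasurableEquiv.measurableEmbedding _) (fun r : Fin d → ℝ =>
      ((∏ j, greenLine (r j) : ℝ) : ℂ) * FourierOp.besselProd e f (z + ∑ j, r j • e j))

/-- The operator `∏ (1 - ∂_j²)` over all coordinates of `(x, y)`. -/
def xyBessel (u : Var d → ℂ) : Var d → ℂ :=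
  besselProd (fun j => xyDir (Sum.inl j)) (besselProd (fun j => xyDir (Sum.inr j)) u)

theorem IsBoundedSymbol.xyBessel {u : Var d → ℂ} (hu : IsBoundedSymbol u) :
    IsBoundedSymbol (xyBessel u) := (hu.besselProd _).besselProd _

theorem sum_smul_single (r : E d) : ∑ j, r j • (EuclideanSpace.single j 1 : E d) = r := by
  ext i; simp [Finset.sum_apply, Pi.single_apply]

theorem sum_smul_xyDir_inl (r : E d) : ∑ j, r j • (xyDir (Sum.inl j) : Var d) = (r, 0, 0, 0) := by
  have : ∀ j, r j • (xyDir (Sum.inl j) : Var d) =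
      ContinuousLinearMap.inl ℝ (E d) (E d × E d × E d) (r j • EuclideanSpace.single j 1) := by
    intro j; simp [xyDir, Prod.zero_eq_mk]
  simp only [this]
  rw [← map_sum, sum_smul_single]; rfl

theorem sum_smul_xyDir_inr (r : E d) : ∑ j, r j • (xyDir (Sum.inr j) : Var d) = (0, r, 0, 0) := by
  have : ∀ j, r j • (xyDir (Sum.inr j) : Var d) =
      ((ContinuousLinearMap.inr ℝ (E d) (E d × E d × E d)).comp
        (ContinuousLinearMap.inl ℝ (E d) (E d × E d))) (r j • EuclideanSpace.single j 1) := by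
    intro j; simp [xyDir, Prod.zero_eq_mk]
  simp only [this]
  rw [← map_sum, sum_smul_single]; rfl

/-- Green representation of a symbol. -/
theorem IsBoundedSymbol.integral_xyBessel {u : Var d → ℂ} (hu : IsBoundedSymbol u)
    (x y q p : E d) :
    ∫ ρ : E d × E d, ((green (ρ.1 - x) * green (ρ.2 - y) : ℝ) : ℂ) *
      FourierOp.xyBessel u (ρ.1, ρ.2, q, p) = u (x, y, q, p) := by
  obtain ⟨M, hM, hb⟩ := hu.xyBessel.exists_norm_le
  have hgx : Integrable (fun r => (green (r - x) : ℂ)) := (integrable_green.comp_sub_right x).ofReal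
  have hgy : Integrable (fun r => (green (r - y) : ℂ)) := (integrable_green.comp_sub_right y).ofReal
  have hint : Integrable (fun ρ : E d × E d => ((green (ρ.1 - x) * green (ρ.2 - y) : ℝ) : ℂ) *
      FourierOp.xyBessel u (ρ.1, ρ.2, q, p)) := by
    have hcont : Continuous (fun ρ : E d × E d => FourierOp.xyBessel u (ρ.1, ρ.2, q, p)) :=
      hu.xyBessel.smooth.continuous.comp (by fun_prop)
    refine ((hgx.mul_prod hgy).mul_bdd (c := M) hcont.aestronglyMeasurable
      (Filter.Eventually.of_forall fun w => hb _)).congr (Filter.Eventually.of_forall fun w => ?_)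
    simp
  refine (integral_prod_symm _ hint).trans ?_
  have h1 := hu.integral_green (fun j => xyDir (Sum.inr j)) (x, y, q, p)
  -- Recentring the integration variable removes `y` from the argument of the amplitude and leaves
  -- it only in the Green function; the same is done below for `x`. This decouples the two
  -- variables.
  rw [← integral_sub_right_eq_self _ y] at h1
  rw [← h1]
  congr 1; ext r'
  have h2 := (hu.besselProd (fun j => xyDir (Sum.inr j))).integral_green
    (fun j => xyDir (Sum.inl j)) ((x, y, q, p) + ∑ j, (r' - y) j • xyDir (Sum.inr j))
  rw [← integral_sub_right_eq_self _ x] at h2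
  rw [← h2, ← integral_const_mul]
  congr 1; ext r
  rw [sum_smul_xyDir_inl, sum_smul_xyDir_inr]
  simp only [Prod.mk_add_mk, add_zero, add_sub_cancel, FourierOp.xyBessel]
  push_cast; ring

end Representation

end FourierOp
end

noncomputable section

namespace FourierOp

/-! ### The sup norm of the Bessel potential of a symbol -/

section BesselNorm

variable {V ι : Type*} [NormedAddCommGroup V] [NormedSpace ℝ V]

theorem IsBoundedSymbol.iterate_dirDeriv {f : V → ℂ} (hf : IsBoundedSymbol f) (v : V) (n : ℕ) :
    IsBoundedSymbol ((FourierOp.dirDeriv v)^[n] f) := by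
  induction n with
  | zero => exact hf
  | succ n ih => rw [Function.iterate_succ_apply']; exact ih.dirDeriv v

/-- The iterated directional derivative `∏ ∂_{e j}^{α j} f`, in the order of the list `l`. -/
def listDeriv (e : ι → V) (α : ι → ℕ) (f : V → ℂ) (l : List ι) : V → ℂ :=
  l.foldr (fun j g => (dirDeriv (e j))^[α j] g) f

theorem IsBoundedSymbol.listDeriv {f : V → ℂ} (hf : IsBoundedSymbol f) (e : ι → V) (α : ι → ℕ)
    (l : List ι) : IsBoundedSymbol (listDeriv e α f l) := by
  induction l with
  | nil => exact hf
  | cons j t ih => exact ih.iterate_dirDeriv (e j) (α j)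

theorem listDeriv_congr (e : ι → V) {α β : ι → ℕ} (f : V → ℂ) {l : List ι}
    (h : ∀ j ∈ l, α j = β j) : listDeriv e α f l = listDeriv e β f l := by
  induction l with
  | nil => rfl
  | cons j t ih =>
    have h1 := ih fun i hi => h i (List.mem_cons_of_mem j hi)
    simp only [listDeriv, List.foldr_cons] at h1 ⊢
    rw [h1, h j List.mem_cons_self]

theorem dirDeriv_sum {s : Finset ι} {f : ι → V → ℂ} (hf : ∀ i, Differentiable ℝ (f i))
    (c : ι → ℂ) (v : V) :
    dirDeriv v (fun z => ∑ i ∈ s, c i * f i z) = fun z => ∑ i ∈ s, c i * dirDeriv v (f i) z := by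
  ext z
  simp only [dirDeriv]
  rw [fderiv_fun_sum fun i _ => ((hf i) z).const_mul (c i)]
  simp only [sum_apply]
  refine Finset.sum_congr rfl fun i _ => ?_
  rw [fderiv_const_mul ((hf i) z)]
  simp

/-- Expansion of a product of the operators `1 - ∂_j²`. -/
theorem foldr_bessel_eq [DecidableEq ι] (e : ι → V) {f : V → ℂ} (hf : IsBoundedSymbol f)
    {l : List ι} (hl : l.Nodup) :
    l.foldr (fun j h => bessel (e j) h) f = fun z => ∑ A ∈ l.toFinset.powerset,
      (-1) ^ A.card * listDeriv e (fun j => if j ∈ A then 2 else 0) f l z := by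
  induction l with
  | nil => ext z; simp [listDeriv]
  | cons j t ih =>
    have hj : j ∉ t.toFinset := by simpa using (List.nodup_cons.1 hl).1
    have hs : ∀ A : Finset ι, IsBoundedSymbol (listDeriv e (fun j => if j ∈ A then 2 else 0) f t) :=
      fun A => hf.listDeriv _ _ _
    ext z
    rw [List.foldr_cons, ih (List.nodup_cons.1 hl).2, List.toFinset_cons,
      -- Subsets without `j` come from the identity in `1 - ∂_j²`, subsets containing `j` from
      -- `-∂_j²`.
      Finset.sum_powerset_insert hj, bessel,
      dirDeriv_sum fun A => (hs A).smooth.differentiable (by simp),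
      dirDeriv_sum fun A => ((hs A).dirDeriv _).smooth.differentiable (by simp), sub_eq_add_neg,
      ← Finset.sum_neg_distrib]
    congr 1
    · refine Finset.sum_congr rfl fun A hA => ?_
      have hjA : j ∉ A := fun h => hj (Finset.mem_powerset.1 hA h)
      simp [listDeriv, hjA]
    · refine Finset.sum_congr rfl fun A hA => ?_
      have hjA : j ∉ A := fun h => hj (Finset.mem_powerset.1 hA h)
      have h1 : listDeriv e (fun i => if i ∈ insert j A then 2 else 0) f t =
          listDeriv e (fun i => if i ∈ A then 2 else 0) f t := by
        refine listDeriv_congr e f fun i hi => ?_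
        have : i ≠ j := by rintro rfl; exact hj (by simpa using hi)
        simp [this]
      have h2 : listDeriv e (fun i => if i ∈ insert j A then 2 else 0) f (j :: t) =
          dirDeriv (e j) (dirDeriv (e j)
            (listDeriv e (fun i => if i ∈ insert j A then 2 else 0) f t)) := by
        simp [listDeriv]
      rw [h2, h1, Finset.card_insert_of_notMem hjA]
      ring

variable {d : ℕ}

theorem xyBessel_eq (u : Var d → ℂ) : xyBessel u =
    ((List.finRange d).map Sum.inl ++ (List.finRange d).map Sum.inr).foldr
      (fun j h => bessel (xyDir j) h) u := by
  rw [List.foldr_append, List.foldr_map, List.foldr_map]; rfl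

theorem IsBoundedSymbol.norm_xyDeriv_le {u : Var d → ℂ} (hu : IsBoundedSymbol u)
    {α : Fin d ⊕ Fin d → ℕ} {N : ℕ} (hα : ∑ j, α j ≤ N) (z : Var d) :
    ‖xyDeriv α u z‖ ≤ xyNorm N u := by
  obtain ⟨M, hM, hb⟩ := (hu.listDeriv xyDir α
    ((List.finRange d).map Sum.inl ++ (List.finRange d).map Sum.inr)).exists_norm_le
  have h0 : ∀ β : Fin d ⊕ Fin d → ℕ, 0 ≤ ⨆ z : Var d, ‖xyDeriv β u z‖ :=
    fun β => Real.iSup_nonneg fun z => norm_nonneg _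
  calc ‖xyDeriv α u z‖ ≤ ⨆ z : Var d, ‖xyDeriv α u z‖ :=
        le_ciSup (f := fun z => ‖xyDeriv α u z‖) ⟨M, by rintro _ ⟨z, rfl⟩; exact hb z⟩ z
    _ ≤ ∑ β ∈ Finset.piAntidiag (Finset.univ : Finset (Fin d ⊕ Fin d)) (∑ j, α j),
          ⨆ z : Var d, ‖xyDeriv β u z‖ :=
        Finset.single_le_sum (f := fun β => ⨆ z : Var d, ‖xyDeriv β u z‖) (fun β _ => h0 β)
          (by simp)
    _ ≤ xyNorm N u :=
        Finset.single_le_sum (f := fun n => ∑ β ∈ Finset.piAntidiag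
            (Finset.univ : Finset (Fin d ⊕ Fin d)) n, ⨆ z : Var d, ‖xyDeriv β u z‖)
          (fun n _ => Finset.sum_nonneg fun β _ => h0 β) (Finset.mem_range.2 (by omega))

theorem xyNorm_nonneg (N : ℕ) (u : Var d → ℂ) : 0 ≤ xyNorm N u :=
  Finset.sum_nonneg fun _ _ => Finset.sum_nonneg fun _ _ => Real.iSup_nonneg fun _ => norm_nonneg _

/-- Expanding the `2d` factors gives `2^{2d} = 4^d` derivatives, each of order at most `4d`, so the
norm of order `4d + 1` suffices. -/
theorem IsBoundedSymbol.norm_xyBessel_le {u : Var d → ℂ} (hu : IsBoundedSymbol u) (z : Var d) :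
    ‖FourierOp.xyBessel u z‖ ≤ 4 ^ d * xyNorm (4 * d + 1) u := by
  have hl : ((List.finRange d).map (Sum.inl : Fin d → Fin d ⊕ Fin d) ++
      (List.finRange d).map Sum.inr).Nodup := by
    refine List.Nodup.append ((List.nodup_finRange d).map Sum.inl_injective)
      ((List.nodup_finRange d).map Sum.inr_injective) ?_
    intro a ha hb
    simp only [List.mem_map] at ha hb
    obtain ⟨i, -, rfl⟩ := ha
    obtain ⟨j, -, h⟩ := hb
    exact absurd h (by simp)
  rw [xyBessel_eq, foldr_bessel_eq xyDir hu hl]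
  refine (norm_sum_le _ _).trans ?_
  refine (Finset.sum_le_card_nsmul _ _ (xyNorm (4 * d + 1) u) fun A _ => ?_).trans (le_of_eq ?_)
  · rw [norm_mul, norm_pow, norm_neg, norm_one, one_pow, one_mul]
    refine hu.norm_xyDeriv_le (α := fun j => if j ∈ A then 2 else 0) ?_ z
    rw [Finset.sum_ite_mem, Finset.univ_inter, Finset.sum_const, smul_eq_mul]
    have : A.card ≤ Fintype.card (Fin d ⊕ Fin d) := Finset.card_le_univ A
    simp only [Fintype.card_sum, Fintype.card_fin] at this
    omega
  · rw [Finset.card_powerset, List.toFinset_card_of_nodup hl, nsmul_eq_mul]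
    congr 1
    simp only [List.length_append, List.length_map, List.length_finRange]
    push_cast
    rw [← two_mul, pow_mul]; norm_num

end BesselNorm

end FourierOp
end

noncomputable section

namespace FourierOp

/-! ### Wave packet transforms of localised functions -/

section Localised

variable {d : ℕ} {ε τ μ : ℝ} {Θ : Matrix (Fin d) (Fin d) ℂ}

/-- The wave packet transform of `h`, localised at `r` by the Green function. -/
def localTransform (τ ε : ℝ) (Θ : Matrix (Fin d) (Fin d) ℂ) (h : E d → ℂ) (r : E d)
    (w : Phase d) : ℂ :=
  packetTransform τ ε Θ (fun y => h y * (green (r - y) : ℂ)) w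

/-- The `L¹` norm of the localised wave packet transforms. -/
def totalTransform (τ ε : ℝ) (Θ : Matrix (Fin d) (Fin d) ℂ) (h : E d → ℂ) (w : Phase d) :
    ENNReal :=
  ∫⁻ r, ‖localTransform τ ε Θ h r w‖ₑ

theorem stronglyMeasurable_localTransform {h : E d → ℂ} (hh : StronglyMeasurable h) :
    StronglyMeasurable (fun z : E d × Phase d => localTransform τ ε Θ h z.1 z.2) := by
  have hg := continuous_green (d := d)
  have : StronglyMeasurable (fun z : (E d × Phase d) × E d =>
      (h z.2 * (green (z.1.1 - z.2) : ℂ)) * packet τ ε Θ z.1.2 z.2) := by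
    refine ((hh.comp_measurable measurable_snd).mul ?_).mul ?_
    · exact Continuous.stronglyMeasurable (by fun_prop)
    · exact (continuous_packet.comp (f := fun z : (E d × Phase d) × E d => (z.1.2, z.2))
        (by fun_prop)).stronglyMeasurable
  exact this.integral_prod_right'

theorem measurable_totalTransform {h : E d → ℂ} (hh : StronglyMeasurable h) :
    Measurable (totalTransform τ ε Θ h) :=
  (stronglyMeasurable_localTransform hh).enorm.lintegral_prod_left'

theorem green_le (r : E d) : green r ≤ (1 / 2) ^ d := by
  rw [green_eq]
  refine mul_le_of_le_one_right (by positivity) (Real.exp_le_one_iff.2 ?_)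
  have : 0 ≤ normOne r := Finset.sum_nonneg fun j _ => abs_nonneg _
  linarith

theorem integrable_mul_green {h : E d → ℂ} (hh : Integrable h) (r : E d) :
    Integrable (fun y => h y * (green (r - y) : ℂ)) := by
  have hg := continuous_green (d := d)
  refine hh.mul_bdd (c := (1 / 2) ^ d) (by fun_prop) (Filter.Eventually.of_forall fun y => ?_)
  rw [Complex.norm_real, Real.norm_of_nonneg (green_nonneg _)]
  exact green_le _

/-- This is `(√μ |z_j| - 1)² ≥ 0` summed over coordinates. The rate `√μ` is chosen so that the
constant `d/2` does not depend on `μ`. -/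
theorem sqrt_mul_normOne_le (hμ : 0 ≤ μ) (z : E d) :
    √μ * normOne z ≤ d / 2 + μ * ‖z‖ ^ 2 / 2 := by
  have h1 : ∀ j, √μ * |z j| ≤ 1 / 2 + μ * z j ^ 2 / 2 := by
    intro j
    have := sq_nonneg (√μ * |z j| - 1)
    have h2 := Real.sq_sqrt hμ
    have h3 := sq_abs (z j)
    nlinarith
  calc √μ * normOne z = ∑ j, √μ * |z j| := by rw [normOne, Finset.mul_sum]
    _ ≤ ∑ j, (1 / 2 + μ * z j ^ 2 / 2) := Finset.sum_le_sum fun j _ => h1 j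
    _ = _ := by
      rw [Finset.sum_add_distrib, ← Finset.sum_div, ← Finset.sum_div, ← Finset.mul_sum,
        EuclideanSpace.norm_sq_eq]
      simp

/-- The squared Green function decays at rate 2; since `μ ≤ 1`, the weight uses up at most half of
that. -/
theorem green_sq_mul_exp_le (hμ : μ ≤ 1) (z : E d) :
    green z ^ 2 * Real.exp (√μ * normOne z) ≤ (1 / 4) ^ d * Real.exp (-1 * normOne z) := by
  have h0 : 0 ≤ normOne z := Finset.sum_nonneg fun j _ => abs_nonneg _
  have h1 : √μ ≤ 1 := Real.sqrt_le_one.2 hμ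
  rw [green_eq, mul_pow, ← pow_mul, mul_comm d 2, pow_mul, ← Real.exp_nat_mul, mul_assoc,
    ← Real.exp_add]
  norm_num
  nlinarith

/-- Half of the Gaussian exponent absorbs the weight, and the other half remains to be integrated.
The assumption `ε ≤ 1` makes the sacrificed half at least `μ ‖z‖² / 2`. -/
theorem exp_quad_mul_exp_le (hμ : 0 ≤ μ) (hΘ : ∀ v, μ * ‖v‖ ^ 2 ≤ (quad Θ v).re) (hε : 0 < ε)
    (hε1 : ε ≤ 1) (z : E d) :
    Real.exp (-(1 / ε) * (quad Θ z).re) * Real.exp (√μ * normOne z) ≤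
      Real.exp (d / 2) * Real.exp (-(1 / (2 * ε)) * (quad Θ z).re) := by
  rw [← Real.exp_add, ← Real.exp_add, Real.exp_le_exp]
  have h1 := sqrt_mul_normOne_le hμ z
  have h2 := hΘ z
  have h3 : (quad Θ z).re ≤ 1 / ε * (quad Θ z).re :=
    le_mul_of_one_le_left (le_trans (by positivity) h2) ((one_le_div hε).2 hε1)
  have h4 : 1 / (2 * ε) * (quad Θ z).re = 1 / ε * (quad Θ z).re / 2 := by field_simp
  rw [neg_mul, neg_mul, h4]
  linarith

theorem lintegral_triple_convolution {F g₁ g₂ : E d → ENNReal} (hF : Measurable F)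
    (h₁ : Measurable g₁) (h₂ : Measurable g₂) :
    ∫⁻ q, ∫⁻ r, ∫⁻ y, F y * g₁ (r - y) * g₂ (y - q) = (∫⁻ z, g₁ z) * (∫⁻ z, g₂ z) * ∫⁻ y, F y := by
  have e1 : ∀ q, ∫⁻ r, ∫⁻ y, F y * g₁ (r - y) * g₂ (y - q) =
      ∫⁻ y, F y * g₂ (y - q) * ∫⁻ z, g₁ z := by
    intro q
    rw [lintegral_lintegral_swap (Measurable.aemeasurable (by fun_prop))]
    congr 1; ext y
    rw [lintegral_mul_const _ (by fun_prop), lintegral_const_mul _ (by fun_prop),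
      lintegral_sub_right_eq_self g₁]
    ring
  simp only [e1]
  rw [lintegral_lintegral_swap (Measurable.aemeasurable (by fun_prop))]
  have e2 : ∀ y, ∫⁻ q, F y * g₂ (y - q) * ∫⁻ z, g₁ z = (∫⁻ z, g₁ z) * (∫⁻ z, g₂ z) * F y := by
    intro y
    rw [lintegral_mul_const _ (by fun_prop), lintegral_const_mul _ (by fun_prop),
      lintegral_sub_left_eq_self g₂]
    ring
  simp only [e2]
  rw [lintegral_const_mul _ hF]

/-- Pointwise Cauchy-Schwarz with an exponential weight. -/
theorem totalTransform_sq_le {h : E d → ℂ} (hh : StronglyMeasurable h) (hμ : 0 < μ) (w : Phase d) :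
    totalTransform τ ε Θ h w ^ 2 ≤ ENNReal.ofReal ((2 / √μ) ^ d) *
      ∫⁻ r, ENNReal.ofReal (Real.exp (√μ * normOne (r - w.1))) *
        ‖localTransform τ ε Θ h r w‖ₑ ^ 2 := by
  have hn := continuous_normOne (d := d)
  have hA : Measurable (fun r => ‖localTransform τ ε Θ h r w‖ₑ) :=
    (stronglyMeasurable_localTransform hh).enorm.comp (f := fun r : E d => (r, w)) (by fun_prop)
  set m : ℝ → E d → ENNReal := fun σ r => ENNReal.ofReal (Real.exp (σ * normOne (r - w.1))) with hm
  have hmm : ∀ σ, Measurable (m σ) := fun σ => by fun_prop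
  have hsq : ∀ σ r, m σ r ^ 2 = m (2 * σ) r := by
    intro σ r
    simp only [hm]
    rw [← ENNReal.ofReal_pow (Real.exp_pos _).le, ← Real.exp_nat_mul]
    congr 2; push_cast; ring
  have h1 := lintegral_mul_sq_le (μ := volume) (hmm (-(√μ / 2))).aemeasurable
    ((hmm (√μ / 2)).mul hA).aemeasurable
  -- The weight and its inverse, each at half rate, are inserted. Squared and integrated, the
  -- decaying one gives `(2/√μ)^d`, the sole source of negative powers of `μ`.
  have e1 : ∀ r, m (-(√μ / 2)) r * (m (√μ / 2) r * ‖localTransform τ ε Θ h r w‖ₑ) =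
      ‖localTransform τ ε Θ h r w‖ₑ := by
    intro r
    rw [← mul_assoc]
    simp only [hm]
    rw [← ENNReal.ofReal_mul (Real.exp_pos _).le, ← Real.exp_add]
    simp
  simp only [Pi.mul_apply, e1, mul_pow, hsq] at h1
  refine h1.trans (le_of_eq ?_)
  congr 1
  · rw [← lintegral_exp_neg_normOne (Real.sqrt_pos.2 hμ),
      ← lintegral_sub_right_eq_self (fun z : E d => ENNReal.ofReal (Real.exp (-√μ * normOne z))) w.1]
    congr 1; ext r
    simp only [hm]; congr 3; ring
  · congr 1; ext r
    simp only [hm]; congr 4; ring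

/-- After weighted Cauchy-Schwarz in `r`, Plancherel in `p` applies for each `r`. The triangle
inequality splits the weight at `y`, so a double convolution with the integrable functions `g₁` and
`g₂` remains. -/
theorem lintegral_totalTransform_sq_le (hε : 0 < ε) (hε1 : ε ≤ 1) (hτ : |τ| = 1 / ε)
    (hΘ : IsAdmissible Θ) (hμ : 0 < μ) (hμ1 : μ ≤ 1) (hμΘ : ∀ v, μ * ‖v‖ ^ 2 ≤ (quad Θ v).re)
    {h : E d → ℂ} (hm : StronglyMeasurable h) (hh : Integrable h) :
    ∫⁻ w, totalTransform τ ε Θ h w ^ 2 ≤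
      ENNReal.ofReal (Real.exp (d / 2) * μ ^ (-(d : ℝ) / 2) *
        (2 * Real.pi * ε) ^ (3 * (d : ℝ) / 2) * ((reMat Θ).det ^ (1 / 2 : ℝ))⁻¹) *
        eLpNorm h 2 volume ^ 2 := by
  have hn := continuous_normOne (d := d)
  have hq := continuous_quad Θ
  have hg := continuous_green (d := d)
  have hme := hm.enorm
  have hlm := (stronglyMeasurable_localTransform (τ := τ) (ε := ε) (Θ := Θ) hm).enorm
  set c := ENNReal.ofReal ((2 / √μ) ^ d) with hc
  set P := ENNReal.ofReal ((2 * Real.pi * ε) ^ d) with hP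
  set m : E d → ENNReal := fun z => ENNReal.ofReal (Real.exp (√μ * normOne z)) with hmdef
  set γ : E d → ENNReal := fun z => ENNReal.ofReal (Real.exp (-(1 / ε) * (quad Θ z).re)) with hγ
  set G : E d → ENNReal := fun z => ENNReal.ofReal (green z ^ 2) with hG
  set g₁ : E d → ENNReal := fun z => ENNReal.ofReal ((1 / 4) ^ d * Real.exp (-1 * normOne z)) with hg₁
  set g₂ : E d → ENNReal := fun z => ENNReal.ofReal (Real.exp (d / 2) *
    Real.exp (-(1 / (2 * ε)) * (quad Θ z).re)) with hg₂
  have hm_m : Measurable m := by fun_prop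
  have hg₁m : Measurable g₁ := by fun_prop
  have hg₂m : Measurable g₂ := by fun_prop
  have hGm : ∀ z, G z * m z ≤ g₁ z := by
    intro z
    simp only [hG, hmdef, hg₁]
    rw [← ENNReal.ofReal_mul (by positivity)]
    exact ENNReal.ofReal_le_ofReal (green_sq_mul_exp_le hμ1 z)
  have hγm : ∀ z, γ z * m z ≤ g₂ z := by
    intro z
    simp only [hγ, hmdef, hg₂]
    rw [← ENNReal.ofReal_mul (by positivity)]
    exact ENNReal.ofReal_le_ofReal (exp_quad_mul_exp_le hμ.le hμΘ hε hε1 z)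
  have hmadd : ∀ r y q : E d, m (r - q) ≤ m (r - y) * m (y - q) := by
    intro r y q
    simp only [hmdef]
    rw [← ENNReal.ofReal_mul (by positivity), ← Real.exp_add, ← mul_add]
    refine ENNReal.ofReal_le_ofReal (Real.exp_le_exp.2 ?_)
    refine mul_le_mul_of_nonneg_left ?_ (Real.sqrt_nonneg _)
    simpa using normOne_add_le (r - y) (y - q)
  have hI₁ : ∫⁻ z, g₁ z = ENNReal.ofReal ((1 / 2) ^ d) := by
    simp only [hg₁, ENNReal.ofReal_mul (show (0:ℝ) ≤ (1 / 4) ^ d by positivity)]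
    rw [lintegral_const_mul' _ _ ENNReal.ofReal_ne_top, lintegral_exp_neg_normOne one_pos,
      ← ENNReal.ofReal_mul (by positivity), ← mul_pow]
    norm_num
  have hI₂ : ∫⁻ z, g₂ z = ENNReal.ofReal (Real.exp (d / 2) * ((2 * Real.pi * ε) ^ ((d : ℝ) / 2) *
      ((reMat Θ).det ^ (1 / 2 : ℝ))⁻¹)) := by
    simp only [hg₂, ENNReal.ofReal_mul (Real.exp_pos ((d : ℝ) / 2)).le]
    rw [lintegral_const_mul' _ _ ENNReal.ofReal_ne_top,
      lintegral_exp_neg_quad hΘ.posDef (by positivity)]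
    congr 3
    rw [div_div_eq_mul_div, div_one]; ring_nf
  calc ∫⁻ w, totalTransform τ ε Θ h w ^ 2
      ≤ ∫⁻ q, ∫⁻ p, totalTransform τ ε Θ h (q, p) ^ 2 := lintegral_prod_le _
    _ ≤ ∫⁻ q, ∫⁻ p, c * ∫⁻ r, m (r - q) * ‖localTransform τ ε Θ h r (q, p)‖ₑ ^ 2 :=
        lintegral_mono fun q => lintegral_mono fun p => totalTransform_sq_le hm hμ (q, p)
    _ = ∫⁻ q, c * ∫⁻ r, m (r - q) * ∫⁻ p, ‖localTransform τ ε Θ h r (q, p)‖ₑ ^ 2 := by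
        congr 1; ext q
        have hl2 : Measurable (fun z : E d × E d => ‖localTransform τ ε Θ h z.2 (q, z.1)‖ₑ) :=
          hlm.comp (f := fun z : E d × E d => (z.2, (q, z.1))) (by fun_prop)
        have hl1 : ∀ r, Measurable (fun p : E d => ‖localTransform τ ε Θ h r (q, p)‖ₑ) :=
          fun r => hlm.comp (f := fun p : E d => (r, (q, p))) (by fun_prop)
        rw [lintegral_const_mul' _ _ ENNReal.ofReal_ne_top, lintegral_lintegral_swap]
        · congr 2; ext r
          rw [lintegral_const_mul _ ((hl1 r).pow_const 2)]
        · exact ((hm_m.comp (measurable_snd.sub_const q)).mul (hl2.pow_const 2)).aemeasurable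
    _ ≤ ∫⁻ q, c * ∫⁻ r, P * ∫⁻ y, ‖h y‖ₑ ^ 2 * g₁ (r - y) * g₂ (y - q) := by
        refine lintegral_mono fun q => mul_le_mul' le_rfl (lintegral_mono fun r => ?_)
        refine (mul_le_mul' le_rfl (lintegral_packetTransform_sq_le hε hτ hΘ
          (integrable_mul_green hh r) q)).trans ?_
        rw [← mul_assoc, mul_comm (m (r - q)) P, mul_assoc]
        refine mul_le_mul' le_rfl ?_
        rw [← lintegral_const_mul' _ _ ENNReal.ofReal_ne_top]
        refine lintegral_mono fun y => ?_
        have e : ‖h y * (green (r - y) : ℂ)‖ₑ ^ 2 = ‖h y‖ₑ ^ 2 * G (r - y) := by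
          rw [enorm_mul, mul_pow, ← ofReal_norm (green (r - y) : ℂ), Complex.norm_real,
            Real.norm_of_nonneg (green_nonneg _), ← ENNReal.ofReal_pow (green_nonneg _)]
        simp only [e]
        calc m (r - q) * (‖h y‖ₑ ^ 2 * G (r - y) * γ (y - q))
            ≤ m (r - y) * m (y - q) * (‖h y‖ₑ ^ 2 * G (r - y) * γ (y - q)) :=
              mul_le_mul' (hmadd r y q) le_rfl
          _ = ‖h y‖ₑ ^ 2 * (G (r - y) * m (r - y)) * (γ (y - q) * m (y - q)) := by ring
          _ ≤ _ := mul_le_mul' (mul_le_mul' le_rfl (hGm _)) (hγm _)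
    _ = c * (P * ∫⁻ q, ∫⁻ r, ∫⁻ y, ‖h y‖ₑ ^ 2 * g₁ (r - y) * g₂ (y - q)) := by
        rw [lintegral_const_mul' _ _ ENNReal.ofReal_ne_top]
        congr 1
        rw [← lintegral_const_mul' _ _ ENNReal.ofReal_ne_top]
        congr 1; ext q
        rw [lintegral_const_mul' _ _ ENNReal.ofReal_ne_top]
    _ = _ := by
        rw [lintegral_triple_convolution (by fun_prop) hg₁m hg₂m, hI₁, hI₂, eLpNorm_two_sq, hc, hP,
          ← mul_assoc, ← mul_assoc, ← ENNReal.ofReal_mul (by positivity),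
          ← ENNReal.ofReal_mul (by positivity), ← ENNReal.ofReal_mul (by positivity)]
        congr 2
        have e1 : μ ^ (-(d : ℝ) / 2) = (1 / √μ) ^ d := by
          rw [one_div, inv_pow, ← Real.rpow_natCast, Real.sqrt_eq_rpow, ← Real.rpow_mul hμ.le,
            ← Real.rpow_neg hμ.le]
          congr 1; ring
        have e2 : (2 * Real.pi * ε) ^ (3 * (d : ℝ) / 2) =
            (2 * Real.pi * ε) ^ d * (2 * Real.pi * ε) ^ ((d : ℝ) / 2) := by
          rw [← Real.rpow_natCast, ← Real.rpow_add (by positivity)]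
          congr 1; ring
        -- The factor `2^d` from the weight cancels the mass `2^{-d}` of `g₁`.
        have e3 : (2 / √μ) ^ d * (1 / 2) ^ d = (1 / √μ) ^ d := by
          rw [← mul_pow]; congr 1; ring
        rw [e1, e2, ← e3]
        ring

end Localised

end FourierOp
end

noncomputable section

namespace FourierOp

/-! ### The weak estimate for general symbols -/

section GeneralSymbol

variable {d : ℕ} {κ : Phase d ≃ Phase d} {ε μ : ℝ} {S : Phase d → ℝ}
  {Θx Θy : Matrix (Fin d) (Fin d) ℂ} {u : Var d → ℂ}

/-- Insert the Green representation of `u` and exchange the integrals. The exchange is justified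
because the integrand is that of a convolution of integrable functions, times a bounded amplitude.
-/
theorem integral_mul_symbol_eq (hu : IsBoundedSymbol u) {f g : E d → ℂ} (hf : Integrable f)
    (hg : Integrable g) (w : Phase d) :
    ∫ z : E d × E d, f z.1 * g z.2 * u (z.1, z.2, w.1, w.2) =
      ∫ ρ : E d × E d, ((∫ x, f x * (green (ρ.1 - x) : ℂ)) * ∫ y, g y * (green (ρ.2 - y) : ℂ)) *
        xyBessel u (ρ.1, ρ.2, w.1, w.2) := by
  obtain ⟨M, hM, hb⟩ := hu.xyBessel.exists_norm_le
  set b : E d × E d → ℂ := fun ρ => xyBessel u (ρ.1, ρ.2, w.1, w.2) with hbdef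
  have hbc : Continuous b := hu.xyBessel.smooth.continuous.comp (by fun_prop)
  set G : E d × E d → ℂ := fun ρ => (green ρ.1 : ℂ) * (green ρ.2 : ℂ) with hG
  have hGi : Integrable G := Integrable.mul_prod integrable_green.ofReal integrable_green.ofReal
  have hfg : Integrable (fun z : E d × E d => f z.1 * g z.2) := hf.mul_prod hg
  have : (volume : Measure (E d × E d)).IsAddHaarMeasure :=
    inferInstanceAs (Measure.prod volume volume).IsAddHaarMeasure
  have hint : Integrable (fun p : (E d × E d) × (E d × E d) =>
      f p.2.1 * g p.2.2 * G (p.1 - p.2) * b p.1) (volume.prod volume) := by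
    refine (hfg.convolution_integrand (ContinuousLinearMap.mul ℝ ℂ) hGi).mul_bdd (c := M)
      (hbc.comp continuous_fst).aestronglyMeasurable (Filter.Eventually.of_forall fun p => hb _)
  have h1 : ∀ z : E d × E d, f z.1 * g z.2 * u (z.1, z.2, w.1, w.2) =
      ∫ ρ, f z.1 * g z.2 * G (ρ - z) * b ρ := by
    intro z
    rw [← hu.integral_xyBessel z.1 z.2 w.1 w.2, ← integral_const_mul]
    congr 1; ext ρ
    simp only [hG, hbdef, Prod.fst_sub, Prod.snd_sub]
    push_cast; ring
  simp only [h1]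
  rw [integral_integral_swap
    (f := fun z ρ : E d × E d => f z.1 * g z.2 * G (ρ - z) * b ρ) hint.swap]
  congr 1; ext ρ
  rw [integral_mul_const]
  congr 1
  have h2 := integral_prod_mul (μ := (volume : Measure (E d))) (ν := (volume : Measure (E d)))
    (fun x => f x * (green (ρ.1 - x) : ℂ)) (fun y => g y * (green (ρ.2 - y) : ℂ))
  rw [← h2]
  refine integral_congr_ae (Filter.Eventually.of_forall fun z => ?_)
  simp only [hG, Prod.fst_sub, Prod.snd_sub]
  ring

/-- At fixed `w` the amplitude is replaced by its supremum, and the double integral over the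
localisation points factors into two `L¹` norms. -/
theorem enorm_integral_wave_le (hε : 0 < ε) (hx : IsAdmissible Θx) (hy : IsAdmissible Θy)
    (hu : IsBoundedSymbol u) {ψ φ : E d → ℂ} (hψm : StronglyMeasurable ψ)
    (hψ : Integrable ψ) (hφ : Integrable φ) (w : Phase d) :
    ‖∫ x, ψ x * wave ε κ S u Θx Θy φ x w‖ₑ ≤ ENNReal.ofReal (4 ^ d * xyNorm (4 * d + 1) u) *
      (totalTransform (1 / ε) ε Θx ψ (κ w) * totalTransform (-(1 / ε)) ε Θy φ w) := by
  set f : E d → ℂ := fun x => ψ x * packet (1 / ε) ε Θx (κ w) x with hf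
  set g : E d → ℂ := fun y => φ y * packet (-(1 / ε)) ε Θy w y with hg
  have hfi : Integrable f := integrable_mul_packet hε hx hψ _
  have hgi : Integrable g := integrable_mul_packet hε hy hφ _
  obtain ⟨M, hM, hb⟩ := hu.exists_norm_le
  have hint : Integrable (fun z : E d × E d => f z.1 * g z.2 * u (z.1, z.2, w.1, w.2)) :=
    (hfi.mul_prod hgi).mul_bdd (c := M)
      (hu.smooth.continuous.comp (by fun_prop)).aestronglyMeasurable
      (Filter.Eventually.of_forall fun z => hb _)
  have e1 : ∫ x, ψ x * wave ε κ S u Θx Θy φ x w = Complex.exp ((S w / ε : ℝ) * Complex.I) *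
      ∫ z : E d × E d, f z.1 * g z.2 * u (z.1, z.2, w.1, w.2) := by
    rw [show (∫ z : E d × E d, f z.1 * g z.2 * u (z.1, z.2, w.1, w.2)) =
      ∫ x, ∫ y, f x * g y * u (x, y, w.1, w.2) from integral_prod _ hint, ← integral_const_mul]
    congr 1; ext x
    rw [wave, ← integral_const_mul, ← integral_const_mul]
    congr 1; ext y
    rw [kern_eq]
    simp only [hf, hg]
    ring
  have e2 : ∀ r, (∫ x, f x * (green (r - x) : ℂ)) = localTransform (1 / ε) ε Θx ψ r (κ w) := by
    intro r
    rw [localTransform, packetTransform]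
    congr 1; ext x
    simp only [hf]; ring
  have e3 : ∀ r, (∫ y, g y * (green (r - y) : ℂ)) = localTransform (-(1 / ε)) ε Θy φ r w := by
    intro r
    rw [localTransform, packetTransform]
    congr 1; ext y
    simp only [hg]; ring
  rw [e1, enorm_mul, enorm_exp_action, one_mul, integral_mul_symbol_eq hu hfi hgi w]
  simp only [e2, e3]
  refine (enorm_integral_le_lintegral_enorm _).trans ?_
  have h4 : ∀ ρ : E d × E d, ‖localTransform (1 / ε) ε Θx ψ ρ.1 (κ w) *
      localTransform (-(1 / ε)) ε Θy φ ρ.2 w * xyBessel u (ρ.1, ρ.2, w.1, w.2)‖ₑ ≤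
      ENNReal.ofReal (4 ^ d * xyNorm (4 * d + 1) u) *
        (‖localTransform (1 / ε) ε Θx ψ ρ.1 (κ w)‖ₑ *
          ‖localTransform (-(1 / ε)) ε Θy φ ρ.2 w‖ₑ) := by
    intro ρ
    rw [enorm_mul, enorm_mul, mul_comm]
    refine mul_le_mul' ?_ le_rfl
    rw [← ofReal_norm]
    exact ENNReal.ofReal_le_ofReal (hu.norm_xyBessel_le _)
  refine (lintegral_mono h4).trans ?_
  rw [lintegral_const_mul' _ _ ENNReal.ofReal_ne_top]
  refine mul_le_mul' le_rfl ((lintegral_prod_le _).trans (le_of_eq ?_))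
  have h5 : ∀ x, ∫⁻ y, ‖localTransform (1 / ε) ε Θx ψ x (κ w)‖ₑ *
      ‖localTransform (-(1 / ε)) ε Θy φ y w‖ₑ = ‖localTransform (1 / ε) ε Θx ψ x (κ w)‖ₑ *
        totalTransform (-(1 / ε)) ε Θy φ w :=
    fun x => lintegral_const_mul' _ _ enorm_ne_top
  simp only [h5]
  refine lintegral_mul_const _ ?_
  exact (stronglyMeasurable_localTransform hψm).enorm.comp
    (f := fun r : E d => (r, κ w)) (by fun_prop)

/-- The weak estimate for symbols that depend on all variables. -/
theorem weakBound_of_symbol (hκ : IsCanonical κ) (hε : 0 < ε) (hε1 : ε ≤ 1) (hx : IsAdmissible Θx)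
    (hy : IsAdmissible Θy) (hμ : 0 < μ) (hμ1 : μ ≤ 1) (hμx : ∀ v, μ * ‖v‖ ^ 2 ≤ (quad Θx v).re)
    (hμy : ∀ v, μ * ‖v‖ ^ 2 ≤ (quad Θy v).re) (hu : IsBoundedSymbol u) :
    WeakBound ε κ S u Θx Θy (4 ^ d * Real.exp (d / 2) * μ ^ (-(d : ℝ) / 2) *
      (xyNorm (4 * d + 1) u / ((reMat Θx).det * (reMat Θy).det) ^ (1 / 4 : ℝ))) := by
  intro φ ψ hψm hψ
  have hφm : StronglyMeasurable φ := φ.continuous.stronglyMeasurable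
  have hdx := hx.posDef.det_pos
  have hdy := hy.posDef.det_pos
  have hN := xyNorm_nonneg (4 * d + 1) u
  set B : ℝ := Real.exp (d / 2) * μ ^ (-(d : ℝ) / 2) * (2 * Real.pi * ε) ^ (3 * (d : ℝ) / 2) with hB
  have hB0 : 0 ≤ B := by positivity
  have h2 := hκ.lintegral_mul_le (measurable_totalTransform hψm) (measurable_totalTransform hφm)
    (by positivity) _ _
    (lintegral_totalTransform_sq_le hε hε1 (abs_one_div hε) hx hμ hμ1 hμx hψm hψ)
    (lintegral_totalTransform_sq_le hε hε1 (abs_neg_one_div hε) hy hμ hμ1 hμy hφm φ.integrable)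
  rw [sqrt_mul_det hB0 hdx hdy] at h2
  have h3 : ∫⁻ w, ‖∫ x, ψ x * wave ε κ S u Θx Θy φ x w‖ₑ ≤
      ENNReal.ofReal (4 ^ d * xyNorm (4 * d + 1) u) *
        (ENNReal.ofReal (B / ((reMat Θx).det * (reMat Θy).det) ^ (1 / 4 : ℝ)) *
          eLpNorm ψ 2 volume * eLpNorm φ 2 volume) := by
    refine (lintegral_mono fun w => enorm_integral_wave_le hε hx hy hu hψm hψ φ.integrable w).trans ?_
    rw [lintegral_const_mul' _ _ ENNReal.ofReal_ne_top]
    exact mul_le_mul' le_rfl h2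
  refine (mul_le_mul' le_rfl h3).trans (le_of_eq ?_)
  have e : 4 ^ d * Real.exp (d / 2) * μ ^ (-(d : ℝ) / 2) *
      (xyNorm (4 * d + 1) u / ((reMat Θx).det * (reMat Θy).det) ^ (1 / 4 : ℝ)) =
      ((2 * Real.pi * ε) ^ (3 * (d : ℝ) / 2))⁻¹ * ((4 ^ d * xyNorm (4 * d + 1) u) *
        (B / ((reMat Θx).det * (reMat Θy).det) ^ (1 / 4 : ℝ))) := by
    have hne : (2 * Real.pi * ε) ^ (3 * (d : ℝ) / 2) ≠ 0 := (by positivity : (0 : ℝ) < _).ne'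
    rw [hB]; field_simp
  rw [e, ENNReal.ofReal_mul (p := ((2 * Real.pi * ε) ^ (3 * (d : ℝ) / 2))⁻¹) (by positivity),
    ENNReal.ofReal_mul (p := 4 ^ d * xyNorm (4 * d + 1) u) (by positivity)]
  ring

end GeneralSymbol

/-- Used with the projection to `(q, p)`, to view a phase space symbol as one in all four variables.
-/
theorem IsBoundedSymbol.comp_clm {V V' W : Type*} [NormedAddCommGroup V] [NormedSpace ℝ V]
    [NormedAddCommGroup V'] [NormedSpace ℝ V'] [NormedAddCommGroup W] [NormedSpace ℝ W]
    {a : V → W} (ha : IsBoundedSymbol a) (L : V' →L[ℝ] V) : IsBoundedSymbol (fun z => a (L z)) where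
  smooth := ha.smooth.comp L.contDiff
  bounded k := by
    obtain ⟨M, hM⟩ := ha.bounded k
    refine ⟨M * ‖L‖ ^ k, fun z => ?_⟩
    have h1 := L.iteratedFDeriv_comp_right (ha.smooth) z (i := k) (by exact_mod_cast le_top)
    change ‖iteratedFDeriv ℝ k (a ∘ L) z‖ ≤ _
    rw [h1]
    refine (ContinuousMultilinearMap.norm_compContinuousLinearMap_le _ _).trans ?_
    simp only [Finset.prod_const, Finset.card_univ, Fintype.card_fin]
    exact mul_le_mul_of_nonneg_right (hM _) (by positivity)

/-- The only place where `η` meets the operator bound. Since `μ η² ≤ μ ≤ 1`, both lowering the base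
and raising the exponent from `d/2` to `(4d + 1)/4` increase the negative power. -/
theorem rpow_neg_le_one_add {d : ℕ} {μ η : ℝ} (hμ : 0 < μ) (hμ1 : μ ≤ 1) (hη : 0 < η)
    (hη1 : η ≤ 1) :
    μ ^ (-(d : ℝ) / 2) ≤ 1 + 1 / (μ * η ^ 2) ^ ((4 * (d : ℝ) + 1) / 4) := by
  have h0 : 0 < μ * η ^ 2 := by positivity
  have h1 : μ * η ^ 2 ≤ μ := mul_le_of_le_one_right hμ.le (pow_le_one₀ hη.le hη1)
  have hd : (0 : ℝ) ≤ d := d.cast_nonneg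
  calc μ ^ (-(d : ℝ) / 2) ≤ (μ * η ^ 2) ^ (-(d : ℝ) / 2) :=
        Real.rpow_le_rpow_of_nonpos h0 h1 (by linarith)
    _ ≤ (μ * η ^ 2) ^ (-((4 * (d : ℝ) + 1) / 4)) :=
        Real.rpow_le_rpow_of_exponent_ge h0 (h1.trans hμ1) (by linarith)
    _ = 1 / (μ * η ^ 2) ^ ((4 * (d : ℝ) + 1) / 4) := by rw [Real.rpow_neg h0.le, one_div]
    _ ≤ _ := by linarith

end FourierOp
end

/-! ### The main theorem -/

theorem theorem4 (d : ℕ) (hd : 1 ≤ d) :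
    -- symbols depending on all variables; the constant depends on the dimension only
    (∃ C : ℝ, 0 < C ∧
      ∀ (κ : FourierOp.Phase d ≃ FourierOp.Phase d), FourierOp.IsClassB κ →
      ∀ (S : FourierOp.Phase d → ℝ), FourierOp.IsAction κ S →
      ∀ (Θx Θy : Matrix (Fin d) (Fin d) ℂ), FourierOp.IsAdmissible Θx → FourierOp.IsAdmissible Θy →
      ∀ (lx ly : ℝ), 0 < lx → 0 < ly →
        (FourierOp.reMat Θx - lx • (1 : Matrix (Fin d) (Fin d) ℝ)).PosSemidef →
        (FourierOp.reMat Θy - ly • (1 : Matrix (Fin d) (Fin d) ℝ)).PosSemidef →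
      ∀ (u : FourierOp.Var d → ℂ), FourierOp.IsBoundedSymbol u →
      ∀ (ε : ℝ), 0 < ε → ε ≤ 1 →
        -- the integrals defining the operator converge absolutely
        (∀ k : ℕ, d < k → ∀ (φ : SchwartzMap (FourierOp.E d) ℂ) (x : FourierOp.E d),
          MeasureTheory.Integrable (FourierOp.integrand ε κ S u Θx Θy k φ x)) ∧
        (∃! T : FourierOp.L2 d →L[ℂ] FourierOp.L2 d, FourierOp.IsL2Extension ε κ S u Θx Θy T) ∧
        (∀ T : FourierOp.L2 d →L[ℂ] FourierOp.L2 d, FourierOp.IsL2Extension ε κ S u Θx Θy T →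
          ‖T‖ ≤ C *
            (1 + 1 / (min 1 (min lx ly) * FourierOp.eta κ Θx Θy ^ 2) ^ ((4 * (d : ℝ) + 1) / 4)) *
            (FourierOp.xyNorm (4 * d + 1) u /
              ((FourierOp.reMat Θx).det * (FourierOp.reMat Θy).det) ^ (1 / 4 : ℝ)))) ∧
    -- symbols independent of `(x, y)`
    (∀ (κ : FourierOp.Phase d ≃ FourierOp.Phase d), FourierOp.IsClassB κ →
      ∀ (S : FourierOp.Phase d → ℝ), FourierOp.IsAction κ S →
      ∀ (Θx Θy : Matrix (Fin d) (Fin d) ℂ), FourierOp.IsAdmissible Θx → FourierOp.IsAdmissible Θy →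
      ∀ (a : FourierOp.Phase d → ℂ), FourierOp.IsBoundedSymbol a →
      ∀ (ε : ℝ), 0 < ε → ε ≤ 1 →
        (∃! T : FourierOp.L2 d →L[ℂ] FourierOp.L2 d,
          FourierOp.IsL2Extension ε κ S (fun (_, _, q, p) => a (q, p)) Θx Θy T) ∧
        (∀ T : FourierOp.L2 d →L[ℂ] FourierOp.L2 d,
          FourierOp.IsL2Extension ε κ S (fun (_, _, q, p) => a (q, p)) Θx Θy T →
          ‖T‖ ≤ (2 : ℝ) ^ (-(d : ℝ) / 2) *
            ((⨆ z : FourierOp.Phase d, ‖a z‖) /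
              ((FourierOp.reMat Θx).det * (FourierOp.reMat Θy).det) ^ (1 / 4 : ℝ)))) := by
  -- The factor `4^d` counts the terms of the expanded operator `∏ (1 - ∂_j²)`; `e^{d/2}` is the
  -- loss when the Gaussian absorbs the exponential weight.
  refine ⟨⟨4 ^ d * Real.exp (d / 2), by positivity, ?_⟩, ?_⟩
  · intro κ hκ S hS Θx Θy hx hy lx ly hlx hly hΘx hΘy u hu ε hε hε1
    have hκc : Continuous κ := hκ.canonical.smooth.continuous
    have hSc : Continuous S := hS.differentiable.continuous
    have hμ : 0 < min 1 (min lx ly) := lt_min one_pos (lt_min hlx hly)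
    have hμ1 : min 1 (min lx ly) ≤ 1 := min_le_left _ _
    have hμx : ∀ v, min 1 (min lx ly) * ‖v‖ ^ 2 ≤ (FourierOp.quad Θx v).re := fun v =>
      (mul_le_mul_of_nonneg_right ((min_le_right _ _).trans (min_le_left _ _))
        (sq_nonneg _)).trans (FourierOp.mul_norm_sq_le_quad_re hΘx v)
    have hμy : ∀ v, min 1 (min lx ly) * ‖v‖ ^ 2 ≤ (FourierOp.quad Θy v).re := fun v =>
      (mul_le_mul_of_nonneg_right ((min_le_right _ _).trans (min_le_right _ _))
        (sq_nonneg _)).trans (FourierOp.mul_norm_sq_le_quad_re hΘy v)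
    have hdx := hx.posDef.det_pos
    have hdy := hy.posDef.det_pos
    have hN := FourierOp.xyNorm_nonneg (4 * d + 1) u
    obtain ⟨hη, hη1⟩ := FourierOp.eta_pos_le_one hd hκ hx hy
    obtain ⟨hT, hnorm⟩ := FourierOp.existsUnique_extension hκc hSc hε hx hy hu (by positivity)
      (FourierOp.weakBound_of_symbol hκ.canonical hε hε1 hx hy hμ hμ1 hμx hμy hu)
    refine ⟨fun k hk φ x => FourierOp.integrable_integrand hκc hSc hε hx hy hu hk φ x, hT,
      fun T hTT => (hnorm T hTT).trans ?_⟩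
    exact mul_le_mul_of_nonneg_right (mul_le_mul_of_nonneg_left
      (FourierOp.rpow_neg_le_one_add hμ hμ1 hη hη1) (by positivity)) (by positivity)
  · intro κ hκ S hS Θx Θy hx hy a ha ε hε _
    have hdx := hx.posDef.det_pos
    have hdy := hy.posDef.det_pos
    have ha0 : 0 ≤ ⨆ z, ‖a z‖ := Real.iSup_nonneg fun z => norm_nonneg _
    exact FourierOp.existsUnique_extension hκ.canonical.smooth.continuous
      hS.differentiable.continuous hε hx hy
      (ha.comp_clm ((ContinuousLinearMap.snd ℝ (FourierOp.E d) (FourierOp.Phase d)).comp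
        (ContinuousLinearMap.snd ℝ (FourierOp.E d) (FourierOp.E d × FourierOp.Phase d))))
      (by positivity) (FourierOp.weakBound_of_phase_symbol hκ.canonical hε hx hy ha)
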